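/- Let $(M,g)$ be a smooth $n$-dimensional Riemannian manifold without boundary (not necessarily compact or connected) and let $L:TM\to\mathbb R$ be a smooth autonomous Lagrangian which is exactly quadratic in the velocities, i.e. for every $q\in M$ the function $v\mapsto L(q,v)$ is a polynomial of degree at most $2$ on $T_qM$. Let $\Lambda^1(M)$ be the Hilbert manifold of $1$-periodic loops in $M$ of Sobolev class $H^1$, and for $x\in\Lambda^1(M)$ let $\mathcal H(x)=T_x\Lambda^1(M)$ be the space of $1$-periodic $H^1$ vector fields along $x$. For $h\in\mathbb R$ consider the free period action functional $$\mathbb E_h(x,T)=T\int_0^1\big(L(x(t),x'(t)/T)+h\big)\,dt,\qquad (x,T)\in\Lambda^1(M)\times(0,+\infty),$$ and, for fixed $T>0$, the fixed period action functional $\mathbb E_h^T=\mathbb E_h(\cdot,T)$ on $\Lambda^1(M)$. Let $(x,T)$ be a critical point of $\mathbb E_h$; then $x$ is a critical point of $\mathbb E_h^T$. Denote by $\iota_{\mathrm{Mor}}(x,T)$ the Morse index of the second variation $d^2\mathbb E_h(x,T)$ on $\mathcal H(x)\times\mathbb R$, and by $\iota^T_{\mathrm{Mor}}(x)$ the Morse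 index of the second variation $d^2\mathbb E_h^T(x)$ on $\mathcal H(x)$, where the Morse index of a quadratic form is the supremum of the dimensions of the subspaces on which it is negative definite. Assume that $(x,T)$ admits an orbit cylinder: there are $\varepsilon>0$ and a smooth family $(x_{e},T_{e})$, $e\in(h-\varepsilon,h+\varepsilon)$, such that $(x_e,T_e)$ is a critical point of $\mathbb E_e$ for every $e$ and $(x_h,T_h)=(x,T)$. Let $T'(h)=\frac{d}{de}\big|_{e=h}T_e$ (it may vanish, i.e. the orbit cylinder may be degenerate). If $L$ is $C^2$-strictly convex on the fibers of $TM$, that is, if $d_{vv}L(q,v)$ is positive definite for every $(q,v)\in TM$, then both Morse indices are finite and $$\iota_{\mathrm{Mor}}(x,T)-\iota^T_{\mathrm{Mor}}(x)=\begin{cases}1 & \text{if } T'(h)\ge 0,\\ 0 & \text{if } T'(h)<0.\end{cases}$$ -/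

import Mathlib

open scoped Manifold ContDiff Bundle
open MeasureTheory Set

noncomputable section

/-- A `1`-periodic loop of Sobolev class `H¹` in a manifold `N`: a continuous `1`-periodic map
`ℝ → N` which, in the charts of `N`, is locally the primitive of a square-integrable function. -/
def IsH1Loop {E H N : Type*} [NormedAddCommGroup E] [NormedSpace ℝ E] [TopologicalSpace H]
    (I : ModelWithCorners ℝ E H) [TopologicalSpace N] [ChartedSpace H N] (x : ℝ → N) : Prop :=
  Function.Periodic x 1 ∧ Continuous x ∧
    ∀ t₀ : ℝ, ∃ δ > 0, ∃ u : ℝ → E,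
      MemLp u 2 (volume.restrict (Icc (t₀ - δ) (t₀ + δ))) ∧
      ∀ t ∈ Icc (t₀ - δ) (t₀ + δ),
        x t ∈ (extChartAt I (x t₀)).source ∧
        extChartAt I (x t₀) (x t) = extChartAt I (x t₀) (x t₀) + ∫ s in t₀..t, u s

section Manifold

variable {n : ℕ} {M : Type*} [TopologicalSpace M] [ChartedSpace (EuclideanSpace ℝ (Fin n)) M]
  [IsManifold (𝓡 n) ∞ M]

/-- The space `𝓗(x)` of `1`-periodic vector fields of class `H¹` along the loop `x`, that is of
the `H¹` loops `t ↦ (x t, ξ t)` in the tangent bundle. -/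
def H1Fields (x : ℝ → M) : Set (∀ t, TangentSpace (𝓡 n) (x t)) :=
  {ξ | IsH1Loop (𝓡 n).tangent (fun t => (⟨x t, ξ t⟩ : TangentBundle (𝓡 n) M))}

/-- The vector of `T_q M` with components `v` in the coordinates around `p`. -/
def vecOfCoord (p q : M) (v : EuclideanSpace ℝ (Fin n)) : TangentSpace (𝓡 n) q :=
  (trivializationAt (EuclideanSpace ℝ (Fin n)) (TangentSpace (𝓡 n) : M → Type) p).symmL ℝ q v

/-- The components, in the coordinates around `p`, of the vector field `ξ` along `x`. -/
def fieldCoord (x : ℝ → M) (ξ : ∀ t, TangentSpace (𝓡 n) (x t)) (p : M) (t : ℝ) :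
    EuclideanSpace ℝ (Fin n) :=
  (trivializationAt (EuclideanSpace ℝ (Fin n)) (TangentSpace (𝓡 n) : M → Type) p
    (⟨x t, ξ t⟩ : TangentBundle (𝓡 n) M)).2

/-- The Lagrangian `L(q, v)` in the coordinates around `p`. -/
def lagrangianCoord (L : TangentBundle (𝓡 n) M → ℝ) (p : M)
    (q v : EuclideanSpace ℝ (Fin n)) : ℝ :=
  L ⟨(extChartAt (𝓡 n) p).symm q, vecOfCoord p ((extChartAt (𝓡 n) p).symm q) v⟩

/-- The type of smooth Riemannian metrics on `M`. -/
abbrev SmoothMetric (n : ℕ) (M : Type*) [TopologicalSpace M]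
    [ChartedSpace (EuclideanSpace ℝ (Fin n)) M] [IsManifold (𝓡 n) ∞ M] : Type _ :=
  Bundle.ContMDiffRiemannianMetric (𝓡 n) ∞ (EuclideanSpace ℝ (Fin n))
    (fun q : M => TangentSpace (𝓡 n) q)

/-- The matrix `g_{ij}(q)` of the metric in the coordinates around `p`. -/
def metricCoord (g : SmoothMetric n M) (p : M) (q : EuclideanSpace ℝ (Fin n)) :
    Matrix (Fin n) (Fin n) ℝ :=
  Matrix.of fun i j =>
    g.inner ((extChartAt (𝓡 n) p).symm q)
      (vecOfCoord p ((extChartAt (𝓡 n) p).symm q) (EuclideanSpace.single i 1))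
      (vecOfCoord p ((extChartAt (𝓡 n) p).symm q) (EuclideanSpace.single j 1))

/-- The partial derivative `∂_k g_{ij}(q)` in the coordinates around `p`. -/
def metricPartial (g : SmoothMetric n M) (p : M) (q : EuclideanSpace ℝ (Fin n))
    (k i j : Fin n) : ℝ :=
  fderiv ℝ (fun y => metricCoord g p y i j) q (EuclideanSpace.single k 1)

/-- The Christoffel symbol
`Γ^k_{ij} = ½ ∑_l g^{kl} (∂_i g_{jl} + ∂_j g_{il} - ∂_l g_{ij})` of the Levi-Civita connection, in
the coordinates around `p`. -/
def christoffel (g : SmoothMetric n M) (p : M) (q : EuclideanSpace ℝ (Fin n))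
    (k i j : Fin n) : ℝ :=
  (1 / 2) * ∑ l, (metricCoord g p q)⁻¹ k l *
    (metricPartial g p q i j l + metricPartial g p q j i l - metricPartial g p q l i j)

/-- The vector with components `∑_{i,j} Γ^k_{ij}(q) v^i v^j`. -/
def christoffelQuad (g : SmoothMetric n M) (p : M) (q v : EuclideanSpace ℝ (Fin n)) :
    EuclideanSpace ℝ (Fin n) :=
  WithLp.toLp 2 fun k => ∑ i, ∑ j, christoffel g p q k i j * v i * v j

/-- In the coordinates around `p`, the variation `x_r(s) = exp_{x(s)} (r ξ(s))` of `x` up to terms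
of order `r³`. (A geodesic `γ` with `γ(0) = q`, `γ'(0) = v` has the coordinate expansion
`γ(r) = q + r v - (r² / 2) Γ(q)(v, v) + O(r³)`.) -/
def variationCoord (g : SmoothMetric n M) (x : ℝ → M) (ξ : ∀ t, TangentSpace (𝓡 n) (x t))
    (p : M) (r s : ℝ) : EuclideanSpace ℝ (Fin n) :=
  extChartAt (𝓡 n) p (x s) + r • fieldCoord x ξ p s
    - (r ^ 2 / 2) • christoffelQuad g p (extChartAt (𝓡 n) p (x s)) (fieldCoord x ξ p s)

/-- The integrand `T_r (L(x_r(t), x_r'(t) / T_r) + h)` of the free period action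
`𝔼_h(x_r, T_r) = T_r ∫₀¹ (L(x_r(t), x_r'(t) / T_r) + h) dt` along the variation
`x_r = exp_x (r ξ)`, `T_r = T + r b`, computed in the coordinates around `x t`. Its value is
correct up to terms of order `r³`, which do not contribute to the first two derivatives at
`r = 0`. -/
def actionDensity (g : SmoothMetric n M) (L : TangentBundle (𝓡 n) M → ℝ) (h : ℝ)
    (x : ℝ → M) (T : ℝ) (ξ : ∀ t, TangentSpace (𝓡 n) (x t)) (b : ℝ) (r t : ℝ) : ℝ :=
  (T + r * b) *
    (lagrangianCoord L (x t) (variationCoord g x ξ (x t) r t)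
      ((T + r * b)⁻¹ • deriv (fun s => variationCoord g x ξ (x t) r s) t) + h)

/-- The first variation `d𝔼_h(x, T)[(ξ, b)]` of the free period action. -/
def firstVariation (g : SmoothMetric n M) (L : TangentBundle (𝓡 n) M → ℝ) (h : ℝ)
    (x : ℝ → M) (T : ℝ) (ξ : ∀ t, TangentSpace (𝓡 n) (x t)) (b : ℝ) : ℝ :=
  ∫ t in (0 : ℝ)..1, deriv (fun r => actionDensity g L h x T ξ b r t) 0

/-- The second variation `d²𝔼_h(x, T)[(ξ, b), (ξ, b)]` of the free period action. -/
def secondVariation (g : SmoothMetric n M) (L : TangentBundle (𝓡 n) M → ℝ) (h : ℝ)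
    (x : ℝ → M) (T : ℝ) (ξ : ∀ t, TangentSpace (𝓡 n) (x t)) (b : ℝ) : ℝ :=
  ∫ t in (0 : ℝ)..1, iteratedDeriv 2 (fun r => actionDensity g L h x T ξ b r t) 0

/-- `(x, T)` is a critical point of `𝔼_h` on the space of pairs of an `H¹` loop of period `1` and
a positive number. -/
def IsFreePeriodCritical (g : SmoothMetric n M) (L : TangentBundle (𝓡 n) M → ℝ) (h : ℝ)
    (x : ℝ → M) (T : ℝ) : Prop :=
  IsH1Loop (𝓡 n) x ∧ 0 < T ∧ ∀ ξ ∈ H1Fields x, ∀ b : ℝ, firstVariation g L h x T ξ b = 0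

/-- An orbit cylinder about the critical point `(x, T)` of `𝔼_h`: a smooth family
`(X e, P e)`, `e ∈ (h - ε, h + ε)`, of critical points of `𝔼_e` with `(X h, P h) = (x, T)`. The
parameter is the energy, so that `P` is the period as a function of the energy. -/
structure IsOrbitCylinder (g : SmoothMetric n M) (L : TangentBundle (𝓡 n) M → ℝ) (h : ℝ)
    (x : ℝ → M) (T : ℝ) (ε : ℝ) (X : ℝ → ℝ → M) (P : ℝ → ℝ) : Prop where
  pos : 0 < ε
  smooth_loops : ContMDiffOn 𝓘(ℝ, ℝ × ℝ) (𝓡 n) ∞ (fun z : ℝ × ℝ => X z.1 z.2)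
    (Ioo (h - ε) (h + ε) ×ˢ univ)
  smooth_period : ContDiffOn ℝ ∞ P (Ioo (h - ε) (h + ε))
  critical : ∀ e ∈ Ioo (h - ε) (h + ε), IsFreePeriodCritical g L e (X e) (P e)
  loop_eq : X h = x
  period_eq : P h = T

/-- `L` is exactly quadratic in the velocities: on each fiber it is a polynomial of degree at
most `2`. -/
def IsExactlyQuadratic (L : TangentBundle (𝓡 n) M → ℝ) : Prop :=
  ∀ q : M, ∃ (B : TangentSpace (𝓡 n) q →ₗ[ℝ] TangentSpace (𝓡 n) q →ₗ[ℝ] ℝ)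
    (l : TangentSpace (𝓡 n) q →ₗ[ℝ] ℝ) (c : ℝ),
    ∀ v : TangentSpace (𝓡 n) q, L ⟨q, v⟩ = B v v + l v + c

/-- `L` is `C²`-strictly convex on the fibers: `d_{vv} L(q, v)[w, w] > 0` for all `w ≠ 0`. -/
def IsFiberStrictlyConvex (L : TangentBundle (𝓡 n) M → ℝ) : Prop :=
  ∀ (q : M) (v w : TangentSpace (𝓡 n) q), w ≠ 0 →
    0 < iteratedDeriv 2 (fun r : ℝ => L ⟨q, v + r • w⟩) 0

end Manifold

/-- The Morse index of the quadratic form `Q` on the linear subspace `A` of `V`: the supremum of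
the dimensions of the finite-dimensional subspaces of `A` on which `Q` is negative definite. -/
def morseIndex {V : Type*} [AddCommGroup V] [Module ℝ V] (A : Set V) (Q : V → ℝ) : ℕ∞ :=
  ⨆ (W : Submodule ℝ V) (_ : FiniteDimensional ℝ W) (_ : (W : Set V) ⊆ A)
    (_ : ∀ w ∈ W, w ≠ 0 → Q w < 0), (Module.finrank ℝ W : ℕ∞)

section Indices

variable {n : ℕ} {M : Type*} [TopologicalSpace M] [ChartedSpace (EuclideanSpace ℝ (Fin n)) M]
  [IsManifold (𝓡 n) ∞ M]

/-- The Morse index of `(x, T)` as a critical point of the free period action `𝔼_h`, on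
`𝓗(x) × ℝ`. -/
def freeMorseIndex (g : SmoothMetric n M) (L : TangentBundle (𝓡 n) M → ℝ) (h : ℝ)
    (x : ℝ → M) (T : ℝ) : ℕ∞ :=
  morseIndex (V := (∀ t, TangentSpace (𝓡 n) (x t)) × ℝ) (H1Fields x ×ˢ univ)
    (fun v => secondVariation g L h x T v.1 v.2)

/-- The Morse index of `x` as a critical point of the fixed period action, the restriction of
`𝔼_h` to the loops with the period `T`, on `𝓗(x)`. -/
def fixedMorseIndex (g : SmoothMetric n M) (L : TangentBundle (𝓡 n) M → ℝ) (h : ℝ)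
    (x : ℝ → M) (T : ℝ) : ℕ∞ :=
  morseIndex (V := ∀ t, TangentSpace (𝓡 n) (x t)) (H1Fields x)
    (fun ξ => secondVariation g L h x T ξ 0)

end Indices

end

/-! Let β be the second variation d²𝔼_h(x,T), polarized to a symmetric bilinear form on 𝓗(x) × ℝ
(`indexForm`); the fixed period form is its restriction to the hyperplane 𝓗(x) × 0. Differentiate
d𝔼_e(x_e,T_e) = 0 in e at e = h. Since 𝔼_e depends on e only through the summand eT, the velocity z
= (ζ, T'(h)) of the cylinder satisfies β(z,(η,c)) = -c for all (η,c): it is β-orthogonal to the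
hyperplane, and β(z,z) = -T'(h).

The rest is linear algebra (`morseIndex_prod_sub`). Passing from the hyperplane to the whole space
raises a finite index by 0 or 1. If T'(h) < 0, the whole space is the orthogonal sum of the
hyperplane and a positive line. If T'(h) > 0, that line is negative. If T'(h) = 0, then z lies in
the hyperplane, in the radical of the restricted form, but pairs nontrivially with (0,1); this
hyperbolic pair contributes one negative direction. The last two cases are handled together by
adding a large multiple of z to a vector with second component 1.

The relation for z is proved locally. With G(q,v,τ) = τ(L(q,v/τ)+h), linearizing the Euler-Lagrange
equation and the energy identity ∂_τ G = 0 along the cylinder shows that the density of β(z,(η,c)),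
plus c, is the time derivative of a 1-periodic function, the linearized momentum paired with η
(`IsOrbitCylinder.hasDerivAt_jacobiMomentum`). Integrating over a period gives the relation
(`IsOrbitCylinder.indexForm_familyField`).

Finiteness follows from convexity: the form is positive definite in the velocities, so by Poincaré's
inequality it is nonnegative on fields vanishing at sufficiently many points of the circle, and a
negative subspace is determined by its values at these points (`fixedMorseIndex_ne_top`).

The second variation is defined by a density computed at time t in the chart around x(t), a chart
that moves with t. To work in a fixed chart on a short interval one needs pointwise invariance of
the density (`hessForm_velocityMap`, `secondDensity_trans`), which rests on the transformation law
of the Christoffel symbols and on its derivative. The loops of the cylinder are smooth, so only the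
fields have H¹ regularity; their components are absolutely continuous, and identities between
densities hold almost everywhere. -/

noncomputable section

/-! ### Linear algebra of the Morse index on a hyperplane. -/

section MorseIndex

variable {V V' : Type*} [AddCommGroup V] [Module ℝ V] [AddCommGroup V'] [Module ℝ V']

theorem finrank_le_morseIndex {A : Set V} {Q : V → ℝ} {W : Submodule ℝ V}
    [hW : FiniteDimensional ℝ W] (hA : (W : Set V) ⊆ A) (hQ : ∀ w ∈ W, w ≠ 0 → Q w < 0) :
    (Module.finrank ℝ W : ℕ∞) ≤ morseIndex A Q :=
  le_iSup_of_le W <| le_iSup_of_le hW <| le_iSup_of_le hA <| le_iSup_of_le hQ le_rfl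

theorem morseIndex_le_iff {A : Set V} {Q : V → ℝ} {k : ℕ∞} :
    morseIndex A Q ≤ k ↔ ∀ W : Submodule ℝ V, FiniteDimensional ℝ W → (W : Set V) ⊆ A →
      (∀ w ∈ W, w ≠ 0 → Q w < 0) → (Module.finrank ℝ W : ℕ∞) ≤ k := by
  simp only [morseIndex, iSup_le_iff]

/-- A linear map along which the quadratic form does not increase increases the Morse index. -/
theorem morseIndex_le_of_linearMap {A : Set V} {A' : Set V'} {Q : V → ℝ} {Q' : V' → ℝ}
    (f : V →ₗ[ℝ] V') (hA : ∀ w ∈ A, f w ∈ A') (h0 : 0 ≤ Q' 0) (hQ : ∀ w ∈ A, Q' (f w) ≤ Q w) :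
    morseIndex A Q ≤ morseIndex A' Q' := by
  rw [morseIndex_le_iff]
  intro W _ hWA hW
  have hinj : Function.Injective (f.domRestrict W) := by
    rw [injective_iff_map_eq_zero]
    rintro ⟨w, hw⟩ hfw
    by_contra hne
    -- A vector on which `Q` is negative cannot be in the kernel of `f`, since that would force `Q'
    -- 0 < 0`. As `Q'` is an arbitrary function, `h0` replaces homogeneity.
    have h1 := hW w hw (fun h => hne (by simpa using h))
    have h2 := hQ w (hWA hw)
    rw [LinearMap.domRestrict_apply] at hfw
    simp only at hfw
    rw [hfw] at h2
    linarith
  have hfin : Module.finrank ℝ (W.map f) = Module.finrank ℝ W := by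
    rw [← LinearMap.range_domRestrict]
    exact LinearMap.finrank_range_of_inj hinj
  rw [← hfin]
  apply finrank_le_morseIndex
  · rintro _ ⟨w, hw, rfl⟩
    exact hA w (hWA hw)
  · rintro _ ⟨w, hw, rfl⟩ hne
    have hw0 : w ≠ 0 := by rintro rfl; simp at hne
    exact (hQ w (hWA hw)).trans_lt (hW w hw hw0)

/-- Comparison maps must be defined on the whole ambient space, so the inclusion is inverted by a
linear retraction onto `A`. -/
theorem morseIndex_submodule (A : Submodule ℝ V) (Q : V → ℝ) (h0 : 0 ≤ Q 0) :
    morseIndex (A : Set V) Q = morseIndex (univ : Set A) (fun w => Q w) := by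
  apply le_antisymm
  · obtain ⟨f, hf⟩ := A.subtype.exists_leftInverse_of_injective A.ker_subtype
    have hf' : ∀ w (hw : w ∈ A), f w = ⟨w, hw⟩ := fun w hw => LinearMap.congr_fun hf ⟨w, hw⟩
    exact morseIndex_le_of_linearMap f (by simp) (by simpa using h0)
      (fun w hw => by rw [hf' w hw])
  · exact morseIndex_le_of_linearMap A.subtype (by simp) h0 (by simp)

variable {H : Type*} [AddCommGroup H] [Module ℝ H]

/-- The hyperplane `H × 0` cuts any negative subspace in codimension at most one. -/
theorem morseIndex_prod_le_add_one (Q : H × ℝ → ℝ) :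
    morseIndex univ Q ≤ morseIndex univ (fun η : H => Q (η, 0)) + 1 := by
  rw [morseIndex_le_iff]
  intro W _ _ hW
  have hinl : Function.Injective (LinearMap.inl ℝ H ℝ) := LinearMap.inl_injective
  let K : Submodule ℝ H := W.comap (LinearMap.inl ℝ H ℝ)
  let i : K →ₗ[ℝ] W := (LinearMap.inl ℝ H ℝ).restrict (p := K) (q := W) (fun _ hx => hx)
  have hi : Function.Injective i := fun a b hab =>
    Subtype.ext (hinl (congrArg Subtype.val hab))
  have : FiniteDimensional ℝ K := FiniteDimensional.of_injective i hi
  let f : W →ₗ[ℝ] ℝ := (LinearMap.snd ℝ H ℝ).domRestrict W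
  have hker : LinearMap.ker f ≤ LinearMap.range i := by
    rintro ⟨⟨η, b⟩, hw⟩ hb
    have hb' : b = 0 := hb
    subst hb'
    exact ⟨⟨η, hw⟩, rfl⟩
  have h1 : Module.finrank ℝ W ≤ Module.finrank ℝ K + 1 := by
    have h1 := LinearMap.finrank_range_add_finrank_ker f
    have h2 : Module.finrank ℝ (LinearMap.range f) ≤ 1 := by
      simpa using Submodule.finrank_le (LinearMap.range f)
    have h3 := Submodule.finrank_mono hker
    have h4 := LinearMap.finrank_range_le i
    omega
  have h5 : (Module.finrank ℝ K : ℕ∞) ≤ morseIndex univ (fun η : H => Q (η, 0)) :=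
    finrank_le_morseIndex (subset_univ _) fun η hη hne =>
      hW (η, 0) hη (fun h => hne (congrArg Prod.fst h))
  calc (Module.finrank ℝ W : ℕ∞) ≤ ((Module.finrank ℝ K + 1 : ℕ) : ℕ∞) := by exact_mod_cast h1
    _ ≤ _ := by push_cast; gcongr

/-- On a finite-dimensional subspace where a symmetric bilinear form is negative definite, every
vector has an orthogonal projection. -/
theorem exists_orthogonal_projection_of_neg (β : V →ₗ[ℝ] V →ₗ[ℝ] ℝ) (W : Submodule ℝ V)
    [FiniteDimensional ℝ W] (hW : ∀ w ∈ W, w ≠ 0 → β w w < 0) (v : V) :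
    ∃ w₀ ∈ W, ∀ w ∈ W, β (v - w₀) w = 0 := by
  let B : W →ₗ[ℝ] Module.Dual ℝ W := (β.domRestrict₁₂ W W)
  have hB : Function.Injective B := by
    rw [injective_iff_map_eq_zero]
    rintro ⟨w, hw⟩ h
    by_contra hne
    have h1 := hW w hw (fun h => hne (by simpa using h))
    have h2 : B ⟨w, hw⟩ ⟨w, hw⟩ = 0 := by rw [h]; rfl
    have h3 : B ⟨w, hw⟩ ⟨w, hw⟩ = β w w := rfl
    linarith
  have hs : Function.Surjective B :=
    (LinearMap.injective_iff_surjective_of_finrank_eq_finrank Subspace.dual_finrank_eq.symm).1 hB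
  obtain ⟨w₀, hw₀⟩ := hs ((β v).domRestrict W)
  refine ⟨w₀, w₀.2, fun w hw => ?_⟩
  have : B w₀ ⟨w, hw⟩ = β v w := by rw [hw₀]; rfl
  have h3 : B w₀ ⟨w, hw⟩ = β w₀ w := rfl
  rw [map_sub, LinearMap.sub_apply, ← this, h3, sub_self]

variable (β : (H × ℝ) →ₗ[ℝ] (H × ℝ) →ₗ[ℝ] ℝ)

/-- Start from (0,1), make it orthogonal to a given negative subspace of the hyperplane, and add a
large multiple of `z`. The result is still orthogonal to that subspace because `z` is orthogonal to
the hyperplane, and it is negative even when `z` is isotropic. -/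
theorem morseIndex_add_one_le_of_nonneg (hsymm : ∀ v w, β v w = β w v) (z : H × ℝ)
    (hz : ∀ w, β z w = -w.2) (hτ : 0 ≤ z.2) :
    morseIndex univ (fun η : H => β (η, 0) (η, 0)) + 1 ≤ morseIndex univ (fun v => β v v) := by
  suffices hmain : ∀ W : Submodule ℝ H, FiniteDimensional ℝ W → (W : Set H) ⊆ univ →
      (∀ w ∈ W, w ≠ 0 → β (w, 0) (w, 0) < 0) →
      (Module.finrank ℝ W : ℕ∞) + 1 ≤ morseIndex univ (fun v => β v v) by
    -- The "+ 1" is moved across the supremum by truncated subtraction in `ℕ∞`, which can be undone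
    -- only once the index is known to be at least 1; `W = ⊥` provides this.
    rcases eq_or_ne (morseIndex univ (fun v => β v v)) ⊤ with htop | htop
    · rw [htop]; exact le_top
    have h1 : (1 : ℕ∞) ≤ morseIndex univ (fun v => β v v) := by
      simpa using hmain ⊥ inferInstance (subset_univ _) (by simp)
    have : morseIndex univ (fun η : H => β (η, 0) (η, 0)) ≤
        morseIndex univ (fun v => β v v) - 1 := by
      rw [morseIndex_le_iff]
      intro W h2 h3 h4
      exact ENat.le_sub_of_add_le_right (by simp) (hmain W h2 h3 h4)
    calc _ ≤ morseIndex univ (fun v => β v v) - 1 + 1 := by gcongr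
      _ = _ := tsub_add_cancel_of_le h1
  intro W _ _ hW
  let W₁ : Submodule ℝ (H × ℝ) := W.map (LinearMap.inl ℝ H ℝ)
  have hW₁ : ∀ w ∈ W₁, w ≠ 0 → β w w < 0 := by
    rintro _ ⟨w, hw, rfl⟩ hne
    exact hW w hw (by rintro rfl; simp at hne)
  have hfin₁ : Module.finrank ℝ W₁ = Module.finrank ℝ W :=
    (Submodule.equivMapOfInjective _ LinearMap.inl_injective W).finrank_eq.symm
  obtain ⟨w₀, hw₀, horth⟩ := exists_orthogonal_projection_of_neg β W₁ hW₁ ((0 : H), (1 : ℝ))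
  have hsnd : ∀ w ∈ W₁, w.2 = 0 := by rintro _ ⟨w, hw, rfl⟩; rfl
  set e : H × ℝ := (0, 1) - w₀ with he
  have he2 : e.2 = 1 := by simp [he, hsnd w₀ hw₀]
  -- For y = c z + e one has β(y,y) = -c² z.2 - 2c + β(e,e), the cross term coming from β(z,e) =
  -- -e.2 = -1. The first term is nonpositive, so the other two decide the choice of c.
  obtain ⟨c, hc0, hc⟩ : ∃ c : ℝ, 0 ≤ c ∧ -(2 * c) + β e e < 0 :=
    ⟨|β e e| + 1, by positivity, by have := le_abs_self (β e e); have := abs_nonneg (β e e); linarith⟩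
  set y := c • z + e with hy
  have hyw : ∀ w ∈ W₁, β y w = 0 := by
    intro w hw
    simp [hy, hz, hsnd w hw, horth w hw]
  have hyy : β y y < 0 := by
    have : β y y = -(c ^ 2 * z.2) - 2 * c + β e e := by
      simp only [hy, map_add, map_smul, LinearMap.add_apply, LinearMap.smul_apply, hz,
        hsymm e z, he2, smul_eq_mul]
      ring
    have h2 : 0 ≤ c ^ 2 * z.2 := by positivity
    rw [this]
    linarith
  have hyne : y ∉ W₁ := by
    intro h
    have := hyw y h
    linarith
  let W₂ : Submodule ℝ (H × ℝ) := W₁ ⊔ Submodule.span ℝ {y}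
  have hfin₂ : Module.finrank ℝ W₂ = Module.finrank ℝ W + 1 := by
    have hdisj : Disjoint W₁ (Submodule.span ℝ {y}) := by
      rw [Submodule.disjoint_span_singleton]
      exact fun h => absurd h hyne
    have h1 := Submodule.finrank_sup_add_finrank_inf_eq W₁ (Submodule.span ℝ {y})
    rw [hdisj.eq_bot, finrank_bot, add_zero, hfin₁,
      finrank_span_singleton (by rintro h; rw [h] at hyne; exact hyne W₁.zero_mem)] at h1
    exact h1
  have hneg : ∀ w ∈ W₂, w ≠ 0 → β w w < 0 := by
    intro v hv hne
    obtain ⟨w, hw, _, hs, rfl⟩ := Submodule.mem_sup.1 hv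
    obtain ⟨s, rfl⟩ := Submodule.mem_span_singleton.1 hs
    have hexp : β (w + s • y) (w + s • y) = β w w + s ^ 2 * β y y := by
      simp only [map_add, map_smul, LinearMap.add_apply, LinearMap.smul_apply, hsymm w y,
        hyw w hw, smul_eq_mul]
      ring
    rw [hexp]
    by_cases hw0 : w = 0
    · have hs0 : s ≠ 0 := by rintro rfl; simp [hw0] at hne
      have : 0 < s ^ 2 := by positivity
      subst hw0
      simp only [map_zero]
      nlinarith
    · have := hW₁ w hw hw0
      nlinarith [sq_nonneg s]
  calc (Module.finrank ℝ W : ℕ∞) + 1 = ((Module.finrank ℝ W₂ : ℕ) : ℕ∞) := by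
        rw [hfin₂]; push_cast; rfl
    _ ≤ _ := finrank_le_morseIndex (subset_univ _) hneg

/-- Project onto the hyperplane along `z`, which is transverse to it. The removed component is
orthogonal to the hyperplane and positive, because β(z,z) = -z.2 > 0, so the projection does not
increase the form. -/
theorem morseIndex_prod_le_of_neg (hsymm : ∀ v w, β v w = β w v) (z : H × ℝ)
    (hz : ∀ w, β z w = -w.2) (hτ : z.2 < 0) :
    morseIndex univ (fun v => β v v) ≤ morseIndex univ (fun η : H => β (η, 0) (η, 0)) := by
  let f : (H × ℝ) →ₗ[ℝ] H :=
    LinearMap.fst ℝ H ℝ - (z.2)⁻¹ • (LinearMap.snd ℝ H ℝ).smulRight z.1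
  refine morseIndex_le_of_linearMap f (by simp) (le_of_eq (by rw [Prod.mk_zero_zero]; simp))
    (fun w _ => ?_)
  have hw : ((f w, 0) : H × ℝ) = w - (z.2⁻¹ * w.2) • z := by
    refine Prod.ext ?_ ?_
    · simp [f, mul_smul]
    · have := hτ.ne
      simp only [Prod.snd_sub, Prod.smul_snd, smul_eq_mul]
      field_simp
      simp
  have : β (f w, 0) (f w, 0) = β w w + w.2 ^ 2 * z.2⁻¹ := by
    rw [hw]
    simp only [map_sub, map_smul, LinearMap.sub_apply, LinearMap.smul_apply, hz, hsymm w z,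
      smul_eq_mul]
    have := hτ.ne
    field_simp
    ring
  simp only [this]
  have h1 : z.2⁻¹ < 0 := inv_lt_zero.2 hτ
  nlinarith [sq_nonneg w.2]

theorem morseIndex_prod_sub (hsymm : ∀ v w, β v w = β w v) (z : H × ℝ)
    (hz : ∀ w, β z w = -w.2)
    (hfin : morseIndex univ (fun η : H => β (η, 0) (η, 0)) ≠ ⊤) :
    morseIndex univ (fun v => β v v) ≠ ⊤ ∧
    ((morseIndex univ (fun v => β v v)).toNat : ℤ) -
      ((morseIndex univ (fun η : H => β (η, 0) (η, 0))).toNat : ℤ) = if 0 ≤ z.2 then 1 else 0 := by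
  have h1 := morseIndex_prod_le_add_one (fun v => β v v)
  have h2 : morseIndex univ (fun η : H => β (η, 0) (η, 0)) ≤ morseIndex univ (fun v => β v v) :=
    morseIndex_le_of_linearMap (LinearMap.inl ℝ H ℝ) (by simp) (by simp) (fun _ _ => le_rfl)
  have h3 := morseIndex_add_one_le_of_nonneg β hsymm z hz
  have h4 := morseIndex_prod_le_of_neg β hsymm z hz
  generalize morseIndex univ (fun η : H => β (η, 0) (η, 0)) = m at *
  generalize morseIndex univ (fun v => β v v) = k at *
  lift m to ℕ using hfin
  have hk : k ≠ ⊤ := by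
    rintro rfl
    exact absurd h1 (by rw [top_le_iff]; exact_mod_cast ENat.natCast_ne_top (m + 1))
  refine ⟨hk, ?_⟩
  lift k to ℕ using hk
  norm_cast at h1 h2 h3 h4
  simp only [ENat.toNat_natCast]
  split_ifs with h
  · have := h3 h
    omega
  · have := h4 (not_le.1 h)
    omega

end MorseIndex

/-! ### Second-order calculus under changes of coordinates. -/

section Calculus

open Filter Topology

variable {E E' F : Type*} [NormedAddCommGroup E] [NormedSpace ℝ E] [NormedAddCommGroup E']
  [NormedSpace ℝ E'] [NormedAddCommGroup F] [NormedSpace ℝ F]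

theorem hasDerivAt_line (y z : E) : HasDerivAt (fun s : ℝ => y + s • z) z 0 := by
  simpa using ((hasDerivAt_id (0 : ℝ)).smul_const z).const_add y

theorem DifferentiableAt.hasDerivAt_line {f : E → F} {y : E} (hf : DifferentiableAt ℝ f y)
    (z : E) : HasDerivAt (fun s : ℝ => f (y + s • z)) (fderiv ℝ f y z) 0 := by
  have h : HasFDerivAt f (fderiv ℝ f y) (y + (0 : ℝ) • z) := by simpa using hf.hasFDerivAt
  exact h.comp_hasDerivAt (0 : ℝ) (_root_.hasDerivAt_line y z)

theorem tendsto_line (y z : E) : Tendsto (fun s : ℝ => y + s • z) (𝓝 0) (𝓝 y) := by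
  simpa using (hasDerivAt_line y z).continuousAt.tendsto

/-- The device behind the identities below: differentiate two locally equal expressions along a line
and compare the results. -/
theorem HasDerivAt.unique_of_eventually {f g : ℝ → E} {a b : E} {x : ℝ} (hf : HasDerivAt f a x)
    (hg : HasDerivAt g b x) (h : ∀ᶠ s in 𝓝 x, f s = g s) : a = b :=
  hf.unique (hg.congr_of_eventuallyEq h)

theorem ContDiffAt.differentiableAt_fderiv {f : E → F} {y : E} (hf : ContDiffAt ℝ 2 f y) :
    DifferentiableAt ℝ (fderiv ℝ f) y :=
  (hf.fderiv_right (m := 1) (by norm_num)).differentiableAt (by norm_num)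

theorem ContDiffAt.fderiv_fderiv_comm {f : E → F} {y : E} (hf : ContDiffAt ℝ 2 f y) (v w : E) :
    fderiv ℝ (fderiv ℝ f) y v w = fderiv ℝ (fderiv ℝ f) y w v :=
  (hf.isSymmSndFDerivAt (by simp)) v w

theorem eventually_contDiffAt {f : E → F} {y : E} {n : ℕ} (hf : ContDiffAt ℝ n f y) :
    ∀ᶠ z in 𝓝 y, ContDiffAt ℝ n f z := hf.eventually (by simp)

/-- The second derivative is the derivative, along a line, of the first one. -/
theorem ContDiffAt.hasDerivAt_fderiv_line {f : E → F} {y : E} (hf : ContDiffAt ℝ 2 f y)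
    (z w : E) :
    HasDerivAt (fun s : ℝ => fderiv ℝ f (y + s • z) w) (fderiv ℝ (fderiv ℝ f) y z w) 0 := by
  simpa using (hf.differentiableAt_fderiv.hasDerivAt_line z).clm_apply (hasDerivAt_const 0 w)

/-- A function of two jets: the second derivative along a curve with the given two-jet. -/
theorem iteratedDeriv_two_comp_curve {f : E → F} {z₀ z₁ z₂ : E} (hf : ContDiffAt ℝ 2 f z₀) :
    iteratedDeriv 2 (fun r : ℝ => f (z₀ + r • z₁ - (r ^ 2 / 2) • z₂)) 0 =
      fderiv ℝ (fderiv ℝ f) z₀ z₁ z₁ - fderiv ℝ f z₀ z₂ := by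
  set c : ℝ → E := fun r => z₀ + r • z₁ - (r ^ 2 / 2) • z₂ with hc
  have hc1 : ∀ r, HasDerivAt c (z₁ - r • z₂) r := by
    intro r
    have h1 : HasDerivAt (fun r : ℝ => r ^ 2 / 2) r r := by
      simpa using ((hasDerivAt_pow 2 r).div_const 2)
    simpa using (((hasDerivAt_id r).smul_const z₁).const_add z₀).fun_sub (h1.smul_const z₂)
  have hc0 : c 0 = z₀ := by simp [hc]
  have hev : ∀ᶠ r in 𝓝 (0 : ℝ), ContDiffAt ℝ 2 f (c r) := by
    have : Tendsto c (𝓝 0) (𝓝 z₀) := by simpa [hc0] using (hc1 0).continuousAt.tendsto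
    exact this.eventually (eventually_contDiffAt hf)
  have hd : deriv (fun r => f (c r)) =ᶠ[𝓝 0] fun r => fderiv ℝ f (c r) (z₁ - r • z₂) := by
    filter_upwards [hev] with r hr
    exact ((hr.differentiableAt (by norm_num)).hasFDerivAt.comp_hasDerivAt r (hc1 r)).deriv
  rw [iteratedDeriv_succ, iteratedDeriv_one, hd.deriv_eq]
  have h1 : HasDerivAt (fun r : ℝ => z₁ - r • z₂) (-z₂) 0 := by
    simpa using ((hasDerivAt_id (0 : ℝ)).smul_const z₂).const_sub z₁
  have h2 : HasFDerivAt (fderiv ℝ f) (fderiv ℝ (fderiv ℝ f) z₀) (c 0) := by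
    rw [hc0]; exact hf.differentiableAt_fderiv.hasFDerivAt
  have h3 := (h2.comp_hasDerivAt (0 : ℝ) (hc1 0)).clm_apply h1
  refine h3.deriv.trans ?_
  simp [hc0, sub_eq_add_neg]

theorem deriv_comp_curve {f : E → F} {z₀ z₁ z₂ : E} (hf : DifferentiableAt ℝ f z₀) :
    deriv (fun r : ℝ => f (z₀ + r • z₁ - (r ^ 2 / 2) • z₂)) 0 = fderiv ℝ f z₀ z₁ := by
  have h1 : HasDerivAt (fun r : ℝ => r ^ 2 / 2) 0 (0 : ℝ) := by
    simpa using ((hasDerivAt_pow 2 (0 : ℝ)).div_const 2)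
  have h2 : HasDerivAt (fun r : ℝ => z₀ + r • z₁ - (r ^ 2 / 2) • z₂) z₁ 0 := by
    simpa using (((hasDerivAt_id (0 : ℝ)).smul_const z₁).const_add z₀).fun_sub (h1.smul_const z₂)
  have h3 : HasFDerivAt f (fderiv ℝ f z₀)
      ((fun r : ℝ => z₀ + r • z₁ - (r ^ 2 / 2) • z₂) 0) := by simpa using hf.hasFDerivAt
  exact (h3.comp_hasDerivAt (0 : ℝ) h2).deriv

/-- The map `(q, v, τ) ↦ (φ(q), dφ(q) v, τ)` induced by a change of coordinates `φ`. -/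
def velocityMap (φ : E → E') (y : E × E × ℝ) : E' × E' × ℝ :=
  (φ y.1, fderiv ℝ φ y.1 y.2.1, y.2.2)

theorem ContDiffAt.velocityMap {φ : E → E'} {y : E × E × ℝ} {m k : WithTop ℕ∞}
    (hφ : ContDiffAt ℝ m φ y.1) (hk : k + 1 ≤ m) : ContDiffAt ℝ k (velocityMap φ) y := by
  have h1 : ContDiffAt ℝ k (fun z : E × E × ℝ => φ z.1) y :=
    (hφ.of_le (le_self_add.trans hk)).comp y contDiffAt_fst
  have h2 : ContDiffAt ℝ k (fun z : E × E × ℝ => fderiv ℝ φ z.1) y :=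
    (hφ.fderiv_right hk).comp y contDiffAt_fst
  exact h1.prodMk ((h2.clm_apply (contDiffAt_fst.comp y contDiffAt_snd)).prodMk
    (contDiffAt_snd.comp y contDiffAt_snd))

theorem fderiv_velocityMap {φ : E → E'} {y : E × E × ℝ} (hφ : ContDiffAt ℝ 2 φ y.1)
    (z : E × E × ℝ) :
    fderiv ℝ (velocityMap φ) y z =
      (fderiv ℝ φ y.1 z.1, fderiv ℝ (fderiv ℝ φ) y.1 z.1 y.2.1 + fderiv ℝ φ y.1 z.2.1, z.2.2) := by
  have h0 := ((hφ.velocityMap (k := 1) (by norm_num)).differentiableAt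
    (by norm_num)).hasDerivAt_line z
  refine h0.unique (HasDerivAt.prodMk ?_ (HasDerivAt.prodMk ?_ ?_))
  · exact (hφ.differentiableAt (by norm_num)).hasDerivAt_line z.1
  · have := (hφ.differentiableAt_fderiv.hasDerivAt_line z.1).clm_apply (hasDerivAt_line y.2.1 z.2.1)
    simpa using this
  · exact hasDerivAt_line y.2.2 z.2.2

theorem fderiv_fderiv_velocityMap {φ : E → E'} {y : E × E × ℝ} (hφ : ContDiffAt ℝ 3 φ y.1)
    (z w : E × E × ℝ) :
    fderiv ℝ (fderiv ℝ (velocityMap φ)) y z w =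
      (fderiv ℝ (fderiv ℝ φ) y.1 z.1 w.1,
        fderiv ℝ (fderiv ℝ (fderiv ℝ φ)) y.1 z.1 w.1 y.2.1 + fderiv ℝ (fderiv ℝ φ) y.1 w.1 z.2.1
          + fderiv ℝ (fderiv ℝ φ) y.1 z.1 w.2.1, 0) := by
  have hφ2 : ContDiffAt ℝ 2 φ y.1 := hφ.of_le (by norm_num)
  have h0 := (hφ.velocityMap (k := 2) (by norm_num)).hasDerivAt_fderiv_line z w
  have hev : ∀ᶠ s : ℝ in 𝓝 0, ContDiffAt ℝ 2 φ (y + s • z).1 := by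
    have := ((continuous_fst.tendsto y).comp (tendsto_line y z)).eventually
      (eventually_contDiffAt hφ2)
    simpa using this
  have h1 : (fun s : ℝ => fderiv ℝ (velocityMap φ) (y + s • z) w) =ᶠ[𝓝 0] fun s =>
      (fderiv ℝ φ (y.1 + s • z.1) w.1,
        fderiv ℝ (fderiv ℝ φ) (y.1 + s • z.1) w.1 (y.2.1 + s • z.2.1)
          + fderiv ℝ φ (y.1 + s • z.1) w.2.1, w.2.2) := by
    filter_upwards [hev] with s hs
    rw [fderiv_velocityMap hs]
    rfl
  refine (h0.congr_of_eventuallyEq h1.symm).unique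
    (HasDerivAt.prodMk ?_ (HasDerivAt.prodMk ?_ (hasDerivAt_const _ _)))
  · exact hφ2.hasDerivAt_fderiv_line z.1 w.1
  · have hφ' : ContDiffAt ℝ 2 (fderiv ℝ φ) y.1 := hφ.fderiv_right (by norm_num)
    have := ((hφ'.hasDerivAt_fderiv_line z.1 w.1).clm_apply (hasDerivAt_line y.2.1 z.2.1)).fun_add
      (hφ2.hasDerivAt_fderiv_line z.1 w.2.1)
    simpa using this

/-- The bilinear form, in coordinates, of the second variation of the action with density `G`
along geodesic variations of the connection with Christoffel symbols `Γ`. -/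
def hessForm (G : E × E × ℝ → ℝ) (Γ : E → E →L[ℝ] E →L[ℝ] E) (y z w : E × E × ℝ) : ℝ :=
  fderiv ℝ (fderiv ℝ G) y z w - fderiv ℝ G y (Γ y.1 z.1 w.1,
    fderiv ℝ Γ y.1 y.2.1 z.1 w.1 + Γ y.1 z.2.1 w.1 + Γ y.1 z.1 w.2.1, 0)

theorem fderiv_comp_velocityMap {G : E × E × ℝ → ℝ} {G' : E' × E' × ℝ → ℝ} {φ : E → E'}
    {y : E × E × ℝ} (hφ : ContDiffAt ℝ 2 φ y.1) (hG' : DifferentiableAt ℝ G' (velocityMap φ y))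
    (hG : G =ᶠ[𝓝 y] G' ∘ velocityMap φ) (z : E × E × ℝ) :
    fderiv ℝ G y z = fderiv ℝ G' (velocityMap φ y) (fderiv ℝ (velocityMap φ) y z) := by
  rw [hG.fderiv_eq, fderiv_comp y hG'
    ((hφ.velocityMap (k := 1) (by norm_num)).differentiableAt (by norm_num))]
  rfl

/-- The second summand is the failure of the plain Hessian to be a tensor. The Christoffel
correction in `hessForm` is there to absorb it. -/
theorem fderiv_fderiv_comp_velocityMap {G : E × E × ℝ → ℝ} {G' : E' × E' × ℝ → ℝ} {φ : E → E'}
    {y : E × E × ℝ} (hφ : ContDiffAt ℝ 3 φ y.1) (hG' : ContDiffAt ℝ 2 G' (velocityMap φ y))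
    (hG : G =ᶠ[𝓝 y] G' ∘ velocityMap φ) (z w : E × E × ℝ) :
    fderiv ℝ (fderiv ℝ G) y z w =
      fderiv ℝ (fderiv ℝ G') (velocityMap φ y) (fderiv ℝ (velocityMap φ) y z)
        (fderiv ℝ (velocityMap φ) y w) +
      fderiv ℝ G' (velocityMap φ y) (fderiv ℝ (fderiv ℝ (velocityMap φ)) y z w) := by
  have hΦ : ContDiffAt ℝ 2 (velocityMap φ) y := hφ.velocityMap (by norm_num)
  have hGc : ContDiffAt ℝ 2 G y := (hG'.comp y hΦ).congr_of_eventuallyEq hG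
  have hφ2 : ContDiffAt ℝ 2 φ y.1 := hφ.of_le (by norm_num)
  have hev : ∀ᶠ x in 𝓝 y, fderiv ℝ G x w =
      fderiv ℝ G' (velocityMap φ x) (fderiv ℝ (velocityMap φ) x w) := by
    filter_upwards [hG.eventually_nhds, continuous_fst.continuousAt.eventually
      (eventually_contDiffAt hφ2), hΦ.continuousAt.eventually (eventually_contDiffAt hG')]
      with x h1 h2 h3
    exact fderiv_comp_velocityMap h2 (h3.differentiableAt (by norm_num)) h1 w
  have h2 := (hΦ.differentiableAt (by norm_num)).hasDerivAt_line z
  have h3 : HasFDerivAt (fderiv ℝ G') (fderiv ℝ (fderiv ℝ G') (velocityMap φ y))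
      (velocityMap φ (y + (0 : ℝ) • z)) := by
    simpa using hG'.differentiableAt_fderiv.hasFDerivAt
  have h4 := h3.comp_hasDerivAt (0 : ℝ) h2
  have h5 := h4.clm_apply (hΦ.hasDerivAt_fderiv_line z w)
  have h6 := (hGc.hasDerivAt_fderiv_line z w).unique_of_eventually h5
    ((tendsto_line y z).eventually hev)
  rw [h6]
  simp only [Function.comp_apply, zero_smul, add_zero]

set_option synthInstance.maxHeartbeats 200000 in
/-- The differentiated transformation law of the Christoffel symbols. -/
theorem christoffel_transform_deriv {φ : E → E'} {Γ : E → E →L[ℝ] E →L[ℝ] E}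
    {Γ' : E' → E' →L[ℝ] E' →L[ℝ] E'} {q : E} (hφ : ContDiffAt ℝ 3 φ q)
    (hΓ : DifferentiableAt ℝ Γ q) (hΓ' : DifferentiableAt ℝ Γ' (φ q))
    (h : ∀ᶠ x in 𝓝 q, ∀ v w, Γ' (φ x) (fderiv ℝ φ x v) (fderiv ℝ φ x w) =
      fderiv ℝ φ x (Γ x v w) - fderiv ℝ (fderiv ℝ φ) x v w) (v u₁ u₂ w₁ w₂ : E) :
    fderiv ℝ Γ' (φ q) (fderiv ℝ φ q v) (fderiv ℝ φ q u₁) (fderiv ℝ φ q u₂) +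
      Γ' (φ q) (fderiv ℝ (fderiv ℝ φ) q v u₁ + fderiv ℝ φ q w₁) (fderiv ℝ φ q u₂) +
      Γ' (φ q) (fderiv ℝ φ q u₁) (fderiv ℝ (fderiv ℝ φ) q v u₂ + fderiv ℝ φ q w₂) =
    fderiv ℝ (fderiv ℝ φ) q v (Γ q u₁ u₂) +
      fderiv ℝ φ q (fderiv ℝ Γ q v u₁ u₂ + Γ q w₁ u₂ + Γ q u₁ w₂) -
      (fderiv ℝ (fderiv ℝ (fderiv ℝ φ)) q v u₁ u₂ + fderiv ℝ (fderiv ℝ φ) q w₁ u₂ +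
        fderiv ℝ (fderiv ℝ φ) q u₁ w₂) := by
  have hφ2 : ContDiffAt ℝ 2 φ q := hφ.of_le (by norm_num)
  have hφ' : ContDiffAt ℝ 2 (fderiv ℝ φ) q := hφ.fderiv_right (by norm_num)
  have d0 := (hφ2.differentiableAt (by norm_num)).hasDerivAt_line v
  have d1 := hφ2.differentiableAt_fderiv.hasDerivAt_line v
  have d2 := hφ'.differentiableAt_fderiv.hasDerivAt_line v
  have dΓ := DifferentiableAt.hasDerivAt_line (F := E →L[ℝ] E →L[ℝ] E) hΓ v
  -- The transformation law is differentiated along q + s v with moving arguments u₁ + s w₁ and u₂ +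
  -- s w₂, as needed for fields along a curve.
  have l1 := hasDerivAt_line u₁ w₁
  have l2 := hasDerivAt_line u₂ w₂
  have h3 : HasFDerivAt Γ' (fderiv ℝ Γ' (φ q)) (φ (q + (0 : ℝ) • v)) := by
    simpa using hΓ'.hasFDerivAt
  have dΓ' := HasFDerivAt.comp_hasDerivAt (E := E' →L[ℝ] E' →L[ℝ] E') (0 : ℝ) h3 d0
  have L := (dΓ'.clm_apply (d1.clm_apply l1)).clm_apply (d1.clm_apply l2)
  have R := (d1.clm_apply ((dΓ.clm_apply l1).clm_apply l2)).fun_sub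
    ((d2.clm_apply l1).clm_apply l2)
  have key := (tendsto_line q v).eventually h
  have heq := L.unique_of_eventually R (key.mono fun s hs => hs _ _)
  simpa [add_assoc] using heq

/-- The second variation form does not depend on the coordinates. -/
theorem hessForm_velocityMap {G : E × E × ℝ → ℝ} {G' : E' × E' × ℝ → ℝ} {φ : E → E'}
    {Γ : E → E →L[ℝ] E →L[ℝ] E} {Γ' : E' → E' →L[ℝ] E' →L[ℝ] E'}
    {y : E × E × ℝ} (hφ : ContDiffAt ℝ 3 φ y.1) (hG' : ContDiffAt ℝ 2 G' (velocityMap φ y))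
    (hG : G =ᶠ[𝓝 y] G' ∘ velocityMap φ)
    (hΓ : DifferentiableAt ℝ Γ y.1) (hΓ' : DifferentiableAt ℝ Γ' (φ y.1))
    (h : ∀ᶠ x in 𝓝 y.1, ∀ v w, Γ' (φ x) (fderiv ℝ φ x v) (fderiv ℝ φ x w) =
      fderiv ℝ φ x (Γ x v w) - fderiv ℝ (fderiv ℝ φ) x v w) (z w : E × E × ℝ) :
    hessForm G Γ y z w = hessForm G' Γ' (velocityMap φ y) (fderiv ℝ (velocityMap φ) y z)
      (fderiv ℝ (velocityMap φ) y w) := by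
  have hφ2 : ContDiffAt ℝ 2 φ y.1 := hφ.of_le (by norm_num)
  have hφ' : ContDiffAt ℝ 2 (fderiv ℝ φ) y.1 := hφ.fderiv_right (by norm_num)
  -- Symmetry of the third derivative: the first two slots by Schwarz for Dφ, the last two by
  -- differentiating the symmetry of D²φ.
  have s3 : fderiv ℝ (fderiv ℝ (fderiv ℝ φ)) y.1 z.1 w.1 y.2.1 =
      fderiv ℝ (fderiv ℝ (fderiv ℝ φ)) y.1 y.2.1 z.1 w.1 := by
    have a1 := hφ'.fderiv_fderiv_comm y.2.1 z.1
    rw [a1]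
    have a2 : ∀ᶠ x in 𝓝 y.1, fderiv ℝ (fderiv ℝ φ) x w.1 y.2.1 =
        fderiv ℝ (fderiv ℝ φ) x y.2.1 w.1 := by
      filter_upwards [eventually_contDiffAt hφ2] with x hx
      exact hx.fderiv_fderiv_comm _ _
    have b1 := (hφ'.hasDerivAt_fderiv_line z.1 w.1).clm_apply (hasDerivAt_const (0 : ℝ) y.2.1)
    have b2 := (hφ'.hasDerivAt_fderiv_line z.1 y.2.1).clm_apply (hasDerivAt_const (0 : ℝ) w.1)
    have := b1.unique_of_eventually b2 ((tendsto_line y.1 z.1).eventually a2)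
    simpa using this
  have c1 := h.self_of_nhds z.1 w.1
  have c2 := christoffel_transform_deriv hφ hΓ hΓ' h y.2.1 z.1 w.1 z.2.1 w.2.1
  unfold hessForm
  rw [fderiv_fderiv_comp_velocityMap hφ hG' hG, fderiv_comp_velocityMap hφ2
    (hG'.differentiableAt (by norm_num)) hG, add_sub_assoc, ← map_sub, sub_eq_add_neg _ (fderiv ℝ G' _ _),
    ← map_neg]
  -- What remains is an identity between the vectors fed to DG': its position component is the
  -- Christoffel transformation law, its velocity component is the differentiated law.
  congr 2
  rw [fderiv_fderiv_velocityMap hφ, fderiv_velocityMap hφ2, fderiv_velocityMap hφ2,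
    fderiv_velocityMap hφ2]
  refine Prod.ext ?_ (Prod.ext ?_ ?_)
  · simp only [velocityMap, Prod.fst_sub, Prod.fst_neg]
    rw [c1]
    abel
  · simp only [velocityMap, Prod.fst_sub, Prod.fst_neg, Prod.snd_sub, Prod.snd_neg]
    rw [hφ2.fderiv_fderiv_comm z.1 y.2.1, hφ2.fderiv_fderiv_comm w.1 y.2.1, c2, s3,
      hφ2.fderiv_fderiv_comm w.1 z.2.1, hφ2.fderiv_fderiv_comm (Γ y.1 z.1 w.1) y.2.1]
    abel
  · simp [velocityMap]

set_option synthInstance.maxHeartbeats 200000 in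
/-- The transformation law of the Christoffel symbols of the Levi-Civita connection. -/
theorem christoffel_transform {φ : E → E'} {m : E → E →L[ℝ] E →L[ℝ] ℝ}
    {m' : E' → E' →L[ℝ] E' →L[ℝ] ℝ} {q : E} (hφ : ContDiffAt ℝ 2 φ q)
    (hm : DifferentiableAt ℝ m q) (hm' : DifferentiableAt ℝ m' (φ q))
    (h : ∀ᶠ x in 𝓝 q, ∀ v w, m x v w = m' (φ x) (fderiv ℝ φ x v) (fderiv ℝ φ x w))
    (hsymm : ∀ v w, m' (φ q) v w = m' (φ q) w v)
    (hnondeg : ∀ v, (∀ w, m' (φ q) v w = 0) → v = 0)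
    (hsurj : Function.Surjective (fderiv ℝ φ q))
    {Γ : E →L[ℝ] E →L[ℝ] E} {Γ' : E' →L[ℝ] E' →L[ℝ] E'}
    (hΓ : ∀ v₁ v₂ w, 2 * m q (Γ v₁ v₂) w = fderiv ℝ m q v₁ v₂ w + fderiv ℝ m q v₂ v₁ w
      - fderiv ℝ m q w v₁ v₂)
    (hΓ' : ∀ v₁ v₂ w, 2 * m' (φ q) (Γ' v₁ v₂) w = fderiv ℝ m' (φ q) v₁ v₂ w
      + fderiv ℝ m' (φ q) v₂ v₁ w - fderiv ℝ m' (φ q) w v₁ v₂) (v₁ v₂ : E) :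
    Γ' (fderiv ℝ φ q v₁) (fderiv ℝ φ q v₂) =
      fderiv ℝ φ q (Γ v₁ v₂) - fderiv ℝ (fderiv ℝ φ) q v₁ v₂ := by
  have d0 : ∀ z, _ := fun z => (hφ.differentiableAt (by norm_num)).hasDerivAt_line z
  have d1 : ∀ z, _ := fun z => hφ.differentiableAt_fderiv.hasDerivAt_line z
  -- Derivative of the relation m = φ^*m'. In the Koszul combination the terms containing D²φ cancel
  -- except for 2m'(D²φ(v₁,v₂), Dφ w), the inhomogeneous term of the transformation law.
  have key : ∀ z v w, fderiv ℝ m q z v w = fderiv ℝ m' (φ q) (fderiv ℝ φ q z) (fderiv ℝ φ q v)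
      (fderiv ℝ φ q w) + m' (φ q) (fderiv ℝ (fderiv ℝ φ) q z v) (fderiv ℝ φ q w) +
      m' (φ q) (fderiv ℝ φ q v) (fderiv ℝ (fderiv ℝ φ) q z w) := by
    intro z v w
    have h3 : HasFDerivAt m' (fderiv ℝ m' (φ q)) (φ (q + (0 : ℝ) • z)) := by
      simpa using hm'.hasFDerivAt
    have dm' := HasFDerivAt.comp_hasDerivAt (E := E' →L[ℝ] E' →L[ℝ] ℝ) (0 : ℝ) h3 (d0 z)
    have cv : ∀ v : E, HasDerivAt (fun s : ℝ => v) 0 0 := fun v => hasDerivAt_const 0 v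
    have L := ((DifferentiableAt.hasDerivAt_line (F := E →L[ℝ] E →L[ℝ] ℝ) hm z).clm_apply (cv v)).clm_apply (cv w)
    have R := (dm'.clm_apply ((d1 z).clm_apply (cv v))).clm_apply ((d1 z).clm_apply (cv w))
    have := L.unique_of_eventually R (((tendsto_line q z).eventually h).mono fun s hs => hs v w)
    simpa using this
  rw [← sub_eq_zero]
  apply hnondeg
  intro w'
  obtain ⟨w, rfl⟩ := hsurj w'
  have e1 := hΓ v₁ v₂ w
  have e2 := hΓ' (fderiv ℝ φ q v₁) (fderiv ℝ φ q v₂) (fderiv ℝ φ q w)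
  rw [h.self_of_nhds, key, key, key] at e1
  have s1 := hφ.fderiv_fderiv_comm v₂ v₁
  have s2 := hφ.fderiv_fderiv_comm v₂ w
  have s3 := hφ.fderiv_fderiv_comm v₁ w
  rw [s1, s2, s3, hsymm (fderiv ℝ φ q v₂) (fderiv ℝ (fderiv ℝ φ) q w v₁)] at e1
  simp only [map_sub, _root_.sub_apply]
  linarith

end Calculus

/-! ### The action, the metric and the Christoffel symbols in charts. -/

section Coordinates

open Filter Topology

variable {n : ℕ} {M : Type*} [TopologicalSpace M] [ChartedSpace (EuclideanSpace ℝ (Fin n)) M]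
  [IsManifold (𝓡 n) ∞ M]

local notation "𝔼" => EuclideanSpace ℝ (Fin n)

/-- The change of coordinates from the chart around `p` to the chart around `p'`. -/
def chartTransition (p p' : M) : EuclideanSpace ℝ (Fin n) → EuclideanSpace ℝ (Fin n) :=
  extChartAt (𝓡 n) p' ∘ (extChartAt (𝓡 n) p).symm

omit [IsManifold (𝓡 n) ∞ M] in
theorem chartTransition_extChartAt {p y : M} (p' : M) (hp : y ∈ (extChartAt (𝓡 n) p).source) :
    chartTransition p p' (extChartAt (𝓡 n) p y) = extChartAt (𝓡 n) p' y := by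
  rw [chartTransition, Function.comp_apply, (extChartAt (𝓡 n) p).left_inv hp]

theorem contDiffAt_chartTransition {p p' y : M} (hp : y ∈ (extChartAt (𝓡 n) p).source)
    (hp' : y ∈ (extChartAt (𝓡 n) p').source) :
    ContDiffAt ℝ ∞ (chartTransition p p') (extChartAt (𝓡 n) p y) := by
  have h' : extChartAt (𝓡 n) p y ∈
      ((extChartAt (𝓡 n) p).symm ≫ (extChartAt (𝓡 n) p')).source := by
    rw [PartialEquiv.trans_source'', PartialEquiv.symm_symm, PartialEquiv.symm_target]
    exact mem_image_of_mem _ ⟨hp, hp'⟩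
  have := contDiffWithinAt_ext_coord_change (I := 𝓡 n) (n := ∞) p' p h'
  rwa [(𝓡 n).range_eq_univ, contDiffWithinAt_univ] at this

theorem fderiv_chartTransition {p p' y : M} :
    fderiv ℝ (chartTransition p p') (extChartAt (𝓡 n) p y) = tangentCoordChange (𝓡 n) p p' y := by
  rw [tangentCoordChange_def, (𝓡 n).range_eq_univ, fderivWithin_univ]
  rfl

/-- A tangent vector at a point is stored as its coordinate vector in the preferred chart there, so
taking coordinates around `p` is the derivative of a chart transition. -/
theorem fieldCoord_eq (x : ℝ → M) (ξ : ∀ t, TangentSpace (𝓡 n) (x t)) (p : M) (t : ℝ) :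
    fieldCoord x ξ p t = tangentCoordChange (𝓡 n) (x t) p (x t) (ξ t) := rfl

theorem fieldCoord_trans {x : ℝ → M} (ξ : ∀ t, TangentSpace (𝓡 n) (x t)) {p p' : M} {t : ℝ}
    (hp : x t ∈ (extChartAt (𝓡 n) p).source) (hp' : x t ∈ (extChartAt (𝓡 n) p').source) :
    fderiv ℝ (chartTransition p p') (extChartAt (𝓡 n) p (x t)) (fieldCoord x ξ p t) =
      fieldCoord x ξ p' t := by
  rw [fderiv_chartTransition, fieldCoord_eq, fieldCoord_eq]
  exact tangentCoordChange_comp ⟨⟨mem_extChartAt_source (x t), hp⟩, hp'⟩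

theorem vecOfCoord_eq {p y : M} (hp : y ∈ (extChartAt (𝓡 n) p).source) (v : 𝔼) :
    vecOfCoord p y v = tangentCoordChange (𝓡 n) p y y v := by
  rw [extChartAt_source] at hp
  unfold vecOfCoord
  rw [TangentBundle.symmL_trivializationAt_eq_core hp]
  rfl

theorem vecOfCoord_trans {p p' y : M} (hp : y ∈ (extChartAt (𝓡 n) p).source)
    (hp' : y ∈ (extChartAt (𝓡 n) p').source) (v : 𝔼) :
    vecOfCoord p' y (fderiv ℝ (chartTransition p p') (extChartAt (𝓡 n) p y) v) =
      vecOfCoord p y v := by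
  have h := congrArg (vecOfCoord p' y)
    (DFunLike.congr_fun (fderiv_chartTransition (n := n) (p := p) (p' := p') (y := y)) v)
  refine h.trans ((vecOfCoord_eq hp' _).trans (Eq.trans ?_ (vecOfCoord_eq hp v).symm))
  have h2 := tangentCoordChange_comp (I := 𝓡 n) (v := v) ⟨⟨hp, hp'⟩, mem_extChartAt_source y⟩
  exact h2

theorem fieldCoord_of_eq_vecOfCoord {x : ℝ → M} {ξ : ∀ t, TangentSpace (𝓡 n) (x t)} {p : M} {t : ℝ}
    (hp : x t ∈ (extChartAt (𝓡 n) p).source) {v : 𝔼} (h : ξ t = vecOfCoord p (x t) v) :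
    fieldCoord x ξ p t = v := by
  rw [fieldCoord_eq, h, vecOfCoord_eq hp]
  exact (tangentCoordChange_comp ⟨⟨hp, mem_extChartAt_source _⟩, hp⟩).trans
    (tangentCoordChange_self hp)

theorem fderiv_chartTransition_surjective {p p' y : M} (hp : y ∈ (extChartAt (𝓡 n) p).source)
    (hp' : y ∈ (extChartAt (𝓡 n) p').source) :
    Function.Surjective (fderiv ℝ (chartTransition p p') (extChartAt (𝓡 n) p y)) := by
  intro w
  refine ⟨tangentCoordChange (𝓡 n) p' p y w, ?_⟩
  rw [fderiv_chartTransition]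
  exact (tangentCoordChange_comp ⟨⟨hp', hp⟩, hp'⟩).trans (tangentCoordChange_self hp')

omit [IsManifold (𝓡 n) ∞ M] in
/-- Points with coordinates near those of `y` lie in the domains of both charts. -/
theorem eventually_mem_charts {p p' y : M} (hp : y ∈ (extChartAt (𝓡 n) p).source)
    (hp' : y ∈ (extChartAt (𝓡 n) p').source) :
    ∀ᶠ q in 𝓝 (extChartAt (𝓡 n) p y), ∃ z, z ∈ (extChartAt (𝓡 n) p).source ∧
      z ∈ (extChartAt (𝓡 n) p').source ∧ extChartAt (𝓡 n) p z = q := by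
  have h1 : (extChartAt (𝓡 n) p).target ∈ 𝓝 (extChartAt (𝓡 n) p y) :=
    (isOpen_extChartAt_target p).mem_nhds ((extChartAt (𝓡 n) p).map_source hp)
  have h2 : Tendsto (extChartAt (𝓡 n) p).symm (𝓝 (extChartAt (𝓡 n) p y)) (𝓝 y) := by
    have := continuousAt_extChartAt_symm'' ((extChartAt (𝓡 n) p).map_source hp)
    rwa [ContinuousAt, (extChartAt (𝓡 n) p).left_inv hp] at this
  filter_upwards [h1, h2.eventually ((isOpen_extChartAt_source p').mem_nhds hp')] with q hq hq'
  exact ⟨(extChartAt (𝓡 n) p).symm q, (extChartAt (𝓡 n) p).map_target hq, hq',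
    (extChartAt (𝓡 n) p).right_inv hq⟩

theorem contMDiffAt_vecOfCoord {p : M} {q v : 𝔼} (hq : q ∈ (extChartAt (𝓡 n) p).target) :
    ContMDiffAt 𝓘(ℝ, 𝔼 × 𝔼) (𝓡 n).tangent ∞ (fun z : 𝔼 × 𝔼 =>
      (⟨(extChartAt (𝓡 n) p).symm z.1, vecOfCoord p ((extChartAt (𝓡 n) p).symm z.1) z.2⟩ :
        TangentBundle (𝓡 n) M)) (q, v) := by
  have hs : ∀ z ∈ (extChartAt (𝓡 n) p).target, (extChartAt (𝓡 n) p).symm z ∈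
      (trivializationAt (EuclideanSpace ℝ (Fin n)) (TangentSpace (𝓡 n) : M → Type) p).baseSet := by
    intro z hz
    rw [TangentBundle.trivializationAt_baseSet, ← extChartAt_source (𝓡 n)]
    exact (extChartAt (𝓡 n) p).map_target hz
  have ht : (extChartAt (𝓡 n) p).target ∈ 𝓝 q := (isOpen_extChartAt_target p).mem_nhds hq
  rw [(trivializationAt (EuclideanSpace ℝ (Fin n)) (TangentSpace (𝓡 n) : M → Type) p).contMDiffAt_iff
    (IB := 𝓡 n) (by rw [Bundle.Trivialization.mem_source]; exact hs q hq)]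
  constructor
  · exact ContMDiffAt.comp (g := (extChartAt (𝓡 n) p).symm) (f := (Prod.fst : 𝔼 × 𝔼 → 𝔼)) (q, v)
      ((contMDiffOn_extChartAt_symm p).contMDiffAt ht) contDiffAt_fst.contMDiffAt
  · refine (contDiffAt_snd.contMDiffAt).congr_of_eventuallyEq ?_
    filter_upwards [continuous_fst.continuousAt.preimage_mem_nhds (x := (q, v)) ht] with z hz
    unfold vecOfCoord
    rw [Bundle.Trivialization.symmL_apply _ (hs _ hz), Bundle.Trivialization.apply_mk_symm _ (hs _ hz)]

theorem contDiffAt_lagrangianCoord {L : TangentBundle (𝓡 n) M → ℝ}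
    (hL : ContMDiff (𝓡 n).tangent 𝓘(ℝ, ℝ) ∞ L) {p : M} {q v : 𝔼}
    (hq : q ∈ (extChartAt (𝓡 n) p).target) :
    ContDiffAt ℝ ∞ (fun z : 𝔼 × 𝔼 => lagrangianCoord L p z.1 z.2) (q, v) :=
  (hL.contMDiffAt.comp (q, v) (contMDiffAt_vecOfCoord hq)).contDiffAt

theorem lagrangianCoord_trans (L : TangentBundle (𝓡 n) M → ℝ) {p p' y : M}
    (hp : y ∈ (extChartAt (𝓡 n) p).source) (hp' : y ∈ (extChartAt (𝓡 n) p').source) (v : 𝔼) :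
    lagrangianCoord L p' (extChartAt (𝓡 n) p' y)
      (fderiv ℝ (chartTransition p p') (extChartAt (𝓡 n) p y) v) =
      lagrangianCoord L p (extChartAt (𝓡 n) p y) v := by
  unfold lagrangianCoord
  rw [(extChartAt (𝓡 n) p).left_inv hp, (extChartAt (𝓡 n) p').left_inv hp',
    vecOfCoord_trans hp hp']

/-- The integrand `τ (L(q, v / τ) + h)` of the free period action in the coordinates around `p`. -/
def actionCoord (L : TangentBundle (𝓡 n) M → ℝ) (h : ℝ) (p : M)
    (y : EuclideanSpace ℝ (Fin n) × EuclideanSpace ℝ (Fin n) × ℝ) : ℝ :=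
  y.2.2 * (lagrangianCoord L p y.1 (y.2.2⁻¹ • y.2.1) + h)

theorem contDiffAt_actionCoord {L : TangentBundle (𝓡 n) M → ℝ}
    (hL : ContMDiff (𝓡 n).tangent 𝓘(ℝ, ℝ) ∞ L) (h : ℝ) {p : M} {y : 𝔼 × 𝔼 × ℝ}
    (hq : y.1 ∈ (extChartAt (𝓡 n) p).target) (hτ : y.2.2 ≠ 0) :
    ContDiffAt ℝ ∞ (actionCoord L h p) y := by
  have h1 : ContDiffAt ℝ ∞ (fun y : 𝔼 × 𝔼 × ℝ => (y.1, y.2.2⁻¹ • y.2.1)) y := by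
    refine contDiffAt_fst.prodMk (ContDiffAt.fun_smul ?_ (contDiffAt_fst.comp y contDiffAt_snd))
    exact (contDiffAt_snd.comp y contDiffAt_snd).inv hτ
  have h2 := (contDiffAt_lagrangianCoord hL (v := y.2.2⁻¹ • y.2.1) hq).comp y h1
  exact (contDiffAt_snd.comp y contDiffAt_snd).mul (h2.add contDiffAt_const)

/-- Charts are partial, so this is an equality of germs; that suffices, since only derivatives at
the point enter. -/
theorem actionCoord_trans (L : TangentBundle (𝓡 n) M → ℝ) (h : ℝ) {p p' m : M}
    (hp : m ∈ (extChartAt (𝓡 n) p).source) (hp' : m ∈ (extChartAt (𝓡 n) p').source)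
    {y : 𝔼 × 𝔼 × ℝ} (hy : y.1 = extChartAt (𝓡 n) p m) :
    actionCoord L h p =ᶠ[𝓝 y] actionCoord L h p' ∘ velocityMap (chartTransition p p') := by
  have h1 := (continuous_fst.tendsto y).eventually (hy ▸ eventually_mem_charts hp hp')
  filter_upwards [h1] with z ⟨w, hw, hw', hz⟩
  simp only [actionCoord, Function.comp_apply, velocityMap, ← hz,
    chartTransition_extChartAt p' hw, ← lagrangianCoord_trans L hw hw', map_smul]

theorem ContDiffAt.smul_const' {V F : Type*} [NormedAddCommGroup V] [NormedSpace ℝ V]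
    [NormedAddCommGroup F] [NormedSpace ℝ F] {m : WithTop ℕ∞} {c : V → ℝ} {q : V}
    (hc : ContDiffAt ℝ m c q) (A : F) : ContDiffAt ℝ m (fun q => c q • A) q :=
  hc.smul contDiffAt_const

/-- The metric in the coordinates around `p`, as a bilinear form. -/
def metricForm (g : SmoothMetric n M) (p : M) (q : EuclideanSpace ℝ (Fin n)) :
    EuclideanSpace ℝ (Fin n) →L[ℝ] EuclideanSpace ℝ (Fin n) →L[ℝ] ℝ :=
  ∑ i, ∑ j, metricCoord g p q i j •
    (EuclideanSpace.proj i : EuclideanSpace ℝ (Fin n) →L[ℝ] ℝ).smulRight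
      (EuclideanSpace.proj j : EuclideanSpace ℝ (Fin n) →L[ℝ] ℝ)

theorem metricForm_apply (g : SmoothMetric n M) (p : M) (q v w : 𝔼) :
    metricForm g p q v w = ∑ i, ∑ j, metricCoord g p q i j * (v i * w j) := by
  simp [metricForm]

theorem EuclideanSpace.eq_sum_single (v : 𝔼) : v = ∑ i, v i • EuclideanSpace.single i (1 : ℝ) := by
  ext j
  simp [Finset.sum_apply, Pi.single_apply]

theorem metricForm_eq (g : SmoothMetric n M) (p : M) (q v w : 𝔼) :
    metricForm g p q v w = g.inner ((extChartAt (𝓡 n) p).symm q)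
      (vecOfCoord p ((extChartAt (𝓡 n) p).symm q) v)
      (vecOfCoord p ((extChartAt (𝓡 n) p).symm q) w) := by
  rw [metricForm_apply]
  conv_rhs => rw [EuclideanSpace.eq_sum_single v, EuclideanSpace.eq_sum_single w]
  unfold metricCoord vecOfCoord
  simp only [map_sum, map_smul, Matrix.of_apply, _root_.sum_apply,
    _root_.smul_apply, smul_eq_mul, Finset.mul_sum]
  rw [Finset.sum_comm]
  refine Finset.sum_congr rfl fun j _ => Finset.sum_congr rfl fun i _ => ?_
  ring

theorem metricForm_symm (g : SmoothMetric n M) (p : M) (q v w : 𝔼) :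
    metricForm g p q v w = metricForm g p q w v := by
  rw [metricForm_eq, metricForm_eq, g.symm]

theorem metricForm_pos (g : SmoothMetric n M) {p y : M} (hp : y ∈ (extChartAt (𝓡 n) p).source)
    {v : 𝔼} (hv : v ≠ 0) : 0 < metricForm g p (extChartAt (𝓡 n) p y) v v := by
  rw [metricForm_eq, (extChartAt (𝓡 n) p).left_inv hp]
  apply g.pos
  intro h0
  apply hv
  have := vecOfCoord_eq hp v
  rw [h0] at this
  have h1 := tangentCoordChange_comp (I := 𝓡 n) (v := v)
    ⟨⟨hp, mem_extChartAt_source y⟩, hp⟩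
  rw [tangentCoordChange_self hp] at h1
  rw [← h1]
  exact (congrArg _ this.symm).trans (map_zero _)

theorem metricForm_trans (g : SmoothMetric n M) {p p' y : M}
    (hp : y ∈ (extChartAt (𝓡 n) p).source) (hp' : y ∈ (extChartAt (𝓡 n) p').source) (v w : 𝔼) :
    metricForm g p (extChartAt (𝓡 n) p y) v w = metricForm g p' (extChartAt (𝓡 n) p' y)
      (fderiv ℝ (chartTransition p p') (extChartAt (𝓡 n) p y) v)
      (fderiv ℝ (chartTransition p p') (extChartAt (𝓡 n) p y) w) := by
  rw [metricForm_eq, metricForm_eq, (extChartAt (𝓡 n) p).left_inv hp,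
    (extChartAt (𝓡 n) p').left_inv hp', vecOfCoord_trans hp hp', vecOfCoord_trans hp hp']

theorem contDiffAt_metricCoord (g : SmoothMetric n M) {p : M} {q : 𝔼}
    (hq : q ∈ (extChartAt (𝓡 n) p).target) (i j : Fin n) :
    ContDiffAt ℝ ∞ (fun q => metricCoord g p q i j) q := by
  have hb : ContMDiffAt 𝓘(ℝ, 𝔼) (𝓡 n) ∞ (extChartAt (𝓡 n) p).symm q :=
    (contMDiffOn_extChartAt_symm p).contMDiffAt ((isOpen_extChartAt_target p).mem_nhds hq)
  have hv : ∀ v : 𝔼, ContMDiffAt 𝓘(ℝ, 𝔼) (𝓡 n).tangent ∞ (fun z : 𝔼 =>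
      (⟨(extChartAt (𝓡 n) p).symm z, vecOfCoord p ((extChartAt (𝓡 n) p).symm z) v⟩ :
        TangentBundle (𝓡 n) M)) q := fun v =>
    (contMDiffAt_vecOfCoord (v := v) hq).comp q
      (contDiffAt_id.prodMk contDiffAt_const).contMDiffAt
  have : ContMDiffAt 𝓘(ℝ, 𝔼) ((𝓡 n).prod 𝓘(ℝ)) ∞
      (fun z ↦ Bundle.TotalSpace.mk' ℝ (E := Bundle.Trivial M ℝ) ((extChartAt (𝓡 n) p).symm z)
        (metricCoord g p z i j)) q := by
    apply ContMDiffAt.clm_bundle_apply₂ (F₁ := 𝔼) (F₂ := 𝔼)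
    · exact ContMDiffAt.comp q g.contMDiff.contMDiffAt hb
    · exact hv _
    · exact hv _
  exact (Bundle.contMDiffAt_totalSpace.1 this).2.contDiffAt

set_option synthInstance.maxHeartbeats 200000 in
theorem contDiffAt_metricForm (g : SmoothMetric n M) {p : M} {q : 𝔼}
    (hq : q ∈ (extChartAt (𝓡 n) p).target) : ContDiffAt ℝ ∞ (metricForm g p) q := by
  unfold metricForm
  refine ContDiffAt.sum fun i _ => ContDiffAt.sum fun j _ => ?_
  exact (contDiffAt_metricCoord g hq i j).smul_const' _

set_option synthInstance.maxHeartbeats 200000 in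
theorem fderiv_metricForm (g : SmoothMetric n M) {p : M} {q : 𝔼}
    (hq : q ∈ (extChartAt (𝓡 n) p).target) (z v w : 𝔼) :
    fderiv ℝ (metricForm g p) q z v w =
      ∑ k, ∑ i, ∑ j, z k * v i * w j * metricPartial g p q k i j := by
  have h1 : HasDerivAt (fun s : ℝ => metricForm g p (q + s • z) v w)
      (fderiv ℝ (metricForm g p) q z v w) 0 := by
    have := DifferentiableAt.hasDerivAt_line (F := 𝔼 →L[ℝ] 𝔼 →L[ℝ] ℝ)
      ((contDiffAt_metricForm g hq).differentiableAt (by simp)) z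
    simpa using (this.clm_apply (hasDerivAt_const 0 v)).clm_apply (hasDerivAt_const 0 w)
  have h2 : HasDerivAt (fun s : ℝ => metricForm g p (q + s • z) v w)
      (∑ i, ∑ j, fderiv ℝ (fun q => metricCoord g p q i j) q z * (v i * w j)) 0 := by
    simp only [metricForm_apply]
    refine HasDerivAt.fun_sum fun i _ => HasDerivAt.fun_sum fun j _ => ?_
    exact (((contDiffAt_metricCoord g hq i j).differentiableAt (by simp)).hasDerivAt_line
      z).mul_const _
  rw [h1.unique h2]
  have h3 : ∀ i j, fderiv ℝ (fun q => metricCoord g p q i j) q z =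
      ∑ k, z k * metricPartial g p q k i j := by
    intro i j
    conv_lhs => rw [EuclideanSpace.eq_sum_single z]
    simp [metricPartial]
  simp only [h3, Finset.sum_mul]
  rw [Finset.sum_congr rfl fun i _ => Finset.sum_comm, Finset.sum_comm]
  refine Finset.sum_congr rfl fun k _ => Finset.sum_congr rfl fun i _ =>
    Finset.sum_congr rfl fun j _ => ?_
  ring

/-- The Christoffel symbols in the coordinates around `p`, as a bilinear map. -/
def christoffelBilin (g : SmoothMetric n M) (p : M) (q : EuclideanSpace ℝ (Fin n)) :
    EuclideanSpace ℝ (Fin n) →L[ℝ] EuclideanSpace ℝ (Fin n) →L[ℝ] EuclideanSpace ℝ (Fin n) :=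
  ∑ k, ∑ i, ∑ j, christoffel g p q k i j •
    (EuclideanSpace.proj i : EuclideanSpace ℝ (Fin n) →L[ℝ] ℝ).smulRight
      ((EuclideanSpace.proj j : EuclideanSpace ℝ (Fin n) →L[ℝ] ℝ).smulRight
        (EuclideanSpace.single k (1 : ℝ)))

theorem christoffelBilin_apply (g : SmoothMetric n M) (p : M) (q v w : 𝔼) (k : Fin n) :
    christoffelBilin g p q v w k = ∑ i, ∑ j, christoffel g p q k i j * v i * w j := by
  simp [christoffelBilin, Finset.sum_apply, Pi.single_apply, mul_assoc]

theorem christoffelQuad_eq (g : SmoothMetric n M) (p : M) (q v : 𝔼) :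
    christoffelQuad g p q v = christoffelBilin g p q v v := by
  ext k
  rw [christoffelBilin_apply]
  rfl

theorem metricCoord_symm (g : SmoothMetric n M) (p : M) (q : 𝔼) (i j : Fin n) :
    metricCoord g p q i j = metricCoord g p q j i := g.symm _ _ _

theorem metricPartial_symm (g : SmoothMetric n M) (p : M) (q : 𝔼) (k i j : Fin n) :
    metricPartial g p q k i j = metricPartial g p q k j i := by
  unfold metricPartial
  simp only [metricCoord_symm g p _ i j]

theorem christoffel_symm (g : SmoothMetric n M) (p : M) (q : 𝔼) (k i j : Fin n) :
    christoffel g p q k i j = christoffel g p q k j i := by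
  unfold christoffel
  congr 1
  refine Finset.sum_congr rfl fun l _ => ?_
  rw [metricPartial_symm g p q l i j]
  ring

theorem christoffelBilin_symm (g : SmoothMetric n M) (p : M) (q v w : 𝔼) :
    christoffelBilin g p q v w = christoffelBilin g p q w v := by
  ext k
  rw [christoffelBilin_apply, christoffelBilin_apply, Finset.sum_comm]
  refine Finset.sum_congr rfl fun i _ => Finset.sum_congr rfl fun j _ => ?_
  rw [christoffel_symm]
  ring

theorem isUnit_det_metricCoord (g : SmoothMetric n M) {p y : M}
    (hp : y ∈ (extChartAt (𝓡 n) p).source) :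
    IsUnit (metricCoord g p (extChartAt (𝓡 n) p y)).det := by
  rw [isUnit_iff_ne_zero]
  intro h0
  obtain ⟨v, hv, hv0⟩ := Matrix.exists_mulVec_eq_zero_iff.2 h0
  have h1 := metricForm_pos g hp (v := WithLp.toLp 2 v) (by simpa using hv)
  rw [metricForm_apply] at h1
  refine h1.ne' (Finset.sum_eq_zero fun i _ => ?_)
  have h2 : ∀ i, ∑ j, metricCoord g p (extChartAt (𝓡 n) p y) i j * v j = 0 := fun i =>
    congrFun hv0 i
  rw [← mul_zero (v i), ← h2 i, Finset.mul_sum]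
  exact Finset.sum_congr rfl fun j _ => by
    change _ * (v i * v j) = _
    ring

theorem contDiffAt_christoffel (g : SmoothMetric n M) {p y : M}
    (hp : y ∈ (extChartAt (𝓡 n) p).source) (k i j : Fin n) :
    ContDiffAt ℝ ∞ (fun q => christoffel g p q k i j) (extChartAt (𝓡 n) p y) := by
  have hq := (extChartAt (𝓡 n) p).map_source hp
  have hm := fun i j => contDiffAt_metricCoord g hq i j
  have hpart : ∀ k i j, ContDiffAt ℝ ∞ (fun q => metricPartial g p q k i j)
      (extChartAt (𝓡 n) p y) := fun k i j =>
    ((hm i j).fderiv_right (m := ∞) (by simp)).clm_apply contDiffAt_const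
  -- Smoothness of the inverse matrix by Cramer's rule: determinants, hence also adjugate entries,
  -- are polynomials in the entries.
  have hdet : ∀ B : 𝔼 → Matrix (Fin n) (Fin n) ℝ,
      (∀ i j, ContDiffAt ℝ ∞ (fun q => B q i j) (extChartAt (𝓡 n) p y)) →
      ContDiffAt ℝ ∞ (fun q => (B q).det) (extChartAt (𝓡 n) p y) := by
    intro B hB
    simp only [Matrix.det_apply]
    exact ContDiffAt.sum fun σ _ => ContDiffAt.const_smul _ (contDiffAt_prod fun i _ => hB _ _)
  have hinv : ∀ k l, ContDiffAt ℝ ∞ (fun q => (metricCoord g p q)⁻¹ k l)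
      (extChartAt (𝓡 n) p y) := by
    intro k l
    simp only [Matrix.inv_def, Matrix.smul_apply, smul_eq_mul, Ring.inverse_eq_inv',
      Matrix.adjugate_apply]
    refine ((hdet _ hm).inv (isUnit_det_metricCoord g hp).ne_zero).mul (hdet _ fun a b => ?_)
    simp only [Matrix.updateRow_apply]
    split_ifs
    · exact contDiffAt_const
    · exact hm a b
  unfold christoffel
  refine contDiffAt_const.mul (ContDiffAt.sum fun l _ => (hinv k l).mul ?_)
  exact ((hpart _ _ _).add (hpart _ _ _)).sub (hpart _ _ _)

set_option synthInstance.maxHeartbeats 200000 in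
theorem contDiffAt_christoffelBilin (g : SmoothMetric n M) {p y : M}
    (hp : y ∈ (extChartAt (𝓡 n) p).source) :
    ContDiffAt ℝ ∞ (christoffelBilin g p) (extChartAt (𝓡 n) p y) := by
  unfold christoffelBilin
  refine ContDiffAt.sum fun k _ => ContDiffAt.sum fun i _ => ContDiffAt.sum fun j _ => ?_
  exact (contDiffAt_christoffel g hp k i j).smul_const' _

/-- The Koszul formula in coordinates. -/
theorem two_mul_metricForm_christoffelBilin (g : SmoothMetric n M) {p y : M}
    (hp : y ∈ (extChartAt (𝓡 n) p).source) (v₁ v₂ w : 𝔼) :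
    2 * metricForm g p (extChartAt (𝓡 n) p y) (christoffelBilin g p (extChartAt (𝓡 n) p y) v₁ v₂) w
      = fderiv ℝ (metricForm g p) (extChartAt (𝓡 n) p y) v₁ v₂ w
        + fderiv ℝ (metricForm g p) (extChartAt (𝓡 n) p y) v₂ v₁ w
        - fderiv ℝ (metricForm g p) (extChartAt (𝓡 n) p y) w v₁ v₂ := by
  have hq := (extChartAt (𝓡 n) p).map_source hp
  have hu := isUnit_det_metricCoord g hp
  set q := extChartAt (𝓡 n) p y
  simp only [fderiv_metricForm g hq]
  -- `c` is twice the Christoffel vector with its index lowered by the metric.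
  let c : Fin n → ℝ := fun l => ∑ i, ∑ j, (metricPartial g p q i j l + metricPartial g p q j i l
    - metricPartial g p q l i j) * v₁ i * v₂ j
  have h1 : ∀ k, 2 * christoffelBilin g p q v₁ v₂ k = ((metricCoord g p q)⁻¹.mulVec c) k := by
    intro k
    rw [christoffelBilin_apply]
    simp only [christoffel, Matrix.mulVec, dotProduct, c, Finset.mul_sum, Finset.sum_mul]
    rw [Finset.sum_congr rfl fun i _ => Finset.sum_comm, Finset.sum_comm]
    refine Finset.sum_congr rfl fun k _ => Finset.sum_congr rfl fun i _ =>
      Finset.sum_congr rfl fun j _ => ?_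
    ring
  have h2 : ∀ l, ∑ k, metricCoord g p q k l * (2 * christoffelBilin g p q v₁ v₂ k) = c l := by
    intro l
    have h3 : (metricCoord g p q).mulVec ((metricCoord g p q)⁻¹.mulVec c) = c := by
      rw [Matrix.mulVec_mulVec, Matrix.mul_nonsing_inv _ hu, Matrix.one_mulVec]
    conv_rhs => rw [← h3]
    simp only [Matrix.mulVec, dotProduct] at h1 ⊢
    refine Finset.sum_congr rfl fun k _ => ?_
    rw [h1, metricCoord_symm]
  rw [metricForm_apply, Finset.mul_sum, Finset.sum_congr rfl fun i _ => Finset.mul_sum _ _ _,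
    Finset.sum_comm]
  have h4 : ∀ l, ∑ k, 2 * (metricCoord g p q k l * (christoffelBilin g p q v₁ v₂ k * w l)) =
      c l * w l := by
    intro l
    rw [← h2, Finset.sum_mul]
    exact Finset.sum_congr rfl fun k _ => by ring
  rw [Finset.sum_congr rfl fun l _ => h4 l]
  simp only [c, Finset.sum_mul]
  have e1 : ∑ k, ∑ i, ∑ j, v₁ k * v₂ i * w j * metricPartial g p q k i j =
      ∑ l, ∑ i, ∑ j, v₁ i * v₂ j * w l * metricPartial g p q i j l := by
    rw [Finset.sum_congr rfl fun i _ => Finset.sum_comm, Finset.sum_comm]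
  have e2 : ∑ k, ∑ i, ∑ j, v₂ k * v₁ i * w j * metricPartial g p q k i j =
      ∑ l, ∑ i, ∑ j, v₁ i * v₂ j * w l * metricPartial g p q j i l := by
    rw [Finset.sum_congr rfl fun i _ => Finset.sum_comm, Finset.sum_comm]
    refine Finset.sum_congr rfl fun l _ => ?_
    rw [Finset.sum_comm]
    exact Finset.sum_congr rfl fun k _ => Finset.sum_congr rfl fun i _ => by ring
  rw [e1, e2, ← Finset.sum_add_distrib, ← Finset.sum_sub_distrib]
  refine Finset.sum_congr rfl fun l _ => ?_
  rw [← Finset.sum_add_distrib, ← Finset.sum_sub_distrib]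
  refine Finset.sum_congr rfl fun i _ => ?_
  rw [← Finset.sum_add_distrib, ← Finset.sum_sub_distrib]
  refine Finset.sum_congr rfl fun j _ => ?_
  ring

/-- The chart transition is an isometry of the coordinate metrics, and by nondegeneracy the Koszul
formula determines the symbols from the metric. -/
theorem christoffelBilin_trans (g : SmoothMetric n M) {p p' y : M}
    (hp : y ∈ (extChartAt (𝓡 n) p).source) (hp' : y ∈ (extChartAt (𝓡 n) p').source) (v w : 𝔼) :
    christoffelBilin g p' (chartTransition p p' (extChartAt (𝓡 n) p y))
      (fderiv ℝ (chartTransition p p') (extChartAt (𝓡 n) p y) v)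
      (fderiv ℝ (chartTransition p p') (extChartAt (𝓡 n) p y) w) =
    fderiv ℝ (chartTransition p p') (extChartAt (𝓡 n) p y)
      (christoffelBilin g p (extChartAt (𝓡 n) p y) v w) -
      fderiv ℝ (fderiv ℝ (chartTransition p p')) (extChartAt (𝓡 n) p y) v w := by
  have ht := chartTransition_extChartAt p' hp
  refine christoffel_transform (m := metricForm g p) (m' := metricForm g p')
    ((contDiffAt_chartTransition hp hp').of_le ENat.LEInfty.out)
    ((contDiffAt_metricForm g ((extChartAt (𝓡 n) p).map_source hp)).differentiableAt (by simp))
    ?_ ?_ (fun v w => metricForm_symm _ _ _ _ _) ?_ (fderiv_chartTransition_surjective hp hp')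
    (two_mul_metricForm_christoffelBilin g hp) ?_ v w
  · rw [ht]
    exact (contDiffAt_metricForm g ((extChartAt (𝓡 n) p').map_source hp')).differentiableAt
      (by simp)
  · filter_upwards [eventually_mem_charts hp hp'] with q ⟨z, hz, hz', hzq⟩ v w
    rw [← hzq, chartTransition_extChartAt p' hz]
    exact metricForm_trans g hz hz' v w
  · intro v hv
    by_contra hne
    have := metricForm_pos g hp' hne
    rw [← ht, hv v] at this
    exact lt_irrefl _ this
  · rw [ht]
    exact two_mul_metricForm_christoffelBilin g hp'

theorem hessForm_chart (g : SmoothMetric n M) {L : TangentBundle (𝓡 n) M → ℝ}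
    (hL : ContMDiff (𝓡 n).tangent 𝓘(ℝ, ℝ) ∞ L) (h : ℝ) {p p' m : M}
    (hp : m ∈ (extChartAt (𝓡 n) p).source) (hp' : m ∈ (extChartAt (𝓡 n) p').source)
    {y : 𝔼 × 𝔼 × ℝ} (hy : y.1 = extChartAt (𝓡 n) p m) (hτ : y.2.2 ≠ 0) (z w : 𝔼 × 𝔼 × ℝ) :
    hessForm (actionCoord L h p) (christoffelBilin g p) y z w =
      hessForm (actionCoord L h p') (christoffelBilin g p') (velocityMap (chartTransition p p') y)
        (fderiv ℝ (velocityMap (chartTransition p p')) y z)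
        (fderiv ℝ (velocityMap (chartTransition p p')) y w) := by
  have ht := chartTransition_extChartAt p' hp
  refine hessForm_velocityMap ?_ ?_ (actionCoord_trans L h hp hp' hy) ?_ ?_ ?_ z w
  · rw [hy]
    exact (contDiffAt_chartTransition hp hp').of_le ENat.LEInfty.out
  · refine (contDiffAt_actionCoord hL h (y := velocityMap _ y) ?_ hτ).of_le ENat.LEInfty.out
    simp only [velocityMap, hy, ht]
    exact (extChartAt (𝓡 n) p').map_source hp'
  · rw [hy]
    exact (contDiffAt_christoffelBilin g hp).differentiableAt (by simp)
  · rw [hy, ht]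
    exact (contDiffAt_christoffelBilin g hp').differentiableAt (by simp)
  · rw [hy]
    filter_upwards [eventually_mem_charts hp hp'] with q ⟨z, hz, hz', hzq⟩ v w
    rw [← hzq]
    exact christoffelBilin_trans g hz hz' v w

end Coordinates

/-! ### First and second variation densities, and their independence of the chart. -/

section Densities

open Filter Topology

theorem HasDerivAt.clm_comp_apply {V F W : Type*} [NormedAddCommGroup V] [NormedSpace ℝ V]
    [NormedAddCommGroup F] [NormedSpace ℝ F] [NormedAddCommGroup W] [NormedSpace ℝ W]
    {A : V → F →L[ℝ] W} {a : ℝ → V} {u : ℝ → F} {a' : V} {u' : F} {t : ℝ}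
    (hA : DifferentiableAt ℝ A (a t)) (ha : HasDerivAt a a' t) (hu : HasDerivAt u u' t) :
    HasDerivAt (fun s => A (a s) (u s)) (fderiv ℝ A (a t) a' (u t) + A (a t) u') t :=
  (hA.hasFDerivAt.comp_hasDerivAt t ha).clm_apply hu

set_option synthInstance.maxHeartbeats 200000 in
theorem HasDerivAt.bilin_comp_apply {V F W : Type*} [NormedAddCommGroup V] [NormedSpace ℝ V]
    [NormedAddCommGroup F] [NormedSpace ℝ F] [NormedAddCommGroup W] [NormedSpace ℝ W]
    {A : V → F →L[ℝ] F →L[ℝ] W} {a : ℝ → V} {u v : ℝ → F} {a' : V} {u' v' : F} {t : ℝ}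
    (hA : DifferentiableAt ℝ A (a t)) (ha : HasDerivAt a a' t) (hu : HasDerivAt u u' t)
    (hv : HasDerivAt v v' t) :
    HasDerivAt (fun s => A (a s) (u s) (v s))
      (fderiv ℝ A (a t) a' (u t) (v t) + A (a t) u' (v t) + A (a t) (u t) v') t := by
  have h1 := HasFDerivAt.comp_hasDerivAt (E := F →L[ℝ] F →L[ℝ] W) t hA.hasFDerivAt ha
  exact (h1.clm_apply hu).clm_apply hv

variable {n : ℕ} {M : Type*} [TopologicalSpace M] [ChartedSpace (EuclideanSpace ℝ (Fin n)) M]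
  [IsManifold (𝓡 n) ∞ M]

local notation "𝔼" => EuclideanSpace ℝ (Fin n)

/-- The point `(x(t), x'(t), T)` in the coordinates around `p`. -/
def loopPoint (x : ℝ → M) (T : ℝ) (p : M) (t : ℝ) :
    EuclideanSpace ℝ (Fin n) × EuclideanSpace ℝ (Fin n) × ℝ :=
  (extChartAt (𝓡 n) p (x t), deriv (fun s => extChartAt (𝓡 n) p (x s)) t, T)

/-- The vector `(ξ(t), ξ'(t), b)` in the coordinates around `p`. -/
def fieldJet (x : ℝ → M) (ξ : ∀ t, TangentSpace (𝓡 n) (x t)) (b : ℝ) (p : M) (t : ℝ) :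
    EuclideanSpace ℝ (Fin n) × EuclideanSpace ℝ (Fin n) × ℝ :=
  (fieldCoord x ξ p t, deriv (fieldCoord x ξ p) t, b)

/-- The density of the first variation of the free period action in the coordinates around `p`. -/
def firstDensity (L : TangentBundle (𝓡 n) M → ℝ) (h : ℝ) (x : ℝ → M) (T : ℝ) (p : M)
    (ξ : ∀ t, TangentSpace (𝓡 n) (x t)) (b : ℝ) (t : ℝ) : ℝ :=
  fderiv ℝ (actionCoord L h p) (loopPoint x T p t) (fieldJet x ξ b p t)

/-- The polarized density of the second variation of the free period action in the coordinates
around `p`. -/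
def secondDensity (g : SmoothMetric n M) (L : TangentBundle (𝓡 n) M → ℝ) (h : ℝ) (x : ℝ → M)
    (T : ℝ) (p : M) (ξ : ∀ t, TangentSpace (𝓡 n) (x t)) (b : ℝ)
    (η : ∀ t, TangentSpace (𝓡 n) (x t)) (c : ℝ) (t : ℝ) : ℝ :=
  hessForm (actionCoord L h p) (christoffelBilin g p) (loopPoint x T p t) (fieldJet x ξ b p t)
    (fieldJet x η c p t)

variable {x : ℝ → M}

omit [IsManifold (𝓡 n) ∞ M] in
theorem eventually_mem_source (hx : Continuous x) {p : M} {t : ℝ}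
    (hp : x t ∈ (extChartAt (𝓡 n) p).source) :
    ∀ᶠ s in 𝓝 t, x s ∈ (extChartAt (𝓡 n) p).source :=
  hx.continuousAt.eventually ((isOpen_extChartAt_source p).mem_nhds hp)

theorem contDiffAt_loopCoord (hx : ContMDiff 𝓘(ℝ, ℝ) (𝓡 n) ∞ x) {p : M} {t : ℝ}
    (hp : x t ∈ (extChartAt (𝓡 n) p).source) :
    ContDiffAt ℝ ∞ (fun s => extChartAt (𝓡 n) p (x s)) t := by
  rw [extChartAt_source] at hp
  exact ((contMDiffAt_extChartAt' hp).comp t hx.contMDiffAt).contDiffAt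

omit [IsManifold (𝓡 n) ∞ M] in
theorem loopPoint_mem_target {p : M} {t : ℝ} (T : ℝ) (hp : x t ∈ (extChartAt (𝓡 n) p).source) :
    (loopPoint x T p t).1 ∈ (extChartAt (𝓡 n) p).target :=
  (extChartAt (𝓡 n) p).map_source hp

theorem contDiffAt_loopPoint (hx : ContMDiff 𝓘(ℝ, ℝ) (𝓡 n) ∞ x) (T : ℝ) {p : M} {t : ℝ}
    (hp : x t ∈ (extChartAt (𝓡 n) p).source) : ContDiffAt ℝ ∞ (loopPoint (n := n) x T p) t := by
  have h1 : ContDiffAt ℝ ∞ (deriv fun s => extChartAt (𝓡 n) p (x s)) t := by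
    have h2 : (deriv fun s => extChartAt (𝓡 n) p (x s)) =
        fun t => fderiv ℝ (fun s => extChartAt (𝓡 n) p (x s)) t 1 :=
      funext fun t => fderiv_apply_one_eq_deriv.symm
    rw [h2]
    exact ((contDiffAt_loopCoord hx hp).fderiv_right (m := ∞) (by simp)).clm_apply contDiffAt_const
  exact (contDiffAt_loopCoord hx hp).prodMk (h1.prodMk contDiffAt_const)

theorem fieldCoord_eventuallyEq (hx : Continuous x) (ξ : ∀ t, TangentSpace (𝓡 n) (x t)) {p p' : M}
    {t : ℝ} (hp : x t ∈ (extChartAt (𝓡 n) p).source) (hp' : x t ∈ (extChartAt (𝓡 n) p').source) :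
    fieldCoord x ξ p' =ᶠ[𝓝 t] fun s =>
      fderiv ℝ (chartTransition p p') (extChartAt (𝓡 n) p (x s)) (fieldCoord x ξ p s) := by
  filter_upwards [eventually_mem_source hx hp, eventually_mem_source hx hp'] with s hs hs'
  exact (fieldCoord_trans ξ hs hs').symm

theorem hasDerivAt_fieldCoord_trans (hx : ContMDiff 𝓘(ℝ, ℝ) (𝓡 n) ∞ x)
    {ξ : ∀ t, TangentSpace (𝓡 n) (x t)} {p p' : M}
    {t : ℝ} (hp : x t ∈ (extChartAt (𝓡 n) p).source) (hp' : x t ∈ (extChartAt (𝓡 n) p').source)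
    (hξ : DifferentiableAt ℝ (fieldCoord x ξ p) t) :
    HasDerivAt (fieldCoord x ξ p')
      (fderiv ℝ (fderiv ℝ (chartTransition p p')) (extChartAt (𝓡 n) p (x t))
        (deriv (fun s => extChartAt (𝓡 n) p (x s)) t) (fieldCoord x ξ p t) +
        fderiv ℝ (chartTransition p p') (extChartAt (𝓡 n) p (x t)) (deriv (fieldCoord x ξ p) t))
      t := by
  have hφ : ContDiffAt ℝ 2 (chartTransition p p') (extChartAt (𝓡 n) p (x t)) :=
    (contDiffAt_chartTransition hp hp').of_le ENat.LEInfty.out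
  have h1 := ((contDiffAt_loopCoord hx hp).differentiableAt (by simp)).hasDerivAt
  have h2 := HasDerivAt.clm_comp_apply hφ.differentiableAt_fderiv h1 hξ.hasDerivAt
  exact h2.congr_of_eventuallyEq (fieldCoord_eventuallyEq hx.continuous ξ hp hp')

theorem differentiableAt_fieldCoord_trans (hx : ContMDiff 𝓘(ℝ, ℝ) (𝓡 n) ∞ x)
    {ξ : ∀ t, TangentSpace (𝓡 n) (x t)} {p p' : M}
    {t : ℝ} (hp : x t ∈ (extChartAt (𝓡 n) p).source) (hp' : x t ∈ (extChartAt (𝓡 n) p').source)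
    (hξ : DifferentiableAt ℝ (fieldCoord x ξ p) t) :
    DifferentiableAt ℝ (fieldCoord x ξ p') t :=
  (hasDerivAt_fieldCoord_trans hx hp hp' hξ).differentiableAt

theorem velocityMap_loopPoint (hx : ContMDiff 𝓘(ℝ, ℝ) (𝓡 n) ∞ x) (T : ℝ) {p p' : M} {t : ℝ}
    (hp : x t ∈ (extChartAt (𝓡 n) p).source) (hp' : x t ∈ (extChartAt (𝓡 n) p').source) :
    velocityMap (chartTransition (n := n) p p') (loopPoint x T p t) = loopPoint x T p' t := by
  have hφ := (contDiffAt_chartTransition hp hp').differentiableAt (by simp)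
  have h1 := ((contDiffAt_loopCoord hx hp).differentiableAt (by simp)).hasDerivAt
  have h2 := hφ.hasFDerivAt.comp_hasDerivAt t h1
  have h3 : (fun s => extChartAt (𝓡 n) p' (x s)) =ᶠ[𝓝 t]
      chartTransition p p' ∘ fun s => extChartAt (𝓡 n) p (x s) := by
    filter_upwards [eventually_mem_source hx.continuous hp] with s hs
    exact (chartTransition_extChartAt p' hs).symm
  unfold velocityMap loopPoint
  rw [(h2.congr_of_eventuallyEq h3).deriv]
  simp only [chartTransition_extChartAt p' hp]

/-- The velocity component D²φ(ξ,x') + Dφ ξ' is the time derivative of Dφ(x)ξ, by symmetry of D²φ.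
-/
theorem fderiv_velocityMap_fieldJet (hx : ContMDiff 𝓘(ℝ, ℝ) (𝓡 n) ∞ x) (T : ℝ)
    {ξ : ∀ t, TangentSpace (𝓡 n) (x t)} (b : ℝ) {p p' : M} {t : ℝ}
    (hp : x t ∈ (extChartAt (𝓡 n) p).source) (hp' : x t ∈ (extChartAt (𝓡 n) p').source)
    (hξ : DifferentiableAt ℝ (fieldCoord x ξ p) t) :
    fderiv ℝ (velocityMap (chartTransition (n := n) p p')) (loopPoint x T p t) (fieldJet x ξ b p t) =
      fieldJet x ξ b p' t := by
  have hφ : ContDiffAt ℝ 2 (chartTransition p p') (extChartAt (𝓡 n) p (x t)) :=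
    (contDiffAt_chartTransition hp hp').of_le ENat.LEInfty.out
  rw [fderiv_velocityMap hφ]
  unfold fieldJet loopPoint
  rw [(hasDerivAt_fieldCoord_trans hx hp hp' hξ).deriv, ← fieldCoord_trans ξ hp hp']
  simp only [hφ.fderiv_fderiv_comm (fieldCoord x ξ p t)]

theorem firstDensity_trans {L : TangentBundle (𝓡 n) M → ℝ}
    (hL : ContMDiff (𝓡 n).tangent 𝓘(ℝ, ℝ) ∞ L) (h : ℝ) (hx : ContMDiff 𝓘(ℝ, ℝ) (𝓡 n) ∞ x) {T : ℝ}
    (hT : T ≠ 0) {ξ : ∀ t, TangentSpace (𝓡 n) (x t)} (b : ℝ) {p p' : M} {t : ℝ}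
    (hp : x t ∈ (extChartAt (𝓡 n) p).source) (hp' : x t ∈ (extChartAt (𝓡 n) p').source)
    (hξ : DifferentiableAt ℝ (fieldCoord x ξ p) t) :
    firstDensity L h x T p ξ b t = firstDensity L h x T p' ξ b t := by
  have hφ : ContDiffAt ℝ 2 (chartTransition p p') (loopPoint x T p t).1 :=
    (contDiffAt_chartTransition hp hp').of_le ENat.LEInfty.out
  unfold firstDensity
  rw [fderiv_comp_velocityMap hφ ?_ (actionCoord_trans L h hp hp' rfl),
    velocityMap_loopPoint hx T hp hp', fderiv_velocityMap_fieldJet hx T b hp hp' hξ]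
  rw [velocityMap_loopPoint hx T hp hp']
  exact (contDiffAt_actionCoord hL h (loopPoint_mem_target T hp') hT).differentiableAt (by simp)

/-- Replaces the chart around `x t`, which changes with `t`, by one chart fixed on a whole interval.
-/
theorem secondDensity_trans (g : SmoothMetric n M) {L : TangentBundle (𝓡 n) M → ℝ}
    (hL : ContMDiff (𝓡 n).tangent 𝓘(ℝ, ℝ) ∞ L) (h : ℝ) (hx : ContMDiff 𝓘(ℝ, ℝ) (𝓡 n) ∞ x) {T : ℝ}
    (hT : T ≠ 0) {ξ η : ∀ t, TangentSpace (𝓡 n) (x t)} (b c : ℝ) {p p' : M} {t : ℝ}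
    (hp : x t ∈ (extChartAt (𝓡 n) p).source) (hp' : x t ∈ (extChartAt (𝓡 n) p').source)
    (hξ : DifferentiableAt ℝ (fieldCoord x ξ p) t) (hη : DifferentiableAt ℝ (fieldCoord x η p) t) :
    secondDensity g L h x T p ξ b η c t = secondDensity g L h x T p' ξ b η c t := by
  unfold secondDensity
  rw [hessForm_chart g hL h hp hp' rfl hT, velocityMap_loopPoint hx T hp hp',
    fderiv_velocityMap_fieldJet hx T b hp hp' hξ, fderiv_velocityMap_fieldJet hx T c hp hp' hη]

/-- The second order term of the coordinate expansion of a geodesic variation, with its time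
derivative. -/
def christoffelJet (g : SmoothMetric n M) (x : ℝ → M) (T : ℝ) (ξ : ∀ t, TangentSpace (𝓡 n) (x t))
    (p : M) (t : ℝ) : EuclideanSpace ℝ (Fin n) × EuclideanSpace ℝ (Fin n) × ℝ :=
  let y := loopPoint x T p t
  let z := fieldJet x ξ 0 p t
  (christoffelBilin g p y.1 z.1 z.1, fderiv ℝ (christoffelBilin g p) y.1 y.2.1 z.1 z.1
    + christoffelBilin g p y.1 z.2.1 z.1 + christoffelBilin g p y.1 z.1 z.2.1, 0)

/-- The variation and its time derivative form a quadratic curve in r with velocity `fieldJet`;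
since the period is affine in r, the r² coefficient has no period component. -/
theorem actionDensity_eq (g : SmoothMetric n M) (L : TangentBundle (𝓡 n) M → ℝ) (h : ℝ)
    (hx : ContMDiff 𝓘(ℝ, ℝ) (𝓡 n) ∞ x) (T : ℝ) {ξ : ∀ t, TangentSpace (𝓡 n) (x t)} (b : ℝ) {t : ℝ}
    (hξ : DifferentiableAt ℝ (fieldCoord x ξ (x t)) t) (r : ℝ) :
    actionDensity g L h x T ξ b r t = actionCoord L h (x t) (loopPoint x T (x t) t +
      r • fieldJet x ξ b (x t) t - (r ^ 2 / 2) • christoffelJet g x T ξ (x t) t) := by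
  have hp : x t ∈ (extChartAt (𝓡 n) (x t)).source := mem_extChartAt_source (x t)
  have h1 := ((contDiffAt_loopCoord hx hp).differentiableAt (by simp)).hasDerivAt
  have h4 := HasDerivAt.bilin_comp_apply
    ((contDiffAt_christoffelBilin g hp).differentiableAt (by simp)) h1 hξ.hasDerivAt hξ.hasDerivAt
  have h5 := (h1.fun_add (hξ.hasDerivAt.fun_const_smul r)).fun_sub (h4.fun_const_smul (r ^ 2 / 2))
  have h6 : (fun s => variationCoord g x ξ (x t) r s) = fun s => extChartAt (𝓡 n) (x t) (x s) +
      r • fieldCoord x ξ (x t) s - (r ^ 2 / 2) • christoffelBilin g (x t)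
        (extChartAt (𝓡 n) (x t) (x s)) (fieldCoord x ξ (x t) s) (fieldCoord x ξ (x t) s) := by
    ext1 s
    rw [variationCoord, christoffelQuad_eq]
  unfold actionDensity actionCoord
  rw [h6, h5.deriv, variationCoord, christoffelQuad_eq]
  simp only [loopPoint, fieldJet, christoffelJet, Prod.smul_mk, Prod.mk_add_mk, Prod.mk_sub_mk,
    smul_eq_mul, mul_zero, sub_zero]

theorem deriv_actionDensity (g : SmoothMetric n M) {L : TangentBundle (𝓡 n) M → ℝ}
    (hL : ContMDiff (𝓡 n).tangent 𝓘(ℝ, ℝ) ∞ L) (h : ℝ) (hx : ContMDiff 𝓘(ℝ, ℝ) (𝓡 n) ∞ x) {T : ℝ}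
    (hT : T ≠ 0) {ξ : ∀ t, TangentSpace (𝓡 n) (x t)} (b : ℝ) {t : ℝ}
    (hξ : DifferentiableAt ℝ (fieldCoord x ξ (x t)) t) :
    deriv (fun r => actionDensity g L h x T ξ b r t) 0 = firstDensity L h x T (x t) ξ b t := by
  simp only [actionDensity_eq g L h hx T b hξ]
  exact deriv_comp_curve ((contDiffAt_actionCoord hL h (loopPoint_mem_target T
    (mem_extChartAt_source (x t))) hT).differentiableAt (by simp))

theorem iteratedDeriv_actionDensity (g : SmoothMetric n M) {L : TangentBundle (𝓡 n) M → ℝ}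
    (hL : ContMDiff (𝓡 n).tangent 𝓘(ℝ, ℝ) ∞ L) (h : ℝ) (hx : ContMDiff 𝓘(ℝ, ℝ) (𝓡 n) ∞ x) {T : ℝ}
    (hT : T ≠ 0) {ξ : ∀ t, TangentSpace (𝓡 n) (x t)} (b : ℝ) {t : ℝ}
    (hξ : DifferentiableAt ℝ (fieldCoord x ξ (x t)) t) :
    iteratedDeriv 2 (fun r => actionDensity g L h x T ξ b r t) 0 =
      secondDensity g L h x T (x t) ξ b ξ b t := by
  simp only [actionDensity_eq g L h hx T b hξ]
  exact iteratedDeriv_two_comp_curve ((contDiffAt_actionCoord hL h (loopPoint_mem_target T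
    (mem_extChartAt_source (x t))) hT).of_le ENat.LEInfty.out)

end Densities

/-! ### Local primitives of square-integrable functions. -/

section LocalPrimitive

open Filter Topology

variable {V W : Type*} [NormedAddCommGroup V] [NormedSpace ℝ V] [NormedAddCommGroup W]
  [NormedSpace ℝ W]

/-- On `[t₀ - δ, t₀ + δ]`, the function `u` is a primitive of the square-integrable function `w`. -/
structure IsH1Primitive (u w : ℝ → V) (t₀ δ : ℝ) : Prop where
  pos : 0 < δ
  memLp : MemLp w 2 (volume.restrict (Icc (t₀ - δ) (t₀ + δ)))
  eq_integral : ∀ t ∈ Icc (t₀ - δ) (t₀ + δ), u t = u t₀ + ∫ s in t₀..t, w s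

namespace IsH1Primitive

variable {u w u₁ w₁ u₂ w₂ : ℝ → V} {t₀ δ δ' : ℝ}

theorem mono (h : IsH1Primitive u w t₀ δ) (hδ' : 0 < δ') (hle : δ' ≤ δ) :
    IsH1Primitive u w t₀ δ' := by
  have hsub : Icc (t₀ - δ') (t₀ + δ') ⊆ Icc (t₀ - δ) (t₀ + δ) :=
    Icc_subset_Icc (by linarith) (by linarith)
  exact ⟨hδ', h.memLp.mono_measure (Measure.restrict_mono hsub le_rfl),
    fun t ht => h.eq_integral t (hsub ht)⟩

theorem integrableOn (h : IsH1Primitive u w t₀ δ) : IntegrableOn w (Icc (t₀ - δ) (t₀ + δ)) :=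
  h.memLp.integrable (by norm_num)

theorem center_mem (h : IsH1Primitive u w t₀ δ) : t₀ ∈ Icc (t₀ - δ) (t₀ + δ) :=
  ⟨by linarith [h.pos], by linarith [h.pos]⟩

theorem intervalIntegrable (h : IsH1Primitive u w t₀ δ) {a b : ℝ}
    (ha : a ∈ Icc (t₀ - δ) (t₀ + δ)) (hb : b ∈ Icc (t₀ - δ) (t₀ + δ)) :
    IntervalIntegrable w volume a b :=
  (h.integrableOn.mono_set (uIcc_subset_Icc ha hb)).intervalIntegrable

theorem sub_eq_integral (h : IsH1Primitive u w t₀ δ) {a b : ℝ}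
    (ha : a ∈ Icc (t₀ - δ) (t₀ + δ)) (hb : b ∈ Icc (t₀ - δ) (t₀ + δ)) :
    u b - u a = ∫ s in a..b, w s := by
  rw [h.eq_integral a ha, h.eq_integral b hb, add_sub_add_left_eq_sub]
  exact intervalIntegral.integral_interval_sub_left (h.intervalIntegrable h.center_mem hb)
    (h.intervalIntegrable h.center_mem ha)

theorem continuousOn (h : IsH1Primitive u w t₀ δ) : ContinuousOn u (Icc (t₀ - δ) (t₀ + δ)) := by
  have hle : t₀ - δ ≤ t₀ + δ := by linarith [h.pos]
  have h1 : ContinuousOn (fun t => ∫ s in t₀..t, w s) (Icc (t₀ - δ) (t₀ + δ)) := by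
    rw [← uIcc_of_le hle]
    apply intervalIntegral.continuousOn_primitive_interval'
    · exact h.intervalIntegrable (left_mem_Icc.2 hle) (right_mem_Icc.2 hle)
    · rw [uIcc_of_le hle]; exact h.center_mem
  exact (continuousOn_const.add h1).congr h.eq_integral

theorem continuousAt (h : IsH1Primitive u w t₀ δ) : ContinuousAt u t₀ :=
  h.continuousOn.continuousAt (Icc_mem_nhds (by linarith [h.pos]) (by linarith [h.pos]))

theorem ae_hasDerivAt [CompleteSpace V] (h : IsH1Primitive u w t₀ δ) :
    ∀ᵐ t, t ∈ Ioo (t₀ - δ) (t₀ + δ) → HasDerivAt u (w t) t := by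
  have hle : t₀ - δ ≤ t₀ + δ := by linarith [h.pos]
  have h1 := (h.intervalIntegrable (left_mem_Icc.2 hle)
    (right_mem_Icc.2 hle)).ae_hasDerivAt_integral
  rw [uIcc_of_le hle] at h1
  filter_upwards [h1] with t ht hmem
  refine ((ht (Ioo_subset_Icc_self hmem) t₀ h.center_mem).const_add (u t₀)).congr_of_eventuallyEq ?_
  filter_upwards [Ioo_mem_nhds hmem.1 hmem.2] with s hs
  exact h.eq_integral s (Ioo_subset_Icc_self hs)

theorem add (h₁ : IsH1Primitive u₁ w₁ t₀ δ) (h₂ : IsH1Primitive u₂ w₂ t₀ δ) :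
    IsH1Primitive (fun t => u₁ t + u₂ t) (fun t => w₁ t + w₂ t) t₀ δ := by
  refine ⟨h₁.pos, h₁.memLp.add h₂.memLp, fun t ht => ?_⟩
  rw [intervalIntegral.integral_add (h₁.intervalIntegrable h₁.center_mem ht)
    (h₂.intervalIntegrable h₁.center_mem ht), h₁.eq_integral t ht, h₂.eq_integral t ht]
  abel

theorem const_smul (h : IsH1Primitive u w t₀ δ) (c : ℝ) :
    IsH1Primitive (fun t => c • u t) (fun t => c • w t) t₀ δ := by
  refine ⟨h.pos, h.memLp.const_smul c, fun t ht => ?_⟩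
  rw [intervalIntegral.integral_smul, h.eq_integral t ht, smul_add]

theorem clm_comp [CompleteSpace V] [CompleteSpace W] (h : IsH1Primitive u w t₀ δ) (A : V →L[ℝ] W) :
    IsH1Primitive (fun t => A (u t)) (fun t => A (w t)) t₀ δ := by
  refine ⟨h.pos, A.comp_memLp' h.memLp, fun t ht => ?_⟩
  rw [h.eq_integral t ht, map_add, A.intervalIntegral_comp_comm
    (h.intervalIntegrable h.center_mem ht)]

theorem prodMk [CompleteSpace V] [CompleteSpace W] {u' w' : ℝ → W} (h : IsH1Primitive u w t₀ δ)
    (h' : IsH1Primitive u' w' t₀ δ) :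
    IsH1Primitive (fun t => (u t, u' t)) (fun t => (w t, w' t)) t₀ δ := by
  have h1 := (h.clm_comp (ContinuousLinearMap.inl ℝ V W)).add
    (h'.clm_comp (ContinuousLinearMap.inr ℝ V W))
  simpa using h1

theorem congr (h : IsH1Primitive u₁ w t₀ δ)
    (heq : ∀ t ∈ Icc (t₀ - δ) (t₀ + δ), u₂ t = u₁ t) : IsH1Primitive u₂ w t₀ δ :=
  ⟨h.pos, h.memLp, fun t ht => by rw [heq t ht, heq t₀ h.center_mem, h.eq_integral t ht]⟩

theorem absolutelyContinuousOnInterval {u w : ℝ → ℝ} (h : IsH1Primitive u w t₀ δ) {a b : ℝ}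
    (ha : a ∈ Icc (t₀ - δ) (t₀ + δ)) (hb : b ∈ Icc (t₀ - δ) (t₀ + δ)) :
    AbsolutelyContinuousOnInterval u a b := by
  have h1 := ((h.intervalIntegrable ha hb).absolutelyContinuousOnInterval_intervalIntegral
    (c := a) left_mem_uIcc)
  have h2 : AbsolutelyContinuousOnInterval (fun _ : ℝ => u a) a b :=
    (contDiffOn_const).absolutelyContinuousOnInterval
  have h3 := h2.add h1
  -- The integral formula for `u` holds only on the interval, so absolute continuity is transferred
  -- through the ε-δ criterion, which samples only points of the interval.
  rw [absolutelyContinuousOnInterval_iff] at h3 ⊢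
  intro ε hε
  obtain ⟨d, hd, H⟩ := h3 ε hε
  refine ⟨d, hd, fun E hE hs => ?_⟩
  have heq : ∀ t ∈ uIcc a b, u t = ((fun _ : ℝ => u a) + (fun x : ℝ => ∫ v in a..x, w v) : ℝ → ℝ) t := by
    intro t ht
    rw [Pi.add_apply, ← h.sub_eq_integral ha (uIcc_subset_Icc ha hb ht)]
    abel
  refine lt_of_eq_of_lt (Finset.sum_congr rfl fun i hi => ?_) (H E hE hs)
  rw [heq _ (hE.1 i hi).1, heq _ (hE.1 i hi).2]

/-- Poincaré's inequality for functions vanishing at the left end of an interval. -/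
theorem norm_sq_le [CompleteSpace V] (h : IsH1Primitive u w t₀ δ) {a b : ℝ} (hab : a ≤ b)
    (ha : a ∈ Icc (t₀ - δ) (t₀ + δ)) (hb : b ∈ Icc (t₀ - δ) (t₀ + δ)) (hu : u a = 0) :
    ‖u b‖ ^ 2 ≤ (b - a) * ∫ s in a..b, ‖w s‖ ^ 2 := by
  rcases hab.eq_or_lt with rfl | hlt
  · simp [hu]
  have hi := (h.intervalIntegrable ha hb)
  have hw2 : IntervalIntegrable (fun s => ‖w s‖ ^ 2) volume a b := by
    have h1 : IntegrableOn (fun s => ‖w s‖ ^ 2) (Icc (t₀ - δ) (t₀ + δ)) :=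
      h.memLp.integrable_norm_pow (by norm_num)
    exact (h1.mono_set (uIcc_subset_Icc ha hb)).intervalIntegrable
  have h1 : ‖u b‖ ≤ ∫ s in a..b, ‖w s‖ := by
    have := h.sub_eq_integral ha hb
    rw [hu, sub_zero] at this
    rw [this]
    exact intervalIntegral.norm_integral_le_integral_norm hab
  set I := ∫ s in a..b, ‖w s‖ with hI
  set K := ∫ s in a..b, ‖w s‖ ^ 2 with hK
  -- Cauchy-Schwarz for ∫‖w‖, obtained from the nonnegative variance of ‖w‖ about its mean `m`.
  set m := I / (b - a) with hm
  have hba : 0 < b - a := sub_pos.2 hlt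
  have h2 : 0 ≤ ∫ s in a..b, (‖w s‖ - m) ^ 2 :=
    intervalIntegral.integral_nonneg hab fun s _ => sq_nonneg _
  have h3 : ∫ s in a..b, (‖w s‖ - m) ^ 2 = K - 2 * m * I + (b - a) * m ^ 2 := by
    have e : ∀ s, (‖w s‖ - m) ^ 2 = ‖w s‖ ^ 2 - (2 * m) * ‖w s‖ + m ^ 2 := fun s => by ring
    simp only [e]
    rw [intervalIntegral.integral_add (hw2.sub (hi.norm.const_mul _)) intervalIntegrable_const,
      intervalIntegral.integral_sub hw2 (hi.norm.const_mul _),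
      intervalIntegral.integral_const_mul, intervalIntegral.integral_const, smul_eq_mul]
  have h4 : I = m * (b - a) := by rw [hm]; field_simp
  have hI0 : 0 ≤ I := (norm_nonneg _).trans h1
  rw [h3] at h2
  have h5 : I ^ 2 ≤ (b - a) * K := by
    rw [h4] at h2 ⊢
    nlinarith
  exact (pow_le_pow_left₀ (norm_nonneg _) h1 2).trans h5

end IsH1Primitive

/-- A function which is continuously differentiable near `t₀` is locally the primitive of its
derivative. -/
theorem ContDiffAt.exists_isH1Primitive [CompleteSpace V] {u : ℝ → V} {t₀ : ℝ}
    (hu : ContDiffAt ℝ 1 u t₀) : ∃ δ > 0, IsH1Primitive u (deriv u) t₀ δ := by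
  have hev : ∀ᶠ t in 𝓝 t₀, ContDiffAt ℝ 1 u t := hu.eventually (by simp)
  obtain ⟨ε, hε, hball⟩ := Metric.eventually_nhds_iff_ball.1 hev
  have hsub : ∀ t ∈ Icc (t₀ - ε / 2) (t₀ + ε / 2), ContDiffAt ℝ 1 u t := by
    intro t ht
    apply hball
    rw [Metric.mem_ball, Real.dist_eq, abs_lt]
    constructor <;> linarith [ht.1, ht.2]
  have hcont : ContinuousOn (deriv u) (Icc (t₀ - ε / 2) (t₀ + ε / 2)) := by
    intro t ht
    have h1 : deriv u = fun t => fderiv ℝ u t 1 := funext fun t => fderiv_apply_one_eq_deriv.symm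
    rw [h1]
    exact ((((hsub t ht).fderiv_right (m := 0) (by simp)).clm_apply
      contDiffAt_const).continuousAt).continuousWithinAt
  obtain ⟨C, hC⟩ := isCompact_Icc.exists_bound_of_continuousOn hcont
  refine ⟨ε / 2, half_pos hε, half_pos hε, MemLp.of_bound
    (hcont.aestronglyMeasurable_of_isCompact isCompact_Icc measurableSet_Icc) C
    (ae_restrict_of_forall_mem measurableSet_Icc hC), fun t ht => ?_⟩
  have hmem : uIcc t₀ t ⊆ Icc (t₀ - ε / 2) (t₀ + ε / 2) :=
    uIcc_subset_Icc ⟨by linarith, by linarith⟩ ht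
  rw [intervalIntegral.integral_deriv_eq_sub' u rfl
    (fun s hs => (hsub s (hmem hs)).differentiableAt (by norm_num)) (hcont.mono hmem)]
  abel

theorem integral_eq_sub_of_absolutelyContinuous {f f' : ℝ → ℝ} {a b : ℝ}
    (hf : AbsolutelyContinuousOnInterval f a b)
    (hf' : ∀ᵐ t, t ∈ uIcc a b → HasDerivAt f (f' t) t) : ∫ t in a..b, f' t = f b - f a := by
  rw [← hf.integral_deriv_eq_sub]
  apply intervalIntegral.integral_congr_ae
  filter_upwards [hf'] with t ht hmem
  exact (ht (uIoc_subset_uIcc hmem)).deriv.symm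

end LocalPrimitive

/-! ### H¹ vector fields along a smooth loop. -/

section H1Fields

open Filter Topology

variable {n : ℕ} {M : Type*} [TopologicalSpace M] [ChartedSpace (EuclideanSpace ℝ (Fin n)) M]
  [IsManifold (𝓡 n) ∞ M] {x : ℝ → M}

local notation "𝔼" => EuclideanSpace ℝ (Fin n)

theorem mem_extChartAt_tangent_source_iff (z z₀ : TangentBundle (𝓡 n) M) :
    z ∈ (extChartAt (𝓡 n).tangent z₀).source ↔ z.1 ∈ (extChartAt (𝓡 n) z₀.1).source := by
  rw [extChartAt_source, extChartAt_source]
  exact TangentBundle.mem_chart_source_iff z z₀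

theorem extChartAt_tangent_apply (ξ : ∀ t, TangentSpace (𝓡 n) (x t)) (t₀ t : ℝ) :
    extChartAt (𝓡 n).tangent (⟨x t₀, ξ t₀⟩ : TangentBundle (𝓡 n) M) ⟨x t, ξ t⟩ =
      (extChartAt (𝓡 n) (x t₀) (x t), fieldCoord x ξ (x t₀) t) := by
  rw [FiberBundle.extChartAt]
  rfl

/-- Along a smooth periodic loop the base component of the H¹ condition in the tangent bundle is
automatic. Only the fibre components matter, and periodicity can be stated in the common model of
all tangent spaces. -/
theorem mem_H1Fields_iff (hx : ContMDiff 𝓘(ℝ, ℝ) (𝓡 n) ∞ x) (hper : Function.Periodic x 1)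
    {ξ : ∀ t, TangentSpace (𝓡 n) (x t)} :
    ξ ∈ H1Fields x ↔ Function.Periodic (fun t => (ξ t : 𝔼)) 1 ∧
      ∀ t₀, ∃ δ w, IsH1Primitive (fieldCoord x ξ (x t₀)) w t₀ δ := by
  constructor
  · rintro ⟨h1, -, h3⟩
    refine ⟨fun t => ?_, fun t₀ => ?_⟩
    · have := h1 t
      have h4 := (Bundle.TotalSpace.mk.injEq _ _ _ _ ▸ this :
        x (t + 1) = x t ∧ HEq (ξ (t + 1)) (ξ t))
      exact eq_of_heq h4.2
    · obtain ⟨δ, hδ, u, hu, h⟩ := h3 t₀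
      simp only [extChartAt_tangent_apply] at h
      have hprim : IsH1Primitive (fun t => (extChartAt (𝓡 n) (x t₀) (x t),
          fieldCoord x ξ (x t₀) t)) u t₀ δ := ⟨hδ, hu, fun t ht => (h t ht).2⟩
      exact ⟨δ, _, hprim.clm_comp (ContinuousLinearMap.snd ℝ 𝔼 𝔼)⟩
  · rintro ⟨h1, h2⟩
    refine ⟨fun t => ?_, ?_, fun t₀ => ?_⟩
    · have h3 : HEq (ξ (t + 1)) (ξ t) := heq_of_eq (h1 t : (ξ (t + 1) : 𝔼) = ξ t)
      have h4 := hper t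
      change (⟨x (t + 1), ξ (t + 1)⟩ : TangentBundle (𝓡 n) M) = ⟨x t, ξ t⟩
      rw [Bundle.TotalSpace.mk.injEq]
      exact ⟨h4, h3⟩
    · rw [continuous_iff_continuousAt]
      intro t₀
      rw [FiberBundle.continuousAt_totalSpace]
      refine ⟨hx.continuous.continuousAt, ?_⟩
      obtain ⟨δ, w, h⟩ := h2 t₀
      exact h.continuousAt
    · obtain ⟨δ, w, h⟩ := h2 t₀
      have hs : x t₀ ∈ (extChartAt (𝓡 n) (x t₀)).source := mem_extChartAt_source (x t₀)
      obtain ⟨δ', hδ', h'⟩ := ((contDiffAt_loopCoord hx hs).of_le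
        ENat.LEInfty.out).exists_isH1Primitive
      obtain ⟨ε, hε, hball⟩ := Metric.eventually_nhds_iff_ball.1
        (eventually_mem_source hx.continuous hs)
      -- Small enough for the primitive formula of the field, for that of the loop, and for the loop
      -- to remain in the chart.
      let d := min (min δ δ') (ε / 2)
      have hd : 0 < d := lt_min (lt_min h.pos hδ') (half_pos hε)
      have hprim := (h'.mono hd ((min_le_left _ _).trans (min_le_right _ _))).prodMk
        (h.mono hd ((min_le_left _ _).trans (min_le_left _ _)))
      refine ⟨d, hd, _, hprim.memLp, fun t ht => ⟨?_, ?_⟩⟩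
      · rw [mem_extChartAt_tangent_source_iff]
        apply hball
        have hdε : d ≤ ε / 2 := min_le_right _ _
        rw [Metric.mem_ball, Real.dist_eq, abs_lt]
        constructor <;> linarith [ht.1, ht.2]
      · rw [extChartAt_tangent_apply, extChartAt_tangent_apply]
        exact hprim.eq_integral t ht

theorem fieldCoord_add (ξ η : ∀ t, TangentSpace (𝓡 n) (x t)) (p : M) (t : ℝ) :
    fieldCoord x (ξ + η) p t = fieldCoord x ξ p t + fieldCoord x η p t :=
  map_add (tangentCoordChange (𝓡 n) (x t) p (x t)) (ξ t : 𝔼) (η t : 𝔼)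

theorem fieldCoord_smul (c : ℝ) (ξ : ∀ t, TangentSpace (𝓡 n) (x t)) (p : M) (t : ℝ) :
    fieldCoord x (c • ξ) p t = c • fieldCoord x ξ p t :=
  map_smul (tangentCoordChange (𝓡 n) (x t) p (x t)) c (ξ t : 𝔼)

theorem fieldCoord_zero (p : M) (t : ℝ) :
    fieldCoord x (0 : ∀ t, TangentSpace (𝓡 n) (x t)) p t = 0 :=
  map_zero (tangentCoordChange (𝓡 n) (x t) p (x t))

/-- The linear space of `1`-periodic vector fields of class `H¹` along a smooth loop. -/
def h1Submodule (hx : ContMDiff 𝓘(ℝ, ℝ) (𝓡 n) ∞ x) (hper : Function.Periodic x 1) :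
    Submodule ℝ (∀ t, TangentSpace (𝓡 n) (x t)) where
  carrier := H1Fields x
  add_mem' := by
    intro ξ η hξ hη
    rw [mem_H1Fields_iff hx hper] at *
    refine ⟨fun t => congrArg₂ (fun v w : 𝔼 => v + w) (hξ.1 t) (hη.1 t), fun t₀ => ?_⟩
    obtain ⟨δ, w, h⟩ := hξ.2 t₀
    obtain ⟨δ', w', h'⟩ := hη.2 t₀
    have hd := lt_min h.pos h'.pos
    refine ⟨_, _, ((h.mono hd (min_le_left _ _)).add (h'.mono hd (min_le_right _ _))).congr
      fun t _ => fieldCoord_add ξ η _ t⟩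
  zero_mem' := by
    rw [mem_H1Fields_iff hx hper]
    refine ⟨fun t => rfl, fun t₀ => ⟨1, fun _ => 0, one_pos, MemLp.zero', fun t _ => ?_⟩⟩
    simp [fieldCoord_zero]
  smul_mem' := by
    intro c ξ hξ
    rw [mem_H1Fields_iff hx hper] at *
    refine ⟨fun t => congrArg (fun v : 𝔼 => c • v) (hξ.1 t), fun t₀ => ?_⟩
    obtain ⟨δ, w, h⟩ := hξ.2 t₀
    exact ⟨_, _, (h.const_smul c).congr fun t _ => fieldCoord_smul c ξ _ t⟩

/-- A periodic vector field with continuously differentiable components is of class `H¹`. -/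
theorem mem_H1Fields_of_contDiffAt (hx : ContMDiff 𝓘(ℝ, ℝ) (𝓡 n) ∞ x)
    (hper : Function.Periodic x 1) {ξ : ∀ t, TangentSpace (𝓡 n) (x t)}
    (hξ : Function.Periodic (fun t => (ξ t : 𝔼)) 1)
    (h : ∀ t₀, ContDiffAt ℝ 1 (fieldCoord x ξ (x t₀)) t₀) : ξ ∈ H1Fields x := by
  rw [mem_H1Fields_iff hx hper]
  refine ⟨hξ, fun t₀ => ?_⟩
  obtain ⟨δ, -, h'⟩ := (h t₀).exists_isH1Primitive
  exact ⟨δ, _, h'⟩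

theorem ae_of_forall_ae_Ioo {P : ℝ → Prop}
    (h : ∀ t₀ : ℝ, ∃ δ > 0, ∀ᵐ t, t ∈ Ioo (t₀ - δ) (t₀ + δ) → P t) : ∀ᵐ t, P t := by
  rw [ae_iff]
  refine measure_null_of_locally_null _ fun t₀ _ => ?_
  obtain ⟨δ, hδ, hae⟩ := h t₀
  refine ⟨{t | ¬ P t} ∩ Ioo (t₀ - δ) (t₀ + δ), inter_mem self_mem_nhdsWithin
    (mem_nhdsWithin_of_mem_nhds (Ioo_mem_nhds (by linarith) (by linarith))), ?_⟩
  rw [ae_iff] at hae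
  refine measure_mono_null (fun t ht => ?_) hae
  exact fun hh => ht.1 (hh ht.2)

/-- Local data of an `H¹` vector field in a fixed chart. -/
theorem exists_isH1Primitive_source (hx : ContMDiff 𝓘(ℝ, ℝ) (𝓡 n) ∞ x)
    (hper : Function.Periodic x 1) {ξ : ∀ t, TangentSpace (𝓡 n) (x t)} (hξ : ξ ∈ H1Fields x)
    {t₀ ε : ℝ} (hε : 0 < ε) : ∃ δ w, δ ≤ ε ∧ IsH1Primitive (fieldCoord x ξ (x t₀)) w t₀ δ := by
  obtain ⟨δ, w, h⟩ := ((mem_H1Fields_iff hx hper).1 hξ).2 t₀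
  exact ⟨min δ ε, w, min_le_right _ _, h.mono (lt_min h.pos hε) (min_le_left _ _)⟩

omit [IsManifold (𝓡 n) ∞ M] in
theorem exists_forall_Icc_mem_source (hx : Continuous x) (t₀ : ℝ) :
    ∃ ε > 0, ∀ t ∈ Icc (t₀ - ε) (t₀ + ε), x t ∈ (extChartAt (𝓡 n) (x t₀)).source := by
  obtain ⟨ε, hε, hball⟩ := Metric.eventually_nhds_iff_ball.1
    (eventually_mem_source hx (mem_extChartAt_source (I := 𝓡 n) (x t₀)))
  refine ⟨ε / 2, half_pos hε, fun t ht => hball t ?_⟩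
  rw [Metric.mem_ball, Real.dist_eq, abs_lt]
  constructor <;> linarith [ht.1, ht.2]

/-- Lebesgue differentiation applies in a chart fixed near `t₀`; a smooth transition then carries
differentiability to the chart around `x t` used by the densities. -/
theorem ae_differentiableAt_fieldCoord (hx : ContMDiff 𝓘(ℝ, ℝ) (𝓡 n) ∞ x)
    (hper : Function.Periodic x 1) {ξ : ∀ t, TangentSpace (𝓡 n) (x t)} (hξ : ξ ∈ H1Fields x) :
    ∀ᵐ t, DifferentiableAt ℝ (fieldCoord x ξ (x t)) t := by
  refine ae_of_forall_ae_Ioo fun t₀ => ?_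
  obtain ⟨ε, hε, hsrc⟩ := exists_forall_Icc_mem_source (n := n) hx.continuous t₀
  obtain ⟨δ, w, hδε, h⟩ := exists_isH1Primitive_source hx hper hξ hε (t₀ := t₀)
  refine ⟨δ, h.pos, ?_⟩
  filter_upwards [h.ae_hasDerivAt] with t ht hmem
  exact differentiableAt_fieldCoord_trans hx
    (hsrc t ⟨by linarith [hmem.1], by linarith [hmem.2]⟩)
    (mem_extChartAt_source (x t)) (ht hmem).differentiableAt

end H1Fields

/-! ### Product rules and patching for H¹ functions. -/

section LocalPrimitive

open Filter Topology

theorem memLp_two_of_continuousOn {V : Type*} [NormedAddCommGroup V] {f : ℝ → V} {a b : ℝ}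
    (hf : ContinuousOn f (Icc a b)) : MemLp f 2 (volume.restrict (Icc a b)) := by
  obtain ⟨C, hC⟩ := isCompact_Icc.exists_bound_of_continuousOn hf
  exact MemLp.of_bound (hf.aestronglyMeasurable_of_isCompact isCompact_Icc measurableSet_Icc) C
    (ae_restrict_of_forall_mem measurableSet_Icc hC)

theorem MemLp.continuousOn_mul {f w : ℝ → ℝ} {a b : ℝ} (hf : ContinuousOn f (Icc a b))
    (hw : MemLp w 2 (volume.restrict (Icc a b))) :
    MemLp (fun t => f t * w t) 2 (volume.restrict (Icc a b)) := by
  obtain ⟨C, hC⟩ := isCompact_Icc.exists_bound_of_continuousOn hf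
  refine hw.of_le_mul (c := C)
    ((hf.aestronglyMeasurable_of_isCompact isCompact_Icc measurableSet_Icc).mul hw.1) ?_
  refine ae_restrict_of_forall_mem measurableSet_Icc fun t ht => ?_
  rw [norm_mul]
  exact mul_le_mul_of_nonneg_right (hC t ht) (norm_nonneg _)

theorem continuousAt_deriv_of_contDiffAt {V : Type*} [NormedAddCommGroup V] [NormedSpace ℝ V]
    {f : ℝ → V} {t : ℝ} (hf : ContDiffAt ℝ 1 f t) : ContinuousAt (deriv f) t := by
  have h1 : deriv f = fun t => fderiv ℝ f t 1 := funext fun t => fderiv_apply_one_eq_deriv.symm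
  rw [h1]
  exact ((hf.fderiv_right (m := 0) (by simp)).clm_apply contDiffAt_const).continuousAt

namespace IsH1Primitive

variable {t₀ δ : ℝ}

/-- The product is absolutely continuous, so the product rule almost everywhere already identifies
its primitive. -/
theorem mul {f u w : ℝ → ℝ} (h : IsH1Primitive u w t₀ δ)
    (hf : ∀ t ∈ Icc (t₀ - δ) (t₀ + δ), ContDiffAt ℝ 1 f t) :
    IsH1Primitive (fun t => f t * u t) (fun t => deriv f t * u t + f t * w t) t₀ δ := by
  have hf0 : ContinuousOn f (Icc (t₀ - δ) (t₀ + δ)) := fun t ht =>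
    (hf t ht).continuousAt.continuousWithinAt
  have hf1 : ContinuousOn (deriv f) (Icc (t₀ - δ) (t₀ + δ)) := fun t ht =>
    (continuousAt_deriv_of_contDiffAt (hf t ht)).continuousWithinAt
  refine ⟨h.pos, (memLp_two_of_continuousOn (hf1.mul h.continuousOn)).add
    (MemLp.continuousOn_mul hf0 h.memLp), fun t ht => ?_⟩
  have hsub := uIcc_subset_Icc h.center_mem ht
  have hac : AbsolutelyContinuousOnInterval (f * u) t₀ t :=
    AbsolutelyContinuousOnInterval.mul
      (ContDiffOn.absolutelyContinuousOnInterval fun s hs => (hf s (hsub hs)).contDiffWithinAt)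
      (h.absolutelyContinuousOnInterval h.center_mem ht)
  rw [integral_eq_sub_of_absolutelyContinuous hac]
  · simp
  · have h1 : ∀ᵐ s : ℝ, s ≠ t₀ - δ := by simp [ae_iff, measure_singleton]
    have h2 : ∀ᵐ s : ℝ, s ≠ t₀ + δ := by simp [ae_iff, measure_singleton]
    filter_upwards [h.ae_hasDerivAt, h1, h2] with s hs hs1 hs2 hmem
    have hm := hsub hmem
    exact ((hf s hm).differentiableAt (by norm_num)).hasDerivAt.mul
      (hs ⟨lt_of_le_of_ne hm.1 hs1.symm, lt_of_le_of_ne hm.2 hs2⟩)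

theorem sum {V ι : Type*} [NormedAddCommGroup V] [NormedSpace ℝ V] (hδ : 0 < δ) (s : Finset ι)
    {u w : ι → ℝ → V} (h : ∀ i ∈ s, IsH1Primitive (u i) (w i) t₀ δ) :
    IsH1Primitive (fun t => ∑ i ∈ s, u i t) (fun t => ∑ i ∈ s, w i t) t₀ δ := by
  classical
  induction s using Finset.induction_on with
  | empty => exact ⟨hδ, by simp, by simp⟩
  | insert a s ha ih =>
    simp only [Finset.sum_insert ha]
    exact (h a (by simp)).add (ih fun i hi => h i (by simp [hi]))

variable {n : ℕ}

theorem of_coord {u w : ℝ → EuclideanSpace ℝ (Fin n)} (hδ : 0 < δ)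
    (h : ∀ j, IsH1Primitive (fun t => u t j) (fun t => w t j) t₀ δ) :
    IsH1Primitive u w t₀ δ := by
  have h1 := IsH1Primitive.sum hδ Finset.univ fun (j : Fin n) _ =>
    (h j).clm_comp ((1 : ℝ →L[ℝ] ℝ).smulRight (EuclideanSpace.single j (1 : ℝ)))
  have h2 : ∀ v : EuclideanSpace ℝ (Fin n), ∑ j, ((1 : ℝ →L[ℝ] ℝ).smulRight
      (EuclideanSpace.single j (1 : ℝ))) (v j) = v := fun v => by
    conv_rhs => rw [EuclideanSpace.eq_sum_single v]
    simp
  simpa only [h2] using h1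

/-- The pairing of an `H¹` function with a continuously differentiable covector. -/
theorem covector_apply {A : ℝ → EuclideanSpace ℝ (Fin n) →L[ℝ] ℝ}
    {u w : ℝ → EuclideanSpace ℝ (Fin n)} (h : IsH1Primitive u w t₀ δ)
    (hA : ∀ t ∈ Icc (t₀ - δ) (t₀ + δ), ContDiffAt ℝ 1 A t) :
    IsH1Primitive (fun t => A t (u t)) (fun t => deriv A t (u t) + A t (w t)) t₀ δ := by
  have h1 := IsH1Primitive.sum h.pos Finset.univ fun (i : Fin n) _ =>
    (h.clm_comp (EuclideanSpace.proj i : EuclideanSpace ℝ (Fin n) →L[ℝ] ℝ)).mul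
      (f := fun t => A t (EuclideanSpace.single i 1))
      fun t ht => (hA t ht).clm_apply contDiffAt_const
  have h2 : ∀ (B : EuclideanSpace ℝ (Fin n) →L[ℝ] ℝ) (v : EuclideanSpace ℝ (Fin n)),
      B v = ∑ i, B (EuclideanSpace.single i 1) * v i := fun B v => by
    conv_lhs => rw [EuclideanSpace.eq_sum_single v]
    simp [mul_comm]
  have h3 : IsH1Primitive (fun t => A t (u t)) _ t₀ δ :=
    h1.congr fun t _ => h2 (A t) (u t)
  have key : ∀ t ∈ Icc (t₀ - δ) (t₀ + δ),
      ∑ i, (deriv (fun t => A t (EuclideanSpace.single i 1)) t * u t i +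
        A t (EuclideanSpace.single i 1) * w t i) = deriv A t (u t) + A t (w t) := by
    intro t ht
    rw [h2 (deriv A t), h2 (A t), ← Finset.sum_add_distrib]
    refine Finset.sum_congr rfl fun i _ => ?_
    have := (((hA t ht).differentiableAt (by norm_num)).hasDerivAt.clm_apply
      (hasDerivAt_const t (EuclideanSpace.single i (1 : ℝ)))).deriv
    simp only [map_zero, add_zero] at this
    rw [this]
  refine ⟨h.pos, h3.memLp.ae_eq (ae_restrict_of_forall_mem measurableSet_Icc key),
    fun t ht => ?_⟩
  rw [h3.eq_integral t ht]
  congr 1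
  exact intervalIntegral.integral_congr fun s hs =>
    key s (uIcc_subset_Icc h.center_mem ht hs)

/-- The product of an `H¹` function with a continuously differentiable matrix. -/
theorem matrix_apply {A : ℝ → EuclideanSpace ℝ (Fin n) →L[ℝ] EuclideanSpace ℝ (Fin n)}
    {u w : ℝ → EuclideanSpace ℝ (Fin n)} (h : IsH1Primitive u w t₀ δ)
    (hA : ∀ t ∈ Icc (t₀ - δ) (t₀ + δ), ContDiffAt ℝ 1 A t) :
    ∃ w', IsH1Primitive (fun t => A t (u t)) w' t₀ δ := by
  let P : Fin n → EuclideanSpace ℝ (Fin n) →L[ℝ] ℝ := fun j => EuclideanSpace.proj j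
  refine ⟨fun t => WithLp.toLp 2 fun j =>
    deriv (fun t => (P j).comp (A t)) t (u t) + (P j).comp (A t) (w t), of_coord h.pos fun j => ?_⟩
  have := h.covector_apply (A := fun t => (P j).comp (A t))
    fun t ht => contDiffAt_const.clm_comp (hA t ht)
  exact this

end IsH1Primitive

/-- Local primitives patch together. -/
theorem isH1Primitive_of_local {V : Type*} [NormedAddCommGroup V] [NormedSpace ℝ V]
    [CompleteSpace V] {u : ℝ → V} {t₀ ε : ℝ} (hε : 0 < ε)
    (h : ∀ t₁ ∈ Icc (t₀ - ε) (t₀ + ε), ∃ δ w, IsH1Primitive u w t₁ δ) :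
    IsH1Primitive u (deriv u) t₀ ε := by
  have key : ∀ t₁ ∈ Icc (t₀ - ε) (t₀ + ε), ∃ δ > 0, ∃ w, IsH1Primitive u w t₁ δ ∧
      w =ᵐ[volume.restrict (Icc (t₁ - δ) (t₁ + δ))] deriv u := by
    intro t₁ ht₁
    obtain ⟨δ, w, hw⟩ := h t₁ ht₁
    refine ⟨δ, hw.pos, w, hw, ?_⟩
    rw [← restrict_Ioo_eq_restrict_Icc, EventuallyEq, ae_restrict_iff' measurableSet_Ioo]
    filter_upwards [hw.ae_hasDerivAt] with t ht hmem
    exact (ht hmem).deriv.symm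
  have hnhds : ∀ {t₁ δ : ℝ}, 0 < δ → Icc (t₁ - δ) (t₁ + δ) ∈ 𝓝 t₁ := fun hδ =>
    Icc_mem_nhds (by linarith) (by linarith)
  have hint : IntegrableOn (deriv u) (Icc (t₀ - ε) (t₀ + ε)) := by
    refine LocallyIntegrableOn.integrableOn_isCompact (fun t₁ ht₁ => ?_) isCompact_Icc
    obtain ⟨δ, hδ, w, hw, hae⟩ := key t₁ ht₁
    exact ⟨_, mem_nhdsWithin_of_mem_nhds (hnhds hδ), hw.integrableOn.congr_fun_ae hae⟩
  have hint2 : IntegrableOn (fun t => ‖deriv u t‖ ^ 2) (Icc (t₀ - ε) (t₀ + ε)) := by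
    refine LocallyIntegrableOn.integrableOn_isCompact (fun t₁ ht₁ => ?_) isCompact_Icc
    obtain ⟨δ, hδ, w, hw, hae⟩ := key t₁ ht₁
    have h1 : IntegrableOn (fun t => ‖w t‖ ^ 2) (Icc (t₁ - δ) (t₁ + δ)) :=
      hw.memLp.integrable_norm_pow (by norm_num)
    refine ⟨_, mem_nhdsWithin_of_mem_nhds (hnhds hδ), h1.congr_fun_ae ?_⟩
    filter_upwards [hae] with t ht
    rw [ht]
  have hcenter : t₀ ∈ Icc (t₀ - ε) (t₀ + ε) := ⟨by linarith, by linarith⟩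
  have hle : t₀ - ε ≤ t₀ + ε := by linarith
  have hii : ∀ {a b : ℝ}, a ∈ Icc (t₀ - ε) (t₀ + ε) → b ∈ Icc (t₀ - ε) (t₀ + ε) →
      IntervalIntegrable (deriv u) volume a b := fun ha hb =>
    (hint.mono_set (uIcc_subset_Icc ha hb)).intervalIntegrable
  refine ⟨hε, (memLp_two_iff_integrable_sq_norm hint.1).2 hint2, ?_⟩
  -- Near each point Ψ is constant, because there `u` is a primitive of a function equal to `deriv
  -- u` almost everywhere. So Ψ has zero derivative everywhere on the interval, although `u` need
  -- not be differentiable everywhere.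
  let Ψ : ℝ → V := fun t => u t - ∫ s in t₀..t, deriv u s
  have hΨ : ∀ t₁ ∈ Icc (t₀ - ε) (t₀ + ε),
      HasDerivWithinAt Ψ 0 (Icc (t₀ - ε) (t₀ + ε)) t₁ := by
    intro t₁ ht₁
    obtain ⟨δ, hδ, w, hw, hae⟩ := key t₁ ht₁
    refine (hasDerivWithinAt_const t₁ _ (Ψ t₁)).congr_of_eventuallyEq ?_ rfl
    filter_upwards [mem_nhdsWithin_of_mem_nhds (hnhds hδ), self_mem_nhdsWithin] with t ht ht'
    have h1 := hw.sub_eq_integral hw.center_mem ht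
    have h2 : ∫ s in t₁..t, w s = ∫ s in t₁..t, deriv u s := by
      apply intervalIntegral.integral_congr_ae_restrict
      exact ae_restrict_of_ae_restrict_of_subset
        (uIoc_subset_uIcc.trans (uIcc_subset_Icc hw.center_mem ht)) hae
    have h3 := intervalIntegral.integral_interval_sub_left (hii hcenter ht') (hii hcenter ht₁)
    rw [← h2, ← h1] at h3
    simp only [Ψ]
    rw [sub_eq_sub_iff_add_eq_add]
    rw [sub_eq_sub_iff_add_eq_add] at h3
    rw [add_comm (u t₁), h3, add_comm]
  have hconst := constant_of_derivWithin_zero (fun t ht => (hΨ t ht).differentiableWithinAt)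
    (fun t ht => (hΨ t (Ico_subset_Icc_self ht)).derivWithin
      (uniqueDiffOn_Icc (by linarith) t (Ico_subset_Icc_self ht)))
  intro t ht
  have h1 := (hconst t ht).trans (hconst t₀ hcenter).symm
  simp only [Ψ, intervalIntegral.integral_same, sub_zero] at h1
  rw [← h1]
  abel

end LocalPrimitive

/-! ### Continuous families of bilinear forms. -/

section Bilinear

open Filter Topology

variable {V : Type*} [NormedAddCommGroup V] [NormedSpace ℝ V] [FiniteDimensional ℝ V]

/-- In finite dimension, continuity of every entry t ↦ β t z w gives continuity in operator norm;
uniform bounds on compact intervals then follow. -/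
theorem exists_continuousOn_bilin {β : ℝ → V → V → ℝ} {s : Set ℝ}
    (hal : ∀ t z z' w, β t (z + z') w = β t z w + β t z' w)
    (hsl : ∀ t (c : ℝ) z w, β t (c • z) w = c * β t z w)
    (har : ∀ t z w w', β t z (w + w') = β t z w + β t z w')
    (hsr : ∀ t (c : ℝ) z w, β t z (c • w) = c * β t z w)
    (hcont : ∀ z w, ContinuousOn (fun t => β t z w) s) :
    ∃ B : ℝ → V →L[ℝ] V →L[ℝ] ℝ, (∀ t z w, B t z w = β t z w) ∧ ContinuousOn B s := by
  let B₀ : ℝ → V →ₗ[ℝ] V →ₗ[ℝ] ℝ := fun t => LinearMap.mk₂ ℝ (β t) (hal t) (hsl t) (har t) (hsr t)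
  let B : ℝ → V →L[ℝ] V →L[ℝ] ℝ := fun t =>
    LinearMap.toContinuousLinearMap
      ((LinearMap.toContinuousLinearMap (𝕜 := ℝ) (E := V) (F' := ℝ)).toLinearMap ∘ₗ B₀ t)
  have hB : ∀ t z w, B t z w = β t z w := fun t z w => rfl
  refine ⟨B, hB, ?_⟩
  rw [continuousOn_clm_apply]
  intro z
  rw [continuousOn_clm_apply]
  exact fun w => hcont z w

theorem aestronglyMeasurable_clm_apply {V F : Type*} [NormedAddCommGroup V] [NormedSpace ℝ V]
    [NormedAddCommGroup F] [NormedSpace ℝ F] {B : ℝ → V →L[ℝ] F} {a b : ℝ} {z : ℝ → V}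
    (hB : ContinuousOn B (Icc a b)) (hz : AEStronglyMeasurable z (volume.restrict (Icc a b))) :
    AEStronglyMeasurable (fun t => B t (z t)) (volume.restrict (Icc a b)) :=
  isBoundedBilinearMap_apply.continuous.comp_aestronglyMeasurable
    ((hB.aestronglyMeasurable_of_isCompact isCompact_Icc measurableSet_Icc).prodMk hz)

omit [FiniteDimensional ℝ V] in
set_option synthInstance.maxHeartbeats 200000 in
theorem integrableOn_bilin {B : ℝ → V →L[ℝ] V →L[ℝ] ℝ} {a b : ℝ} {z w : ℝ → V}
    (hB : ContinuousOn B (Icc a b)) (hz : MemLp z 2 (volume.restrict (Icc a b)))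
    (hw : MemLp w 2 (volume.restrict (Icc a b))) :
    IntegrableOn (fun t => B t (z t) (w t)) (Icc a b) := by
  obtain ⟨C, hC⟩ := isCompact_Icc.exists_bound_of_continuousOn (E := V →L[ℝ] V →L[ℝ] ℝ) hB
  have h1 : Integrable (fun t => C * (‖z t‖ * ‖w t‖)) (volume.restrict (Icc a b)) :=
    (hz.norm.integrable_mul hw.norm).const_mul C
  have h2 := aestronglyMeasurable_clm_apply (F := V →L[ℝ] ℝ) hB hz.1
  have h3 : AEStronglyMeasurable (fun t => B t (z t) (w t)) (volume.restrict (Icc a b)) :=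
    isBoundedBilinearMap_apply.continuous.comp_aestronglyMeasurable (h2.prodMk hw.1)
  refine h1.mono' h3 (ae_restrict_of_forall_mem measurableSet_Icc fun t ht => ?_)
  calc ‖B t (z t) (w t)‖ ≤ ‖B t‖ * ‖z t‖ * ‖w t‖ := (B t).le_opNorm₂ _ _
    _ ≤ C * ‖z t‖ * ‖w t‖ := by gcongr; exact hC t ht
    _ = _ := mul_assoc _ _ _

end Bilinear

/-! ### The second variation as a symmetric bilinear form on H¹ fields. -/

section Hessian

open Filter Topology

variable {n : ℕ} {M : Type*} [TopologicalSpace M] [ChartedSpace (EuclideanSpace ℝ (Fin n)) M]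
  [IsManifold (𝓡 n) ∞ M] {x : ℝ → M}

local notation "𝔼" => EuclideanSpace ℝ (Fin n)

/-- The components of an `H¹` vector field in any chart are of class `H¹`, on every interval that
the loop maps to the domain of the chart. -/
theorem isH1Primitive_fieldCoord (hx : ContMDiff 𝓘(ℝ, ℝ) (𝓡 n) ∞ x)
    (hper : Function.Periodic x 1) {ξ : ∀ t, TangentSpace (𝓡 n) (x t)} (hξ : ξ ∈ H1Fields x)
    {t₀ ε : ℝ} (hε : 0 < ε) {p : M}
    (hsrc : ∀ t ∈ Icc (t₀ - ε) (t₀ + ε), x t ∈ (extChartAt (𝓡 n) p).source) :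
    IsH1Primitive (fieldCoord x ξ p) (deriv (fieldCoord x ξ p)) t₀ ε := by
  refine isH1Primitive_of_local hε fun t₁ ht₁ => ?_
  have hev := (eventually_mem_source hx.continuous (hsrc t₁ ht₁)).and
    (eventually_mem_source hx.continuous (mem_extChartAt_source (I := 𝓡 n) (x t₁)))
  obtain ⟨d, hd, hball⟩ := Metric.eventually_nhds_iff_ball.1 hev
  obtain ⟨δ, w, hδ, hw⟩ := exists_isH1Primitive_source hx hper hξ (half_pos hd) (t₀ := t₁)
  have hmem : ∀ t ∈ Icc (t₁ - δ) (t₁ + δ), x t ∈ (extChartAt (𝓡 n) p).source ∧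
      x t ∈ (extChartAt (𝓡 n) (x t₁)).source := by
    intro t ht
    apply hball
    rw [Metric.mem_ball, Real.dist_eq, abs_lt]
    constructor <;> linarith [ht.1, ht.2]
  -- By definition the components are H¹ in the chart around `x t₁`; those in the chart around `p`
  -- arise by the transition matrix, smooth along the loop.
  obtain ⟨w', hw'⟩ := hw.matrix_apply
    (A := fun t => fderiv ℝ (chartTransition (x t₁) p) (extChartAt (𝓡 n) (x t₁) (x t)))
    fun t ht => by
      have h1 := ((contDiffAt_chartTransition (hmem t ht).2 (hmem t ht).1).fderiv_right
        (m := ∞) (by simp)).comp t (contDiffAt_loopCoord hx (hmem t ht).2)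
      exact h1.of_le (by simp)
  exact ⟨δ, w', hw'.congr fun t ht => (fieldCoord_trans ξ (hmem t ht).2 (hmem t ht).1).symm⟩

theorem memLp_fieldJet (hx : ContMDiff 𝓘(ℝ, ℝ) (𝓡 n) ∞ x)
    (hper : Function.Periodic x 1) {ξ : ∀ t, TangentSpace (𝓡 n) (x t)} (hξ : ξ ∈ H1Fields x)
    (b : ℝ) {t₀ ε : ℝ} (hε : 0 < ε) {p : M}
    (hsrc : ∀ t ∈ Icc (t₀ - ε) (t₀ + ε), x t ∈ (extChartAt (𝓡 n) p).source) :
    MemLp (fieldJet x ξ b p) 2 (volume.restrict (Icc (t₀ - ε) (t₀ + ε))) := by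
  have h := isH1Primitive_fieldCoord hx hper hξ hε hsrc
  have h1 := (ContinuousLinearMap.inl ℝ 𝔼 (𝔼 × ℝ)).comp_memLp'
    (memLp_two_of_continuousOn h.continuousOn)
  have h2 := ((ContinuousLinearMap.inr ℝ 𝔼 (𝔼 × ℝ)).comp
    (ContinuousLinearMap.inl ℝ 𝔼 ℝ)).comp_memLp' h.memLp
  have h3 : MemLp (fun _ : ℝ => ((0, 0, b) : 𝔼 × 𝔼 × ℝ)) 2
    (volume.restrict (Icc (t₀ - ε) (t₀ + ε))) := memLp_const _
  refine ((h1.add h2).add h3).ae_eq (ae_of_all _ fun t => ?_)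
  simp [fieldJet]

variable (g : SmoothMetric n M) (L : TangentBundle (𝓡 n) M → ℝ) (h T : ℝ)

section

variable {V : Type*} [NormedAddCommGroup V] [NormedSpace ℝ V] (G : V × V × ℝ → ℝ)
  (Γ : V → V →L[ℝ] V →L[ℝ] V) (y z z' w w' : V × V × ℝ)

set_option synthInstance.maxHeartbeats 200000 in
theorem hessForm_add_left : hessForm G Γ y (z + z') w = hessForm G Γ y z w + hessForm G Γ y z' w := by
  unfold hessForm
  simp only [map_add, Prod.fst_add, Prod.snd_add, _root_.add_apply]
  have e : ((Γ y.1 z.1 w.1 + Γ y.1 z'.1 w.1, fderiv ℝ Γ y.1 y.2.1 z.1 w.1 +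
      fderiv ℝ Γ y.1 y.2.1 z'.1 w.1 + (Γ y.1 z.2.1 w.1 + Γ y.1 z'.2.1 w.1) +
      (Γ y.1 z.1 w.2.1 + Γ y.1 z'.1 w.2.1), 0) : V × V × ℝ) =
      (Γ y.1 z.1 w.1, fderiv ℝ Γ y.1 y.2.1 z.1 w.1 + Γ y.1 z.2.1 w.1 + Γ y.1 z.1 w.2.1, 0) +
      (Γ y.1 z'.1 w.1, fderiv ℝ Γ y.1 y.2.1 z'.1 w.1 + Γ y.1 z'.2.1 w.1 + Γ y.1 z'.1 w.2.1, 0) := by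
    refine Prod.ext rfl (Prod.ext ?_ ?_)
    · simp only [Prod.snd_add, Prod.fst_add]; abel
    · simp
  rw [e, map_add]
  ring

set_option synthInstance.maxHeartbeats 200000 in
theorem hessForm_smul_left (c : ℝ) : hessForm G Γ y (c • z) w = c * hessForm G Γ y z w := by
  unfold hessForm
  simp only [map_smul, Prod.smul_fst, Prod.smul_snd, _root_.smul_apply]
  have e : ((c • Γ y.1 z.1 w.1, c • fderiv ℝ Γ y.1 y.2.1 z.1 w.1 + c • Γ y.1 z.2.1 w.1 +
      c • Γ y.1 z.1 w.2.1, 0) : V × V × ℝ) = c • (Γ y.1 z.1 w.1,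
        fderiv ℝ Γ y.1 y.2.1 z.1 w.1 + Γ y.1 z.2.1 w.1 + Γ y.1 z.1 w.2.1, 0) := by
    refine Prod.ext rfl (Prod.ext ?_ ?_)
    · simp only [Prod.smul_snd, Prod.smul_fst, smul_add]
    · simp
  rw [e, map_smul, smul_eq_mul, smul_eq_mul]
  ring

set_option synthInstance.maxHeartbeats 200000 in
theorem hessForm_add_right :
    hessForm G Γ y z (w + w') = hessForm G Γ y z w + hessForm G Γ y z w' := by
  unfold hessForm
  simp only [map_add, Prod.fst_add, Prod.snd_add]
  have e : ((Γ y.1 z.1 w.1 + Γ y.1 z.1 w'.1, fderiv ℝ Γ y.1 y.2.1 z.1 w.1 +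
      fderiv ℝ Γ y.1 y.2.1 z.1 w'.1 + (Γ y.1 z.2.1 w.1 + Γ y.1 z.2.1 w'.1) +
      (Γ y.1 z.1 w.2.1 + Γ y.1 z.1 w'.2.1), 0) : V × V × ℝ) =
      (Γ y.1 z.1 w.1, fderiv ℝ Γ y.1 y.2.1 z.1 w.1 + Γ y.1 z.2.1 w.1 + Γ y.1 z.1 w.2.1, 0) +
      (Γ y.1 z.1 w'.1, fderiv ℝ Γ y.1 y.2.1 z.1 w'.1 + Γ y.1 z.2.1 w'.1 + Γ y.1 z.1 w'.2.1, 0) := by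
    refine Prod.ext rfl (Prod.ext ?_ ?_)
    · simp only [Prod.snd_add, Prod.fst_add]; abel
    · simp
  rw [e, map_add]
  ring

set_option synthInstance.maxHeartbeats 200000 in
theorem hessForm_smul_right (c : ℝ) : hessForm G Γ y z (c • w) = c * hessForm G Γ y z w := by
  unfold hessForm
  simp only [map_smul, Prod.smul_fst, Prod.smul_snd]
  have e : ((c • Γ y.1 z.1 w.1, c • fderiv ℝ Γ y.1 y.2.1 z.1 w.1 + c • Γ y.1 z.2.1 w.1 +
      c • Γ y.1 z.1 w.2.1, 0) : V × V × ℝ) = c • (Γ y.1 z.1 w.1,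
        fderiv ℝ Γ y.1 y.2.1 z.1 w.1 + Γ y.1 z.2.1 w.1 + Γ y.1 z.1 w.2.1, 0) := by
    refine Prod.ext rfl (Prod.ext ?_ ?_)
    · simp only [Prod.smul_snd, Prod.smul_fst, smul_add]
    · simp
  rw [e, map_smul, smul_eq_mul, smul_eq_mul]
  ring

set_option synthInstance.maxHeartbeats 200000 in
theorem hessForm_symm {G : V × V × ℝ → ℝ} {Γ : V → V →L[ℝ] V →L[ℝ] V} {y : V × V × ℝ}
    (hG : ContDiffAt ℝ 2 G y) (hΓ : DifferentiableAt ℝ Γ y.1) (hsymm : ∀ q v w, Γ q v w = Γ q w v)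
    (z w : V × V × ℝ) : hessForm G Γ y z w = hessForm G Γ y w z := by
  have h1 : ∀ v a b, fderiv ℝ Γ y.1 v a b = fderiv ℝ Γ y.1 v b a := by
    intro v a b
    have h2 : ∀ a b, HasDerivAt (fun s : ℝ => Γ (y.1 + s • v) a b) (fderiv ℝ Γ y.1 v a b) 0 := by
      intro a b
      have := DifferentiableAt.hasDerivAt_line (F := V →L[ℝ] V →L[ℝ] V) hΓ v
      simpa using (this.clm_apply (hasDerivAt_const 0 a)).clm_apply (hasDerivAt_const 0 b)
    refine (h2 a b).unique ?_
    simpa only [hsymm _ b a] using h2 b a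
  unfold hessForm
  rw [hG.fderiv_fderiv_comm z w, hsymm _ z.1 w.1, h1 _ z.1 w.1, hsymm _ z.2.1 w.1,
    hsymm _ z.1 w.2.1]
  congr 3
  simp only [Prod.mk.injEq, and_true]
  abel

theorem continuousAt_fderiv_comp_apply {V F : Type*} [NormedAddCommGroup V] [NormedSpace ℝ V]
    [NormedAddCommGroup F] [NormedSpace ℝ F] {A : V → F} {a v : ℝ → V} {t : ℝ}
    (hA : ContDiffAt ℝ 1 A (a t)) (ha : ContinuousAt a t) (hv : ContinuousAt v t) :
    ContinuousAt (fun t => fderiv ℝ A (a t) (v t)) t :=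
  (ContinuousAt.comp (f := a) (hA.fderiv_right (m := 0) (by simp)).continuousAt ha).clm_apply hv

end

variable {L T}

set_option synthInstance.maxHeartbeats 200000 in
theorem continuousAt_hessForm (hL : ContMDiff (𝓡 n).tangent 𝓘(ℝ, ℝ) ∞ L)
    (hx : ContMDiff 𝓘(ℝ, ℝ) (𝓡 n) ∞ x) (hT : T ≠ 0) {p : M} {t : ℝ}
    (hp : x t ∈ (extChartAt (𝓡 n) p).source) (z w : 𝔼 × 𝔼 × ℝ) :
    ContinuousAt (fun t => hessForm (actionCoord L h p) (christoffelBilin g p)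
      (loopPoint x T p t) z w) t := by
  have hG := contDiffAt_actionCoord hL h (loopPoint_mem_target T hp) hT
  have hc : ContinuousAt (loopPoint x T p) t := (contDiffAt_loopPoint hx T hp).continuousAt
  have hΓ := contDiffAt_christoffelBilin g hp
  have hG1 := (hG.fderiv_right (m := ∞) (by simp))
  have hG2 := (hG1.fderiv_right (m := ∞) (by simp))
  have c1 : ContinuousAt (fun t => fderiv ℝ (actionCoord L h p) (loopPoint x T p t)) t :=
    ContinuousAt.comp (f := loopPoint x T p) hG1.continuousAt hc
  have c2 : ContinuousAt (fun t => fderiv ℝ (fderiv ℝ (actionCoord L h p)) (loopPoint x T p t)) t :=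
    ContinuousAt.comp (f := loopPoint x T p) hG2.continuousAt hc
  have hc1 : ContinuousAt (fun t => (loopPoint x T p t).1) t := hc.fst
  have hc2 : ContinuousAt (fun t => (loopPoint x T p t).2.1) t := hc.snd.fst
  have c3 : ContinuousAt (fun t => christoffelBilin g p (loopPoint x T p t).1) t :=
    ContinuousAt.comp (f := fun t => (loopPoint x T p t).1) hΓ.continuousAt hc1
  have c4 := continuousAt_fderiv_comp_apply (F := 𝔼 →L[ℝ] 𝔼 →L[ℝ] 𝔼) (hΓ.of_le (by simp)) hc1 hc2
  unfold hessForm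
  refine ((c2.clm_apply continuousAt_const).clm_apply continuousAt_const).sub (c1.clm_apply ?_)
  refine ContinuousAt.prodMk ((c3.clm_apply continuousAt_const).clm_apply continuousAt_const)
    (ContinuousAt.prodMk ?_ continuousAt_const)
  exact (((c4.clm_apply continuousAt_const).clm_apply continuousAt_const).add
    ((c3.clm_apply continuousAt_const).clm_apply continuousAt_const)).add
    ((c3.clm_apply continuousAt_const).clm_apply continuousAt_const)

/-- `hessForm` is a bare function of its arguments. This version, continuous in operator norm,
serves both integrability and the coercivity estimate. -/
theorem exists_hessForm_bilin (hL : ContMDiff (𝓡 n).tangent 𝓘(ℝ, ℝ) ∞ L)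
    (hx : ContMDiff 𝓘(ℝ, ℝ) (𝓡 n) ∞ x) (hT : T ≠ 0) {p : M} {s : Set ℝ}
    (hsrc : ∀ t ∈ s, x t ∈ (extChartAt (𝓡 n) p).source) :
    ∃ B : ℝ → (𝔼 × 𝔼 × ℝ) →L[ℝ] (𝔼 × 𝔼 × ℝ) →L[ℝ] ℝ, (∀ t z w, B t z w =
      hessForm (actionCoord L h p) (christoffelBilin g p) (loopPoint x T p t) z w) ∧
      ContinuousOn B s :=
  exists_continuousOn_bilin (fun _ _ _ _ => hessForm_add_left ..)
    (fun _ _ _ _ => hessForm_smul_left ..) (fun _ _ _ _ => hessForm_add_right ..)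
    (fun _ _ _ _ => hessForm_smul_right ..)
    fun z w t ht => (continuousAt_hessForm g h hL hx hT (hsrc t ht) z w).continuousWithinAt

theorem integrableOn_secondDensity (hL : ContMDiff (𝓡 n).tangent 𝓘(ℝ, ℝ) ∞ L)
    (hx : ContMDiff 𝓘(ℝ, ℝ) (𝓡 n) ∞ x) (hper : Function.Periodic x 1) (hT : T ≠ 0)
    {ξ η : ∀ t, TangentSpace (𝓡 n) (x t)} (hξ : ξ ∈ H1Fields x) (hη : η ∈ H1Fields x) (b c : ℝ)
    {t₀ ε : ℝ} (hε : 0 < ε) {p : M}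
    (hsrc : ∀ t ∈ Icc (t₀ - ε) (t₀ + ε), x t ∈ (extChartAt (𝓡 n) p).source) :
    IntegrableOn (secondDensity g L h x T p ξ b η c) (Icc (t₀ - ε) (t₀ + ε)) := by
  obtain ⟨B, hB, hBc⟩ := exists_hessForm_bilin g h hL hx hT hsrc
  have := integrableOn_bilin hBc (memLp_fieldJet hx hper hξ b hε hsrc)
    (memLp_fieldJet hx hper hη c hε hsrc)
  simp only [hB] at this
  exact this

/-- The exceptional null set is chosen before `p`: it consists of the times where a field is not
differentiable in the chart around `x t`. -/
theorem ae_secondDensity_eq (hL : ContMDiff (𝓡 n).tangent 𝓘(ℝ, ℝ) ∞ L)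
    (hx : ContMDiff 𝓘(ℝ, ℝ) (𝓡 n) ∞ x) (hper : Function.Periodic x 1) (hT : T ≠ 0)
    {ξ η : ∀ t, TangentSpace (𝓡 n) (x t)} (hξ : ξ ∈ H1Fields x) (hη : η ∈ H1Fields x) (b c : ℝ) :
    ∀ᵐ t, ∀ p : M, x t ∈ (extChartAt (𝓡 n) p).source →
      secondDensity g L h x T (x t) ξ b η c t = secondDensity g L h x T p ξ b η c t := by
  filter_upwards [ae_differentiableAt_fieldCoord hx hper hξ,
    ae_differentiableAt_fieldCoord hx hper hη] with t h1 h2 p hp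
  exact secondDensity_trans g hL h hx hT b c (mem_extChartAt_source (x t)) hp h1 h2

theorem intervalIntegrable_secondDensity (hL : ContMDiff (𝓡 n).tangent 𝓘(ℝ, ℝ) ∞ L)
    (hx : ContMDiff 𝓘(ℝ, ℝ) (𝓡 n) ∞ x) (hper : Function.Periodic x 1) (hT : T ≠ 0)
    {ξ η : ∀ t, TangentSpace (𝓡 n) (x t)} (hξ : ξ ∈ H1Fields x) (hη : η ∈ H1Fields x) (b c : ℝ)
    (t₁ t₂ : ℝ) :
    IntervalIntegrable (fun t => secondDensity g L h x T (x t) ξ b η c t) volume t₁ t₂ := by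
  have hloc : LocallyIntegrable (fun t => secondDensity g L h x T (x t) ξ b η c t) := by
    intro t₀
    obtain ⟨ε, hε, hsrc⟩ := exists_forall_Icc_mem_source (n := n) hx.continuous t₀
    refine ⟨Icc (t₀ - ε) (t₀ + ε), Icc_mem_nhds (by linarith) (by linarith), ?_⟩
    refine (integrableOn_secondDensity g h hL hx hper hT hξ hη b c hε hsrc).congr_fun_ae ?_
    rw [EventuallyEq, ae_restrict_iff' measurableSet_Icc]
    filter_upwards [ae_secondDensity_eq g h hL hx hper hT hξ hη b c] with t ht hmem
    exact (ht _ (hsrc t hmem)).symm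
  exact (hloc.integrableOn_isCompact isCompact_uIcc).intervalIntegrable

/-- The polarized second variation of the free period action. -/
def indexForm (hL : ContMDiff (𝓡 n).tangent 𝓘(ℝ, ℝ) ∞ L)
    (hx : ContMDiff 𝓘(ℝ, ℝ) (𝓡 n) ∞ x) (hper : Function.Periodic x 1) (hT : T ≠ 0) :
    (h1Submodule hx hper × ℝ) →ₗ[ℝ] (h1Submodule hx hper × ℝ) →ₗ[ℝ] ℝ :=
  LinearMap.mk₂ ℝ (fun v w => ∫ t in (0 : ℝ)..1, secondDensity g L h x T (x t) v.1 v.2 w.1 w.2 t)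
    (by
      intro v v' w
      rw [← intervalIntegral.integral_add
        (intervalIntegrable_secondDensity g h hL hx hper hT v.1.2 w.1.2 _ _ _ _)
        (intervalIntegrable_secondDensity g h hL hx hper hT v'.1.2 w.1.2 _ _ _ _)]
      apply intervalIntegral.integral_congr_ae
      -- Additivity of the integrand is only claimed where both fields are differentiable, since
      -- `deriv` takes junk values elsewhere. Scalar multiplication, below, needs no such
      -- restriction.
      filter_upwards [ae_differentiableAt_fieldCoord hx hper v.1.2,
        ae_differentiableAt_fieldCoord hx hper v'.1.2] with t h1 h2 _
      unfold secondDensity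
      rw [← hessForm_add_left]
      congr 1
      have e : fieldCoord x ((v + v').1 : ∀ t, TangentSpace (𝓡 n) (x t)) (x t) =
        fieldCoord x v.1 (x t) + fieldCoord x v'.1 (x t) := funext fun s => fieldCoord_add _ _ _ _
      simp only [fieldJet, e, deriv_add h1 h2]
      rfl)
    (by
      intro c v w
      rw [smul_eq_mul, ← intervalIntegral.integral_const_mul]
      apply intervalIntegral.integral_congr_ae
      filter_upwards with t _
      unfold secondDensity
      rw [← hessForm_smul_left]
      congr 1
      have e : fieldCoord x ((c • v).1 : ∀ t, TangentSpace (𝓡 n) (x t)) (x t) =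
        c • fieldCoord x v.1 (x t) := funext fun s => fieldCoord_smul _ _ _ _
      simp only [fieldJet, e, deriv_const_smul_field]
      rfl)
    (by
      intro v w w'
      rw [← intervalIntegral.integral_add
        (intervalIntegrable_secondDensity g h hL hx hper hT v.1.2 w.1.2 _ _ _ _)
        (intervalIntegrable_secondDensity g h hL hx hper hT v.1.2 w'.1.2 _ _ _ _)]
      apply intervalIntegral.integral_congr_ae
      filter_upwards [ae_differentiableAt_fieldCoord hx hper w.1.2,
        ae_differentiableAt_fieldCoord hx hper w'.1.2] with t h1 h2 _
      unfold secondDensity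
      rw [← hessForm_add_right]
      congr 1
      have e : fieldCoord x ((w + w').1 : ∀ t, TangentSpace (𝓡 n) (x t)) (x t) =
        fieldCoord x w.1 (x t) + fieldCoord x w'.1 (x t) := funext fun s => fieldCoord_add _ _ _ _
      simp only [fieldJet, e, deriv_add h1 h2]
      rfl)
    (by
      intro c v w
      rw [smul_eq_mul, ← intervalIntegral.integral_const_mul]
      apply intervalIntegral.integral_congr_ae
      filter_upwards with t _
      unfold secondDensity
      rw [← hessForm_smul_right]
      congr 1
      have e : fieldCoord x ((c • w).1 : ∀ t, TangentSpace (𝓡 n) (x t)) (x t) =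
        c • fieldCoord x w.1 (x t) := funext fun s => fieldCoord_smul _ _ _ _
      simp only [fieldJet, e, deriv_const_smul_field]
      rfl)

theorem indexForm_apply (hL : ContMDiff (𝓡 n).tangent 𝓘(ℝ, ℝ) ∞ L)
    (hx : ContMDiff 𝓘(ℝ, ℝ) (𝓡 n) ∞ x) (hper : Function.Periodic x 1) (hT : T ≠ 0)
    (v w : h1Submodule hx hper × ℝ) : indexForm g h hL hx hper hT v w =
      ∫ t in (0 : ℝ)..1, secondDensity g L h x T (x t) v.1 v.2 w.1 w.2 t := rfl

theorem indexForm_symm (hL : ContMDiff (𝓡 n).tangent 𝓘(ℝ, ℝ) ∞ L)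
    (hx : ContMDiff 𝓘(ℝ, ℝ) (𝓡 n) ∞ x) (hper : Function.Periodic x 1) (hT : T ≠ 0)
    (v w : h1Submodule hx hper × ℝ) :
    indexForm g h hL hx hper hT v w = indexForm g h hL hx hper hT w v := by
  rw [indexForm_apply, indexForm_apply]
  congr 1
  ext t
  have hp : x t ∈ (extChartAt (𝓡 n) (x t)).source := mem_extChartAt_source (x t)
  exact hessForm_symm
    ((contDiffAt_actionCoord hL h (loopPoint_mem_target T hp) hT).of_le ENat.LEInfty.out)
    ((contDiffAt_christoffelBilin g hp).differentiableAt (by simp))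
    (christoffelBilin_symm g (x t)) _ _

theorem indexForm_self (hL : ContMDiff (𝓡 n).tangent 𝓘(ℝ, ℝ) ∞ L)
    (hx : ContMDiff 𝓘(ℝ, ℝ) (𝓡 n) ∞ x) (hper : Function.Periodic x 1) (hT : T ≠ 0)
    (v : h1Submodule hx hper × ℝ) :
    indexForm g h hL hx hper hT v v = secondVariation g L h x T v.1 v.2 := by
  rw [indexForm_apply, secondVariation]
  apply intervalIntegral.integral_congr_ae
  filter_upwards [ae_differentiableAt_fieldCoord hx hper v.1.2] with t ht _
  exact (iteratedDeriv_actionDensity g hL h hx hT v.2 ht).symm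

/-- As in `morseIndex_submodule`, with the retraction acting on the field and the identity on the
period variable. -/
theorem freeMorseIndex_eq (hL : ContMDiff (𝓡 n).tangent 𝓘(ℝ, ℝ) ∞ L)
    (hx : ContMDiff 𝓘(ℝ, ℝ) (𝓡 n) ∞ x) (hper : Function.Periodic x 1) (hT : T ≠ 0) :
    freeMorseIndex g L h x T =
      morseIndex univ (fun v => indexForm g h hL hx hper hT v v) := by
  have h0 : 0 ≤ secondVariation g L h x T 0 0 := by
    have := indexForm_self g h hL hx hper hT 0
    rw [map_zero] at this
    exact this.le
  obtain ⟨f, hf⟩ := (h1Submodule hx hper).subtype.exists_leftInverse_of_injective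
    (h1Submodule hx hper).ker_subtype
  have hf' : ∀ w (hw : w ∈ H1Fields x), f w = ⟨w, hw⟩ := fun w hw =>
    LinearMap.congr_fun hf ⟨w, hw⟩
  apply le_antisymm
  · refine morseIndex_le_of_linearMap (f.prodMap LinearMap.id) (by simp) (by simp)
      fun w hw => ?_
    rw [indexForm_self, LinearMap.prodMap_apply, hf' w.1 hw.1]
    rfl
  · refine morseIndex_le_of_linearMap ((h1Submodule hx hper).subtype.prodMap LinearMap.id)
      (fun w _ => ⟨w.1.2, mem_univ _⟩) h0 fun w _ => ?_
    rw [indexForm_self]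
    rfl

theorem fixedMorseIndex_eq (hL : ContMDiff (𝓡 n).tangent 𝓘(ℝ, ℝ) ∞ L)
    (hx : ContMDiff 𝓘(ℝ, ℝ) (𝓡 n) ∞ x) (hper : Function.Periodic x 1) (hT : T ≠ 0) :
    fixedMorseIndex g L h x T =
      morseIndex univ (fun η => indexForm g h hL hx hper hT (η, 0) (η, 0)) := by
  have h0 : 0 ≤ secondVariation g L h x T 0 0 := by
    have := indexForm_self g h hL hx hper hT 0
    rw [map_zero] at this
    exact this.le
  refine (morseIndex_submodule (h1Submodule hx hper) _ h0).trans ?_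
  simp only [indexForm_self]

end Hessian

/-! ### Finiteness of the fixed period index. -/

section FiniteIndex

open Filter Topology

set_option synthInstance.maxHeartbeats 200000 in
/-- A form which is positive definite in the velocities is coercive up to a multiple of the square
of the position. -/
theorem exists_coercive {V : Type*} [NormedAddCommGroup V] [NormedSpace ℝ V]
    [FiniteDimensional ℝ V] {B : ℝ → (V × V × ℝ) →L[ℝ] (V × V × ℝ) →L[ℝ] ℝ} {a b : ℝ}
    (hB : ContinuousOn B (Icc a b))
    (hpos : ∀ t ∈ Icc a b, ∀ w : V, w ≠ 0 → 0 < B t (0, w, 0) (0, w, 0)) :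
    ∃ c > 0, ∃ C ≥ 0, ∀ t ∈ Icc a b, ∀ u w : V,
      c * ‖w‖ ^ 2 - C * ‖u‖ ^ 2 ≤ B t (u, w, 0) (u, w, 0) := by
  have hcomp : IsCompact (Icc a b ×ˢ Metric.sphere (0 : V) 1) :=
    isCompact_Icc.prod (isCompact_sphere 0 1)
  have hcont : ContinuousOn (fun y : ℝ × V => B y.1 (0, y.2, 0) (0, y.2, 0))
      (Icc a b ×ˢ Metric.sphere (0 : V) 1) := by
    have h1 : ContinuousOn (fun y : ℝ × V => ((0, y.2, 0) : V × V × ℝ))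
      (Icc a b ×ˢ Metric.sphere (0 : V) 1) := by fun_prop
    have h2 : ContinuousOn (fun y : ℝ × V => B y.1) (Icc a b ×ˢ Metric.sphere (0 : V) 1) :=
      hB.comp continuousOn_fst fun y hy => hy.1
    exact (h2.clm_apply h1).clm_apply h1
  obtain ⟨c, hc, hcB⟩ : ∃ c > 0, ∀ t ∈ Icc a b, ∀ w : V, ‖w‖ = 1 →
      c ≤ B t (0, w, 0) (0, w, 0) := by
    rcases (Icc a b ×ˢ Metric.sphere (0 : V) 1).eq_empty_or_nonempty with he | hne
    · refine ⟨1, one_pos, fun t ht w hw => ?_⟩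
      have : (t, w) ∈ Icc a b ×ˢ Metric.sphere (0 : V) 1 := ⟨ht, by simpa using hw⟩
      rw [he] at this
      exact this.elim
    · obtain ⟨y, hy, hmin⟩ := hcomp.exists_isMinOn hne hcont
      refine ⟨_, hpos y.1 hy.1 y.2 (fun h0 => ?_), fun t ht w hw =>
        hmin (show (t, w) ∈ _ from ⟨ht, by simpa using hw⟩)⟩
      have := hy.2
      rw [h0] at this
      simp at this
  obtain ⟨K, hK⟩ := isCompact_Icc.exists_bound_of_continuousOn
    (E := (V × V × ℝ) →L[ℝ] (V × V × ℝ) →L[ℝ] ℝ) hB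
  -- With |B| ≤ |K|, the cross terms are at most 2|K|‖u‖‖w‖ ≤ (c/2)‖w‖² + (2K²/c)‖u‖². Half of the
  -- velocity coercivity is spent on them, and the pure position term costs another |K|‖u‖².
  refine ⟨c / 2, half_pos hc, 2 * (|K| ^ 2 / c) + |K|, by positivity, fun t ht u w => ?_⟩
  have hw : c * ‖w‖ ^ 2 ≤ B t (0, w, 0) (0, w, 0) := by
    rcases eq_or_ne w 0 with rfl | hw
    · have : ((0, 0, 0) : V × V × ℝ) = 0 := rfl
      rw [this]
      simp
    have hn : ‖w‖ ≠ 0 := norm_ne_zero_iff.2 hw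
    have h1 := hcB t ht (‖w‖⁻¹ • w) (by rw [norm_smul, norm_inv, norm_norm, inv_mul_cancel₀ hn])
    have e : ((0, ‖w‖⁻¹ • w, 0) : V × V × ℝ) = ‖w‖⁻¹ • (0, w, 0) := by simp
    rw [e, map_smul, map_smul, _root_.smul_apply, smul_eq_mul, smul_eq_mul] at h1
    have h2 := mul_le_mul_of_nonneg_left h1 (sq_nonneg ‖w‖)
    have h3 : ‖w‖ ^ 2 * (‖w‖⁻¹ * (‖w‖⁻¹ * B t (0, w, 0) (0, w, 0))) = B t (0, w, 0) (0, w, 0) := by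
      field_simp
    rw [h3] at h2
    linarith
  have hle : ∀ z z' : V × V × ℝ, |B t z z'| ≤ |K| * ‖z‖ * ‖z'‖ := fun z z' =>
    ((B t).le_opNorm₂ z z').trans (by
      gcongr
      exact (hK t ht).trans (le_abs_self K))
  have n1 : ‖((u, 0, 0) : V × V × ℝ)‖ = ‖u‖ := by simp
  have n2 : ‖((0, w, 0) : V × V × ℝ)‖ = ‖w‖ := by simp
  have e : ((u, w, 0) : V × V × ℝ) = (u, 0, 0) + (0, w, 0) := by simp
  have e2 : B t (u, w, 0) (u, w, 0) = B t (u, 0, 0) (u, 0, 0) + B t (u, 0, 0) (0, w, 0) +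
      B t (0, w, 0) (u, 0, 0) + B t (0, w, 0) (0, w, 0) := by
    rw [e]
    simp only [map_add, _root_.add_apply]
    ring
  have b1 := neg_le_of_abs_le (hle (u, 0, 0) (u, 0, 0))
  have b2 := neg_le_of_abs_le (hle (u, 0, 0) (0, w, 0))
  have b3 := neg_le_of_abs_le (hle (0, w, 0) (u, 0, 0))
  rw [n1] at b1
  rw [n1, n2] at b2 b3
  have key : 0 ≤ (c / 2) * (‖w‖ - 2 * |K| / c * ‖u‖) ^ 2 := by positivity
  have key2 : (c / 2) * (‖w‖ - 2 * |K| / c * ‖u‖) ^ 2 =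
      c / 2 * ‖w‖ ^ 2 - 2 * |K| * ‖u‖ * ‖w‖ + 2 * (|K| ^ 2 / c) * ‖u‖ ^ 2 := by
    field_simp
    ring
  rw [key2] at key
  rw [e2]
  linarith

/-- Integrating Poincaré's inequality gives ∫‖u‖² ≤ (b - a)²∫‖w‖², and b - a is at most the length
2δ of the window. -/
theorem IsH1Primitive.integral_nonneg {V : Type*} [NormedAddCommGroup V] [NormedSpace ℝ V]
    [CompleteSpace V] {u w : ℝ → V} {t₀ δ a b c C : ℝ} (h : IsH1Primitive u w t₀ δ) (hC : 0 ≤ C)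
    (hab : a ≤ b) (ha : a ∈ Icc (t₀ - δ) (t₀ + δ)) (hb : b ∈ Icc (t₀ - δ) (t₀ + δ)) (hu : u a = 0)
    (hδ : C * (2 * δ) ^ 2 ≤ c) :
    0 ≤ ∫ t in a..b, (c * ‖w t‖ ^ 2 - C * ‖u t‖ ^ 2) := by
  have hw2 : IntegrableOn (fun s => ‖w s‖ ^ 2) (Icc (t₀ - δ) (t₀ + δ)) :=
    h.memLp.integrable_norm_pow (by norm_num)
  have hsub := uIcc_subset_Icc ha hb
  have hwi : IntervalIntegrable (fun s => ‖w s‖ ^ 2) volume a b :=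
    (hw2.mono_set hsub).intervalIntegrable
  have hui : IntervalIntegrable (fun s => ‖u s‖ ^ 2) volume a b :=
    ((h.continuousOn.mono hsub).norm.pow 2).intervalIntegrable
  rw [intervalIntegral.integral_sub (hwi.const_mul c) (hui.const_mul C),
    intervalIntegral.integral_const_mul, intervalIntegral.integral_const_mul]
  set K := ∫ s in a..b, ‖w s‖ ^ 2
  have hK : 0 ≤ K := intervalIntegral.integral_nonneg hab fun s _ => sq_nonneg _
  have h1 : ∫ s in a..b, ‖u s‖ ^ 2 ≤ ∫ _ in a..b, (b - a) * K := by
    refine intervalIntegral.integral_mono_on hab hui intervalIntegrable_const fun t ht => ?_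
    have htm : t ∈ Icc (t₀ - δ) (t₀ + δ) := ⟨ha.1.trans ht.1, ht.2.trans hb.2⟩
    refine (h.norm_sq_le ht.1 ha htm hu).trans ?_
    have h3 : ∫ s in a..t, ‖w s‖ ^ 2 ≤ K :=
      intervalIntegral.integral_mono_interval le_rfl ht.1 ht.2
        (ae_of_all _ fun s => sq_nonneg _) hwi
    have h4 : 0 ≤ ∫ s in a..t, ‖w s‖ ^ 2 :=
      intervalIntegral.integral_nonneg ht.1 fun s _ => sq_nonneg _
    have h5 : t - a ≤ b - a := by linarith [ht.2]
    have h6 : 0 ≤ t - a := by linarith [ht.1]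
    exact mul_le_mul h5 h3 h4 (h6.trans h5)
  rw [intervalIntegral.integral_const, smul_eq_mul] at h1
  have hlen : (b - a) ^ 2 ≤ (2 * δ) ^ 2 :=
    pow_le_pow_left₀ (by linarith) (by linarith [ha.1, hb.2]) 2
  have h7 : C * ((b - a) * ((b - a) * K)) ≤ c * K := by
    calc C * ((b - a) * ((b - a) * K)) = C * (b - a) ^ 2 * K := by ring
      _ ≤ C * (2 * δ) ^ 2 * K := by gcongr
      _ ≤ c * K := by gcongr
  have h8 := mul_le_mul_of_nonneg_left h1 hC
  linarith

variable {n : ℕ} {M : Type*} [TopologicalSpace M] [ChartedSpace (EuclideanSpace ℝ (Fin n)) M]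
  [IsManifold (𝓡 n) ∞ M] {x : ℝ → M}

local notation "𝔼" => EuclideanSpace ℝ (Fin n)

variable (g : SmoothMetric n M) {L : TangentBundle (𝓡 n) M → ℝ} (h : ℝ) {T : ℝ}

theorem vecOfCoord_ne_zero {p y : M} (hp : y ∈ (extChartAt (𝓡 n) p).source)
    {v : 𝔼} (hv : v ≠ 0) : vecOfCoord p y v ≠ 0 := by
  intro h0
  apply hv
  have := vecOfCoord_eq hp v
  rw [h0] at this
  have h1 := tangentCoordChange_comp (I := 𝓡 n) (v := v)
    ⟨⟨hp, mem_extChartAt_source y⟩, hp⟩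
  rw [tangentCoordChange_self hp] at h1
  rw [← h1]
  exact (congrArg _ this.symm).trans (map_zero _)

/-- A pure velocity variation has no position component, so every Christoffel term vanishes. What is
left is the second derivative of r ↦ T(L(q,(v + r w)/T) + h), positive by fiber convexity. -/
theorem hessForm_velocity_pos (hL : ContMDiff (𝓡 n).tangent 𝓘(ℝ, ℝ) ∞ L)
    (hconv : IsFiberStrictlyConvex L) (hT : 0 < T) {p : M}
    {t : ℝ} (hp : x t ∈ (extChartAt (𝓡 n) p).source) {w : 𝔼} (hw : w ≠ 0) :
    0 < hessForm (actionCoord L h p) (christoffelBilin g p) (loopPoint x T p t) (0, w, 0)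
      (0, w, 0) := by
  have hG := contDiffAt_actionCoord hL h (loopPoint_mem_target T hp) hT.ne'
  set y := loopPoint (n := n) x T p t with hy
  have h1 : hessForm (actionCoord L h p) (christoffelBilin g p) y (0, w, 0) (0, w, 0) =
      iteratedDeriv 2 (fun r : ℝ => actionCoord L h p
        (y + r • ((0, w, 0) : 𝔼 × 𝔼 × ℝ) - (r ^ 2 / 2) • (0 : 𝔼 × 𝔼 × ℝ))) 0 := by
    rw [iteratedDeriv_two_comp_curve (hG.of_le ENat.LEInfty.out)]
    simp only [hessForm, map_zero, _root_.zero_apply, add_zero]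
    rw [show ((0, 0, 0) : 𝔼 × 𝔼 × ℝ) = 0 from rfl, map_zero]
  let q : M := (extChartAt (𝓡 n) p).symm y.1
  have hq : q = x t := (extChartAt (𝓡 n) p).left_inv hp
  have h2 : (fun r : ℝ => actionCoord L h p
      (y + r • ((0, w, 0) : 𝔼 × 𝔼 × ℝ) - (r ^ 2 / 2) • (0 : 𝔼 × 𝔼 × ℝ))) = fun r : ℝ =>
      T * (L ⟨q, vecOfCoord p q (T⁻¹ • y.2.1) + r • vecOfCoord p q (T⁻¹ • w)⟩ + h) := by
    ext r
    have e1 : y + r • ((0, w, 0) : 𝔼 × 𝔼 × ℝ) - (r ^ 2 / 2) • (0 : 𝔼 × 𝔼 × ℝ) =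
        (y.1, y.2.1 + r • w, T) := by
      refine Prod.ext ?_ (Prod.ext ?_ ?_)
      · simp
      · simp
      · simp [hy, loopPoint]
    rw [e1]
    simp only [actionCoord, lagrangianCoord]
    have e2 : vecOfCoord p q (T⁻¹ • (y.2.1 + r • w)) =
        vecOfCoord p q (T⁻¹ • y.2.1) + r • vecOfCoord p q (T⁻¹ • w) := by
      unfold vecOfCoord
      rw [smul_add, map_add, smul_comm T⁻¹ r w, map_smul _ r]
    change T * (L ⟨q, vecOfCoord p q (T⁻¹ • (y.2.1 + r • w))⟩ + h) = _
    rw [e2]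
  have h3 := hconv q (vecOfCoord p q (T⁻¹ • y.2.1)) (vecOfCoord p q (T⁻¹ • w))
    (vecOfCoord_ne_zero (hq ▸ hp) (smul_ne_zero (inv_ne_zero hT.ne') hw))
  rw [h1, h2]
  rw [iteratedDeriv_succ, iteratedDeriv_one] at h3 ⊢
  have h4 : ∀ f : ℝ → ℝ, deriv (fun r => T * (f r + h)) = fun r => T * deriv f r := fun f => by
    ext r
    rw [deriv_const_mul_field, deriv_add_const]
  rw [h4, deriv_const_mul_field]
  exact mul_pos hT h3

/-- Fields vanishing at the left end of a short interval have nonnegative second variation on it. -/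
theorem exists_integral_secondDensity_nonneg (hL : ContMDiff (𝓡 n).tangent 𝓘(ℝ, ℝ) ∞ L)
    (hconv : IsFiberStrictlyConvex L) (hx : ContMDiff 𝓘(ℝ, ℝ) (𝓡 n) ∞ x)
    (hper : Function.Periodic x 1) (hT : 0 < T) (t₀ : ℝ) :
    ∃ δ > 0, ∀ ξ ∈ H1Fields x, ∀ a ∈ Icc (t₀ - δ) (t₀ + δ), ∀ b ∈ Icc (t₀ - δ) (t₀ + δ), a ≤ b →
      (ξ a : 𝔼) = 0 → 0 ≤ ∫ t in a..b, secondDensity g L h x T (x t) ξ 0 ξ 0 t := by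
  obtain ⟨ε, hε, hsrc⟩ := exists_forall_Icc_mem_source (n := n) hx.continuous t₀
  obtain ⟨B, hB, hBc⟩ := exists_hessForm_bilin g h hL hx hT.ne' hsrc
  obtain ⟨c, hc, C, hC, hcoer⟩ := exists_coercive hBc fun t ht w hw => by
    rw [hB]
    exact hessForm_velocity_pos g h hL hconv hT (hsrc t ht) hw
  -- The coercivity constants come from the larger interval of radius ε; shrinking to δ keeps them
  -- valid and makes Poincaré's inequality dominate the position term.
  obtain ⟨δ, hδ, hδε, hδc⟩ : ∃ δ > 0, δ ≤ ε ∧ C * (2 * δ) ^ 2 ≤ c := by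
    have h1 : Tendsto (fun δ : ℝ => C * (2 * δ) ^ 2) (𝓝[>] 0) (𝓝 (C * (2 * 0) ^ 2)) :=
      (Continuous.tendsto (by fun_prop) 0).mono_left nhdsWithin_le_nhds
    have h2 := h1.eventually (eventually_lt_nhds (b := c) (by simpa using hc))
    obtain ⟨δ, h3, h4⟩ := (h2.and (Ioc_mem_nhdsGT hε)).exists
    exact ⟨δ, h4.1, h4.2, h3.le⟩
  have hsub : Icc (t₀ - δ) (t₀ + δ) ⊆ Icc (t₀ - ε) (t₀ + ε) :=
    Icc_subset_Icc (by linarith) (by linarith)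
  refine ⟨δ, hδ, fun ξ hξ a ha b hb hab h0 => ?_⟩
  have hprim := isH1Primitive_fieldCoord hx hper hξ hδ fun t ht => hsrc t (hsub ht)
  have hu : fieldCoord x ξ (x t₀) a = 0 :=
    (congrArg (tangentCoordChange (𝓡 n) (x a) (x t₀) (x a)) h0).trans (map_zero _)
  refine (hprim.integral_nonneg hC hab ha hb hu hδc).trans ?_
  have hsubab := uIcc_subset_Icc ha hb
  have i1 : IntervalIntegrable (fun t => c * ‖deriv (fieldCoord x ξ (x t₀)) t‖ ^ 2 -
      C * ‖fieldCoord x ξ (x t₀) t‖ ^ 2) volume a b := by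
    have hw2 : IntegrableOn (fun s => ‖deriv (fieldCoord x ξ (x t₀)) s‖ ^ 2)
      (Icc (t₀ - δ) (t₀ + δ)) := hprim.memLp.integrable_norm_pow (by norm_num)
    exact ((hw2.mono_set hsubab).intervalIntegrable.const_mul c).sub
      (((hprim.continuousOn.mono hsubab).norm.pow 2).intervalIntegrable.const_mul C)
  refine intervalIntegral.integral_mono_ae_restrict hab i1
    (intervalIntegrable_secondDensity g h hL hx hper hT.ne' hξ hξ 0 0 a b) ?_
  rw [EventuallyLE, ae_restrict_iff' measurableSet_Icc]
  filter_upwards [ae_secondDensity_eq g h hL hx hper hT.ne' hξ hξ 0 0] with t ht hmem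
  have hm : t ∈ Icc (t₀ - ε) (t₀ + ε) := hsub ⟨ha.1.trans hmem.1, hmem.2.trans hb.2⟩
  rw [ht _ (hsrc t hm), secondDensity, ← hB]
  exact hcoer t hm _ _

theorem fixedMorseIndex_ne_top (hL : ContMDiff (𝓡 n).tangent 𝓘(ℝ, ℝ) ∞ L)
    (hconv : IsFiberStrictlyConvex L) (hx : ContMDiff 𝓘(ℝ, ℝ) (𝓡 n) ∞ x)
    (hper : Function.Periodic x 1) (hT : 0 < T) :
    morseIndex univ (fun η => indexForm g h hL hx hper hT.ne' (η, 0) (η, 0)) ≠ ⊤ := by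
  choose δ hδ hpos using exists_integral_secondDensity_nonneg g h hL hconv hx hper hT
  obtain ⟨d, hd, hcov⟩ := lebesgue_number_lemma_of_metric (s := Icc (0 : ℝ) 1)
    (c := fun t₀ : ℝ => Ioo (t₀ - δ t₀) (t₀ + δ t₀)) isCompact_Icc (fun _ => isOpen_Ioo)
    fun t _ => mem_iUnion.2 ⟨t, by linarith [hδ t], by linarith [hδ t]⟩
  obtain ⟨m, hm⟩ := exists_nat_one_div_lt hd
  set N := m + 1 with hN
  have hNpos : (0 : ℝ) < N := by positivity
  have hNd : (1 : ℝ) / N < d := by rw [hN]; push_cast; exact hm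
  -- N is so large that each [k/N,(k+1)/N] lies in one of the good windows, by the Lebesgue number.
  -- Only vanishing at left endpoints is needed, which is why k < N suffices.
  have hmain : ∀ η : h1Submodule hx hper, (∀ k < N, (η.1 ((k : ℝ) / N) : 𝔼) = 0) →
      0 ≤ indexForm g h hL hx hper hT.ne' (η, 0) (η, 0) := by
    intro η hη
    rw [indexForm_apply]
    have h1 := intervalIntegral.sum_integral_adjacent_intervals (μ := volume)
      (f := fun t => secondDensity g L h x T (x t) η.1 0 η.1 0 t)
      (a := fun k : ℕ => (k : ℝ) / N) (n := N) fun k _ =>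
        intervalIntegrable_secondDensity g h hL hx hper hT.ne' η.2 η.2 0 0 _ _
    simp only [Nat.cast_zero, zero_div, div_self hNpos.ne'] at h1
    rw [← h1]
    refine Finset.sum_nonneg fun k hk => ?_
    have hkN : (k : ℝ) < N := by exact_mod_cast Finset.mem_range.1 hk
    have hk0 : (0 : ℝ) ≤ k := Nat.cast_nonneg k
    obtain ⟨t₀, ht₀⟩ := hcov ((k : ℝ) / N) ⟨by positivity, (div_le_one hNpos).2 hkN.le⟩
    have hle : (k : ℝ) / N ≤ ((k + 1 : ℕ) : ℝ) / N := by
      gcongr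
      simp
    refine hpos t₀ η.1 η.2 _ (Ioo_subset_Icc_self (ht₀ (Metric.mem_ball_self hd))) _
      (Ioo_subset_Icc_self (ht₀ ?_)) hle (hη k (Finset.mem_range.1 hk))
    rw [Metric.mem_ball, Real.dist_eq]
    have : ((k + 1 : ℕ) : ℝ) / N - (k : ℝ) / N = 1 / N := by push_cast; ring
    rw [this, abs_of_pos (by positivity)]
    exact hNd
  have hle : morseIndex univ (fun η => indexForm g h hL hx hper hT.ne' (η, 0) (η, 0)) ≤
      (Module.finrank ℝ (Fin N → 𝔼) : ℕ∞) := by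
    rw [morseIndex_le_iff]
    intro W _ _ hW
    -- A negative subspace contains no nonzero field vanishing at all nodes, so evaluation embeds it
    -- in `Fin N → 𝔼`.
    let ev : W →ₗ[ℝ] (Fin N → 𝔼) :=
      { toFun := fun η k => (η.1.1 ((k : ℝ) / N) : 𝔼)
        map_add' := fun _ _ => rfl
        map_smul' := fun _ _ => rfl }
    have hinj : Function.Injective ev := by
      rw [injective_iff_map_eq_zero]
      intro w hw
      by_contra hne
      have h1 := hW w.1 w.2 (fun h0 => hne (Subtype.ext h0))
      exact absurd (hmain w.1 fun k hk => congrFun hw ⟨k, hk⟩) (not_le.2 h1)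
    exact_mod_cast LinearMap.finrank_le_finrank_of_injective hinj
  exact ne_top_of_le_ne_top (ENat.natCast_ne_top _) hle

end FiniteIndex

/-! ### Euler-Lagrange equation and energy identity in charts. -/

section EulerLagrange

open Filter Topology

/-- Smooth periodic bump functions with arbitrarily small support modulo the period. -/
theorem exists_periodic_bump (t₀ : ℝ) {ε : ℝ} (hε : 0 < ε) :
    ∃ θ : ℝ → ℝ, ContDiff ℝ ∞ θ ∧ Function.Periodic θ 1 ∧ (∀ s, 0 ≤ θ s) ∧
      ∃ δ > 0, δ < 1 / 2 ∧ δ ≤ ε ∧ (∀ s ∈ Ioo (t₀ - δ) (t₀ + δ), 0 < θ s) ∧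
      (∀ s, |s - t₀| ≤ 1 / 2 → δ ≤ |s - t₀| → θ s = 0) ∧
      (∀ s, (∃ k : ℤ, |s - k - t₀| ≤ δ) ∨ ∀ᶠ r in 𝓝 s, θ r = 0) := by
  obtain ⟨δ, hδ, hδ2, hδε⟩ : ∃ δ > 0, δ < 1 / 2 ∧ δ ≤ ε :=
    ⟨min (1 / 4) ε, lt_min (by norm_num) hε, (min_le_left _ _).trans_lt (by norm_num),
      min_le_right _ _⟩
  have hπ := Real.pi_pos
  have hcos : ∀ u : ℝ, Real.cos (2 * Real.pi * u) = Real.cos (2 * Real.pi * |u|) := by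
    intro u
    rw [← Real.cos_abs (2 * Real.pi * u), abs_mul, abs_of_pos (by positivity : 0 < 2 * Real.pi)]
  have hanti : ∀ a b : ℝ, 0 ≤ a → a < b → b ≤ 1 / 2 →
      Real.cos (2 * Real.pi * b) < Real.cos (2 * Real.pi * a) := fun a b ha hab hb =>
    Real.cos_lt_cos_of_nonneg_of_le_pi (by positivity) (by nlinarith) (by nlinarith)
  have hint : ∀ (u : ℝ) (k : ℤ), Real.cos (2 * Real.pi * (u - k)) = Real.cos (2 * Real.pi * u) := by
    intro u k
    rw [mul_sub, mul_comm (2 * Real.pi) (k : ℝ), Real.cos_sub_int_mul_two_pi]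
  -- The cosine makes the function 1-periodic. Since it decreases with the distance to t₀ up to 1/2,
  -- the difference is positive exactly within δ of t₀ modulo 1.
  refine ⟨fun s => expNegInvGlue (Real.cos (2 * Real.pi * (s - t₀)) - Real.cos (2 * Real.pi * δ)),
    expNegInvGlue.contDiff.comp (by fun_prop), fun s => ?_, fun s => expNegInvGlue.nonneg _,
    δ, hδ, hδ2, hδε, fun s hs => ?_, fun s hs hs' => ?_, fun s => ?_⟩
  · have := hint (s + 1 - t₀) 1
    simp only [Int.cast_one] at this
    change expNegInvGlue (Real.cos (2 * Real.pi * (s + 1 - t₀)) - _) = _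
    rw [← this, show s + 1 - t₀ - 1 = s - t₀ by ring]
  · apply expNegInvGlue.pos_of_pos
    rw [hcos, sub_pos]
    have h1 : |s - t₀| < δ := abs_lt.2 ⟨by linarith [hs.1], by linarith [hs.2]⟩
    exact hanti _ _ (abs_nonneg _) h1 hδ2.le
  · apply expNegInvGlue.zero_of_nonpos
    rw [hcos, sub_nonpos]
    rcases hs'.eq_or_lt with h1 | h1
    · rw [h1]
    · exact (hanti _ _ hδ.le h1 hs).le
  · by_cases hk : ∃ k : ℤ, |s - k - t₀| ≤ δ
    · exact Or.inl hk
    right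
    have h1 : Real.cos (2 * Real.pi * (s - t₀)) - Real.cos (2 * Real.pi * δ) < 0 := by
      rw [sub_neg, ← hint _ (round (s - t₀)), hcos]
      refine hanti _ _ hδ.le ?_ (abs_sub_round _)
      by_contra hle
      apply hk
      refine ⟨round (s - t₀), ?_⟩
      rw [sub_right_comm]
      exact not_lt.1 hle
    have h2 : Continuous fun s : ℝ =>
      Real.cos (2 * Real.pi * (s - t₀)) - Real.cos (2 * Real.pi * δ) := by fun_prop
    filter_upwards [h2.continuousAt.eventually (eventually_lt_nhds h1)] with r hr
    exact expNegInvGlue.zero_of_nonpos hr.le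

theorem Function.Periodic.deriv {F : Type*} [NormedAddCommGroup F] [NormedSpace ℝ F] {f : ℝ → F}
    {c : ℝ} (hf : Function.Periodic f c) : Function.Periodic (deriv f) c := by
  intro t
  rw [← deriv_comp_add_const]
  congr 1
  exact funext hf

variable {n : ℕ} {M : Type*} [TopologicalSpace M] [ChartedSpace (EuclideanSpace ℝ (Fin n)) M]
  [IsManifold (𝓡 n) ∞ M] {x : ℝ → M}

local notation "𝔼" => EuclideanSpace ℝ (Fin n)

omit [IsManifold (𝓡 n) ∞ M] in
theorem loopPoint_periodic (hper : Function.Periodic x 1) (T : ℝ) (p : M) :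
    Function.Periodic (loopPoint (n := n) x T p) 1 := by
  have h1 : Function.Periodic (fun s => extChartAt (𝓡 n) p (x s)) 1 := hper.comp _
  intro t
  unfold loopPoint
  rw [h1.deriv t, hper t]

theorem fieldCoord_periodic (hper : Function.Periodic x 1) {ξ : ∀ t, TangentSpace (𝓡 n) (x t)}
    (hξ : Function.Periodic (fun t => (ξ t : 𝔼)) 1) (p : M) :
    Function.Periodic (fieldCoord x ξ p) 1 := by
  intro t
  have h1 : ∀ (q q' : M) (v v' : 𝔼), q = q' → v = v' →
    tangentCoordChange (𝓡 n) q p q v = tangentCoordChange (𝓡 n) q' p q' v' := by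
    rintro q _ v _ rfl rfl
    rfl
  exact h1 _ _ _ _ (hper t) (hξ t)

theorem fieldJet_periodic (hper : Function.Periodic x 1) {ξ : ∀ t, TangentSpace (𝓡 n) (x t)}
    (hξ : Function.Periodic (fun t => (ξ t : 𝔼)) 1) (b : ℝ) (p : M) :
    Function.Periodic (fieldJet x ξ b p) 1 := by
  intro t
  unfold fieldJet
  rw [(fieldCoord_periodic hper hξ p).deriv t, fieldCoord_periodic hper hξ p t]

theorem firstDensity_periodic (L : TangentBundle (𝓡 n) M → ℝ) (h : ℝ) (T : ℝ)
    (hper : Function.Periodic x 1) {ξ : ∀ t, TangentSpace (𝓡 n) (x t)}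
    (hξ : Function.Periodic (fun t => (ξ t : 𝔼)) 1) (b : ℝ) :
    Function.Periodic (fun t => firstDensity L h x T (x t) ξ b t) 1 := by
  intro t
  simp only [firstDensity]
  rw [hper t, loopPoint_periodic hper T _ t, fieldJet_periodic hper hξ b _ t]

variable (g : SmoothMetric n M) {L : TangentBundle (𝓡 n) M → ℝ} {h : ℝ} {T : ℝ}

theorem firstVariation_eq (hL : ContMDiff (𝓡 n).tangent 𝓘(ℝ, ℝ) ∞ L)
    (hx : ContMDiff 𝓘(ℝ, ℝ) (𝓡 n) ∞ x) (hT : T ≠ 0)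
    {ξ : ∀ t, TangentSpace (𝓡 n) (x t)} (b : ℝ)
    (hξ : ∀ t, DifferentiableAt ℝ (fieldCoord x ξ (x t)) t) :
    firstVariation g L h x T ξ b = ∫ t in (0 : ℝ)..1, firstDensity L h x T (x t) ξ b t :=
  intervalIntegral.integral_congr fun t _ => deriv_actionDensity g hL h hx hT b (hξ t)

theorem contDiffAt_fderiv_loopPoint (hL : ContMDiff (𝓡 n).tangent 𝓘(ℝ, ℝ) ∞ L)
    (hx : ContMDiff 𝓘(ℝ, ℝ) (𝓡 n) ∞ x) (hT : T ≠ 0) {p : M} {t : ℝ}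
    (hp : x t ∈ (extChartAt (𝓡 n) p).source) :
    ContDiffAt ℝ ∞ (fun s => fderiv ℝ (actionCoord L h p) (loopPoint x T p s)) t :=
  ContDiffAt.comp (f := loopPoint x T p) t ((contDiffAt_actionCoord hL h
    (loopPoint_mem_target T hp) hT).fderiv_right (m := ∞) (by simp)) (contDiffAt_loopPoint hx T hp)

/-- The Euler-Lagrange equation, in any chart. -/
theorem hasDerivAt_fderiv_velocity (hL : ContMDiff (𝓡 n).tangent 𝓘(ℝ, ℝ) ∞ L)
    (hx : ContMDiff 𝓘(ℝ, ℝ) (𝓡 n) ∞ x) (hper : Function.Periodic x 1) (hT : T ≠ 0)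
    (hcrit : ∀ ξ ∈ H1Fields x, ∀ b, firstVariation g L h x T ξ b = 0) {p : M} {t₀ : ℝ}
    (hp : x t₀ ∈ (extChartAt (𝓡 n) p).source) (v : 𝔼) :
    HasDerivAt (fun s => fderiv ℝ (actionCoord L h p) (loopPoint x T p s) (0, v, 0))
      (fderiv ℝ (actionCoord L h p) (loopPoint x T p t₀) (v, 0, 0)) t₀ := by
  set K := fun s => fderiv ℝ (actionCoord L h p) (loopPoint x T p s) with hK
  have hKs : ∀ s, x s ∈ (extChartAt (𝓡 n) p).source → ContDiffAt ℝ ∞ K s := fun s hs =>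
    contDiffAt_fderiv_loopPoint hL hx hT hs
  set Pv := fun s => K s (0, v, 0) with hPv
  set Qv := fun s => K s (v, 0, 0) with hQv
  have hPs : ∀ s, x s ∈ (extChartAt (𝓡 n) p).source → ContDiffAt ℝ ∞ Pv s := fun s hs =>
    (hKs s hs).clm_apply contDiffAt_const
  have hQs : ∀ s, x s ∈ (extChartAt (𝓡 n) p).source → ContDiffAt ℝ ∞ Qv s := fun s hs =>
    (hKs s hs).clm_apply contDiffAt_const
  -- μ is the Euler-Lagrange defect in the direction v. If it were nonzero at t₀, a bump variation
  -- supported where μ keeps its sign would contradict criticality; working with μ(t₀)μ(s) avoids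
  -- splitting by sign.
  set μ := fun s => deriv Pv s - Qv s with hμ
  have hμc : ∀ s, x s ∈ (extChartAt (𝓡 n) p).source → ContinuousAt μ s := fun s hs =>
    (continuousAt_deriv_of_contDiffAt ((hPs s hs).of_le (by simp))).sub (hQs s hs).continuousAt
  have hPd := ((hPs t₀ hp).differentiableAt (by simp)).hasDerivAt
  suffices hzero : μ t₀ = 0 by
    rw [hμ] at hzero
    rwa [sub_eq_zero.1 hzero] at hPd
  by_contra hne
  have hev : ∀ᶠ s in 𝓝 t₀, 0 < μ t₀ * μ s :=
    (continuousAt_const.mul (hμc t₀ hp)).eventually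
      (eventually_gt_nhds (mul_self_pos.2 hne))
  obtain ⟨ε, hε, hball⟩ := Metric.eventually_nhds_iff_ball.1
    (hev.and (eventually_mem_source hx.continuous hp))
  obtain ⟨θ, hθ, hθper, hθ0, δ, hδ, hδ2, hδε, hθpos, hθzero, hθdich⟩ :=
    exists_periodic_bump t₀ (half_pos hε)
  have hmem : ∀ s, |s - t₀| ≤ δ → 0 < μ t₀ * μ s ∧ x s ∈ (extChartAt (𝓡 n) p).source := by
    intro s hs
    apply hball
    rw [Metric.mem_ball, Real.dist_eq]
    linarith
  -- The support of θ is periodic, so a point of it may differ from the neighbourhood of t₀ by an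
  -- integer; periodicity of the loop brings it back into the chart.
  have hdich : ∀ s, x s ∈ (extChartAt (𝓡 n) p).source ∨ ∀ᶠ r in 𝓝 s, θ r = 0 := by
    intro s
    refine (hθdich s).imp_left ?_
    rintro ⟨k, hk⟩
    have h1 := (hmem _ hk).2
    rwa [show s - (k : ℝ) = s - k • (1 : ℝ) by simp, hper.sub_zsmul_eq k] at h1
  -- The vector is meaningful only over the chart around `p`; outside it θ vanishes identically near
  -- the point, so the field is smooth everywhere.
  let ξ : ∀ t, TangentSpace (𝓡 n) (x t) := fun s => θ s • vecOfCoord p (x s) v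
  have hξper : Function.Periodic (fun t => (ξ t : 𝔼)) 1 := by
    intro s
    have h1 : (vecOfCoord p (x (s + 1)) v : 𝔼) = vecOfCoord p (x s) v :=
      congrArg (fun q => (vecOfCoord p q v : 𝔼)) (hper s)
    exact congrArg₂ (fun (a : ℝ) (b : 𝔼) => a • b) (hθper s) h1
  have hcoord : ∀ s, x s ∈ (extChartAt (𝓡 n) p).source → fieldCoord x ξ p s = θ s • v := by
    intro s hs
    refine fieldCoord_of_eq_vecOfCoord hs ?_
    simp only [ξ, vecOfCoord, map_smul]
  have hcoordev : ∀ s, x s ∈ (extChartAt (𝓡 n) p).source →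
      fieldCoord x ξ p =ᶠ[𝓝 s] fun r => θ r • v := fun s hs => by
    filter_upwards [eventually_mem_source hx.continuous hs] with r hr using hcoord r hr
  have hcoordC : ∀ s, x s ∈ (extChartAt (𝓡 n) p).source →
      ContDiffAt ℝ ∞ (fieldCoord x ξ p) s := fun s hs =>
    (hθ.contDiffAt.smul_const' v).congr_of_eventuallyEq (hcoordev s hs)
  have hzerocoord : ∀ s, (∀ᶠ r in 𝓝 s, θ r = 0) → ∀ p', fieldCoord x ξ p' =ᶠ[𝓝 s] fun _ => 0 := by
    intro s hs p'
    filter_upwards [hs] with r hr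
    have h1 : (ξ r : 𝔼) = 0 := by
      change θ r • (vecOfCoord p (x r) v : 𝔼) = 0
      rw [hr, zero_smul]
    exact (congrArg (tangentCoordChange (𝓡 n) (x r) p' (x r)) h1).trans (map_zero _)
  have hC : ∀ s, ContDiffAt ℝ ∞ (fieldCoord x ξ (x s)) s := by
    intro s
    rcases hdich s with hs | hs
    · have hs' := mem_extChartAt_source (I := 𝓡 n) (x s)
      have h1 := ((contDiffAt_chartTransition hs hs').fderiv_right (m := ∞) (by simp)).comp s
        (contDiffAt_loopCoord hx hs)
      exact (h1.clm_apply (hcoordC s hs)).congr_of_eventuallyEq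
        (fieldCoord_eventuallyEq hx.continuous ξ hs hs')
    · exact contDiffAt_const.congr_of_eventuallyEq (hzerocoord s hs _)
  have hξ : ξ ∈ H1Fields x :=
    mem_H1Fields_of_contDiffAt hx hper hξper fun s => (hC s).of_le (by simp)
  have hvar := hcrit ξ hξ 0
  rw [firstVariation_eq g hL hx hT 0 fun s => (hC s).differentiableAt (by simp)] at hvar
  set D := fun s => firstDensity L h x T (x s) ξ 0 s with hD
  have hD1 : ∀ s, x s ∈ (extChartAt (𝓡 n) p).source → D s = deriv θ s * Pv s + θ s * Qv s := by
    intro s hs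
    have h1 : D s = firstDensity L h x T p ξ 0 s := firstDensity_trans hL h hx hT 0
      (mem_extChartAt_source (x s)) hs ((hC s).differentiableAt (by simp))
    have hθd := (hθ.contDiffAt.differentiableAt (x := s) (by simp)).hasDerivAt
    have h2 : fieldJet x ξ 0 p s =
        deriv θ s • ((0, v, 0) : 𝔼 × 𝔼 × ℝ) + θ s • ((v, 0, 0) : 𝔼 × 𝔼 × ℝ) := by
      rw [fieldJet, hcoord s hs, ((hθd.smul_const v).congr_of_eventuallyEq (hcoordev s hs)).deriv]
      simp
    rw [h1, firstDensity, h2, map_add, map_smul, map_smul, smul_eq_mul, smul_eq_mul]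
  -- D involves θ' as well as θ; at a zero of the nonnegative function θ its derivative also
  -- vanishes.
  have hD0 : ∀ s, θ s = 0 → D s = 0 := by
    intro s hs
    rcases hdich s with h1 | h1
    · have h2 : IsLocalMin θ s := Eventually.of_forall fun r => hs ▸ hθ0 r
      rw [hD1 s h1, h2.deriv_eq_zero, hs]
      ring
    · have h2 := hzerocoord s h1 (x s)
      have h3 : fieldJet x ξ 0 (x s) s = 0 := by
        rw [fieldJet, h2.deriv_eq, h2.eq_of_nhds]
        simp
      change fderiv ℝ _ _ (fieldJet x ξ 0 (x s) s) = 0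
      rw [h3, map_zero]
  have hmemI : ∀ s ∈ Icc (t₀ - δ) (t₀ + δ), |s - t₀| ≤ δ := fun s hs =>
    abs_le.2 ⟨by linarith [hs.1], by linarith [hs.2]⟩
  have hle : t₀ - δ ≤ t₀ + δ := by linarith
  have i0 : ∀ a b, (∀ s ∈ uIcc a b, θ s = 0) → IntervalIntegrable D volume a b ∧
      ∫ s in a..b, D s = 0 := by
    intro a b hab
    have h1 : EqOn D (fun _ => 0) (uIcc a b) := fun s hs => hD0 s (hab s hs)
    refine ⟨(intervalIntegrable_const (c := (0 : ℝ))).congr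
      (fun s hs => (h1 (uIoc_subset_uIcc hs)).symm), ?_⟩
    rw [intervalIntegral.integral_congr h1, intervalIntegral.integral_zero]
  obtain ⟨i1, i1'⟩ := i0 (t₀ - 1 / 2) (t₀ - δ) fun s hs => by
    rw [uIcc_of_le (by linarith)] at hs
    rw [mem_Icc] at hs
    exact hθzero s (abs_le.2 ⟨by linarith, by linarith⟩)
      ((by linarith : δ ≤ -(s - t₀)).trans (neg_le_abs _))
  obtain ⟨i3, i3'⟩ := i0 (t₀ + δ) (t₀ + 1 / 2) fun s hs => by
    rw [uIcc_of_le (by linarith)] at hs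
    rw [mem_Icc] at hs
    exact hθzero s (abs_le.2 ⟨by linarith, by linarith⟩)
      ((by linarith : δ ≤ s - t₀).trans (le_abs_self _))
  have cθ' : Continuous (deriv θ) := hθ.continuous_deriv (by simp)
  have cP : ContinuousOn Pv (Icc (t₀ - δ) (t₀ + δ)) := fun s hs =>
    (hPs s (hmem s (hmemI s hs)).2).continuousAt.continuousWithinAt
  have cQ : ContinuousOn Qv (Icc (t₀ - δ) (t₀ + δ)) := fun s hs =>
    (hQs s (hmem s (hmemI s hs)).2).continuousAt.continuousWithinAt
  have cμ : ContinuousOn μ (Icc (t₀ - δ) (t₀ + δ)) := fun s hs =>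
    (hμc s (hmem s (hmemI s hs)).2).continuousWithinAt
  have hDI : EqOn D (fun s => deriv θ s * Pv s + θ s * Qv s) (uIcc (t₀ - δ) (t₀ + δ)) := by
    intro s hs
    rw [uIcc_of_le hle] at hs
    exact hD1 s (hmem s (hmemI s hs)).2
  have i2 : IntervalIntegrable D volume (t₀ - δ) (t₀ + δ) := by
    refine ContinuousOn.intervalIntegrable (ContinuousOn.congr ?_ hDI)
    rw [uIcc_of_le hle]
    exact (cθ'.continuousOn.mul cP).add (hθ.continuous.continuousOn.mul cQ)
  -- By periodicity the unit interval may be recentred at t₀, and then cut down to the support of θ.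
  have hsum : ∫ s in (t₀ - δ)..(t₀ + δ), D s = 0 := by
    have h1 := (firstDensity_periodic L h T hper hξper 0).intervalIntegral_add_eq 0 (t₀ - 1 / 2)
    rw [zero_add, show t₀ - 1 / 2 + 1 = t₀ + 1 / 2 by ring] at h1
    have h2 : ∫ s in (t₀ - 1 / 2)..(t₀ + 1 / 2), D s = 0 := h1.symm.trans hvar
    rw [← intervalIntegral.integral_add_adjacent_intervals (i1.trans i2) i3,
      ← intervalIntegral.integral_add_adjacent_intervals i1 i2, i1', i3'] at h2
    simpa using h2
  -- Integration by parts: D + θμ is the derivative of θPv, which vanishes at both ends.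
  have hparts : ∫ s in (t₀ - δ)..(t₀ + δ), (D s + θ s * μ s) = 0 := by
    have h1 : ∀ s ∈ uIcc (t₀ - δ) (t₀ + δ),
        HasDerivAt (fun s => θ s * Pv s) (D s + θ s * μ s) s := by
      intro s hs
      have hs' := hs
      rw [uIcc_of_le hle] at hs'
      have h2 := (hθ.contDiffAt.differentiableAt (x := s) (by simp)).hasDerivAt.mul
        ((hPs s (hmem s (hmemI s hs')).2).differentiableAt (by simp)).hasDerivAt
      have h4 : D s + θ s * μ s = deriv θ s * Pv s + θ s * deriv Pv s := by
        rw [hDI hs]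
        simp only [hμ]
        ring
      rw [h4]
      exact h2
    have h3 : IntervalIntegrable (fun s => D s + θ s * μ s) volume (t₀ - δ) (t₀ + δ) := by
      refine i2.add (ContinuousOn.intervalIntegrable ?_)
      rw [uIcc_of_le hle]
      exact hθ.continuous.continuousOn.mul cμ
    rw [intervalIntegral.integral_eq_sub_of_hasDerivAt h1 h3]
    have e1 : θ (t₀ + δ) = 0 := hθzero _ (by rw [add_sub_cancel_left, abs_of_pos hδ]; exact hδ2.le)
      (by rw [add_sub_cancel_left, abs_of_pos hδ])
    have e2 : θ (t₀ - δ) = 0 := hθzero _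
      (by rw [sub_sub_cancel_left, abs_neg, abs_of_pos hδ]; exact hδ2.le)
      (by rw [sub_sub_cancel_left, abs_neg, abs_of_pos hδ])
    rw [e1, e2]
    ring
  have iμ : IntervalIntegrable (fun s => θ s * μ s) volume (t₀ - δ) (t₀ + δ) := by
    refine ContinuousOn.intervalIntegrable ?_
    rw [uIcc_of_le hle]
    exact hθ.continuous.continuousOn.mul cμ
  rw [intervalIntegral.integral_add i2 iμ, hsum, zero_add] at hparts
  have hpos : 0 < ∫ s in (t₀ - δ)..(t₀ + δ), μ t₀ * (θ s * μ s) := by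
    refine intervalIntegral.intervalIntegral_pos_of_pos_on (iμ.const_mul _) (fun s hs => ?_)
      (by linarith)
    have h1 := (hmem s (hmemI s (Ioo_subset_Icc_self hs))).1
    rw [mul_left_comm]
    exact mul_pos (hθpos s hs) h1
  rw [intervalIntegral.integral_const_mul, hparts, mul_zero] at hpos
  exact lt_irrefl _ hpos

theorem actionCoord_smul (L : TangentBundle (𝓡 n) M → ℝ) (h : ℝ) (p : M) (q v : 𝔼) (τ : ℝ) {r : ℝ}
    (hr : r ≠ 0) : actionCoord L h p (q, r • v, r * τ) = r * actionCoord L h p (q, v, τ) := by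
  simp only [actionCoord]
  rw [smul_smul, show (r * τ)⁻¹ * r = τ⁻¹ by
    rw [mul_inv, mul_right_comm, inv_mul_cancel₀ hr, one_mul], mul_assoc]

/-- Euler's identity for the homogeneity of the action in the velocity and the period. -/
theorem fderiv_actionCoord_euler {p : M} {y : 𝔼 × 𝔼 × ℝ}
    (hG : DifferentiableAt ℝ (actionCoord L h p) y) :
    fderiv ℝ (actionCoord L h p) y (0, y.2.1, y.2.2) = actionCoord L h p y := by
  have h1 := hG.hasDerivAt_line (0, y.2.1, y.2.2)
  have h2 : HasDerivAt (fun s : ℝ => (1 + s) * actionCoord L h p y) (1 * actionCoord L h p y) 0 :=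
    ((hasDerivAt_id (0 : ℝ)).const_add 1).mul_const _
  rw [one_mul] at h2
  refine h1.unique (h2.congr_of_eventuallyEq ?_)
  have hne : ∀ᶠ s : ℝ in 𝓝 0, (1 + s : ℝ) ≠ 0 :=
    (by fun_prop : ContinuousAt (fun s : ℝ => 1 + s) 0).eventually_ne (by norm_num)
  filter_upwards [hne] with s hs
  rw [← actionCoord_smul L h p y.1 y.2.1 y.2.2 hs]
  congr 1
  refine Prod.ext ?_ (Prod.ext ?_ ?_)
  · simp
  · simp [add_smul]
  · simp [add_mul]

theorem HasDerivAt.clm_apply_const {V F : Type*} [NormedAddCommGroup V] [NormedSpace ℝ V]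
    [NormedAddCommGroup F] [NormedSpace ℝ F] {A : ℝ → V →L[ℝ] F} {A' : V →L[ℝ] F} {t : ℝ}
    (hA : HasDerivAt A A' t) (v : V) : HasDerivAt (fun s => A s v) (A' v) t := by
  simpa using hA.clm_apply (hasDerivAt_const t v)

/-- The Euler-Lagrange equation paired with a differentiable vector. -/
theorem hasDerivAt_fderiv_velocity_apply (hL : ContMDiff (𝓡 n).tangent 𝓘(ℝ, ℝ) ∞ L)
    (hx : ContMDiff 𝓘(ℝ, ℝ) (𝓡 n) ∞ x) (hper : Function.Periodic x 1) (hT : T ≠ 0)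
    (hcrit : ∀ ξ ∈ H1Fields x, ∀ b, firstVariation g L h x T ξ b = 0) {p : M} {t₀ : ℝ}
    (hp : x t₀ ∈ (extChartAt (𝓡 n) p).source) {u : ℝ → 𝔼} {u' : 𝔼} (hu : HasDerivAt u u' t₀) :
    HasDerivAt (fun s => fderiv ℝ (actionCoord L h p) (loopPoint x T p s) (0, u s, 0))
      (fderiv ℝ (actionCoord L h p) (loopPoint x T p t₀) (u t₀, u', 0)) t₀ := by
  have hK := ((contDiffAt_fderiv_loopPoint (h := h) hL hx hT hp).differentiableAt
    (by simp)).hasDerivAt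
  -- With the vector frozen at its value at t₀, the Euler-Lagrange equation evaluates the derivative
  -- of the covector; the motion of `u` adds the u' term.
  have h1 := (hK.clm_apply_const (0, u t₀, 0)).unique
    (hasDerivAt_fderiv_velocity g hL hx hper hT hcrit hp (u t₀))
  have h2 : HasDerivAt (fun s => ((0, u s, 0) : 𝔼 × 𝔼 × ℝ)) (0, u', 0) t₀ :=
    (hasDerivAt_const t₀ 0).prodMk (hu.prodMk (hasDerivAt_const t₀ 0))
  have h3 := hK.clm_apply h2
  rw [h1, ← map_add] at h3
  simpa using h3

theorem hasDerivAt_loopPoint (hx : ContMDiff 𝓘(ℝ, ℝ) (𝓡 n) ∞ x) (T : ℝ) {p : M} {t : ℝ}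
    (hp : x t ∈ (extChartAt (𝓡 n) p).source) :
    ∃ a : 𝔼, HasDerivAt (fun s => (loopPoint (n := n) x T p s).2.1) a t ∧
      HasDerivAt (loopPoint (n := n) x T p) ((loopPoint (n := n) x T p t).2.1, a, 0) t := by
  have h1 := ((contDiffAt_loopPoint hx T hp).differentiableAt (by simp)).hasDerivAt
  have h2 := ((contDiffAt_loopCoord hx hp).differentiableAt (by simp)).hasDerivAt
  have h3 : HasDerivAt (fun s => (loopPoint (n := n) x T p s).2.1)
      (deriv (loopPoint (n := n) x T p) t).2.1 t := h1.snd.fst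
  exact ⟨_, h3, h2.prodMk (h3.prodMk (hasDerivAt_const t T))⟩

/-- The energy identity, in any chart. -/
theorem fderiv_period_eq_zero (hL : ContMDiff (𝓡 n).tangent 𝓘(ℝ, ℝ) ∞ L)
    (hx : ContMDiff 𝓘(ℝ, ℝ) (𝓡 n) ∞ x) (hper : Function.Periodic x 1) (hT : T ≠ 0)
    (hcrit : ∀ ξ ∈ H1Fields x, ∀ b, firstVariation g L h x T ξ b = 0) {p : M} {t : ℝ}
    (hp : x t ∈ (extChartAt (𝓡 n) p).source) :
    fderiv ℝ (actionCoord L h p) (loopPoint x T p t) (0, 0, 1) = 0 := by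
  have hcoord : ∀ q : M, fieldCoord x (0 : ∀ t, TangentSpace (𝓡 n) (x t)) q = fun _ => 0 :=
    fun q => funext fun s => fieldCoord_zero q s
  have hjet : ∀ q s, fieldJet x (0 : ∀ t, TangentSpace (𝓡 n) (x t)) 1 q s = (0, 0, 1) := by
    intro q s
    simp [fieldJet, hcoord]
  have hd : ∀ q s, DifferentiableAt ℝ (fieldCoord x (0 : ∀ t, TangentSpace (𝓡 n) (x t)) q) s :=
    fun q s => by rw [hcoord]; exact differentiableAt_const _
  let D : ℝ → ℝ := fun s => firstDensity L h x T (x s) 0 1 s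
  have hD : ∀ q s, x s ∈ (extChartAt (𝓡 n) q).source →
      D s = fderiv ℝ (actionCoord L h q) (loopPoint x T q s) (0, 0, 1) := by
    intro q s hs
    rw [← hjet q s]
    exact firstDensity_trans hL h hx hT 1 (mem_extChartAt_source (x s)) hs (hd _ _)
  -- By Euler's identity T·D = G - ∂_vG(v). Along the loop dG/dt = DG(x',x'',0), which the
  -- Euler-Lagrange equation says is also the derivative of ∂_vG(v). So D is constant, and
  -- criticality under changes of the period makes its mean zero.
  have hder : ∀ s, HasDerivAt D 0 s := by
    intro s
    have hs := mem_extChartAt_source (I := 𝓡 n) (x s)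
    set q := x s
    obtain ⟨a, ha, hc⟩ := hasDerivAt_loopPoint hx T hs
    have hG := (contDiffAt_actionCoord hL h (loopPoint_mem_target T hs) hT).differentiableAt
      (by simp)
    have h1 := hG.hasFDerivAt.comp_hasDerivAt s hc
    have h2 := hasDerivAt_fderiv_velocity_apply g hL hx hper hT hcrit hs ha
    have h3 := (h1.fun_sub h2).const_mul T⁻¹
    rw [sub_self, mul_zero] at h3
    refine h3.congr_of_eventuallyEq ?_
    filter_upwards [eventually_mem_source hx.continuous hs] with r hr
    have hGr := (contDiffAt_actionCoord hL h (loopPoint_mem_target T hr) hT).differentiableAt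
      (by simp)
    have h4 := fderiv_actionCoord_euler hGr
    have e1 : ((0, (loopPoint (n := n) x T q r).2.1, (loopPoint (n := n) x T q r).2.2) :
        𝔼 × 𝔼 × ℝ) = (0, (loopPoint (n := n) x T q r).2.1, 0) + T • (0, 0, 1) := by
      simp [loopPoint]
    rw [e1, map_add, map_smul, smul_eq_mul] at h4
    rw [hD q r hr, Function.comp_apply, ← h4, add_sub_cancel_left, inv_mul_cancel_left₀ hT]
  have hconst : ∀ s, D s = D t := fun s =>
    is_const_of_deriv_eq_zero (fun r => (hder r).differentiableAt) (fun r => (hder r).deriv) s t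
  have h0 : (0 : ∀ t, TangentSpace (𝓡 n) (x t)) ∈ H1Fields x := (h1Submodule hx hper).zero_mem
  have hvar := hcrit 0 h0 1
  rw [firstVariation_eq g hL hx hT 1 fun s => hd _ s,
    intervalIntegral.integral_congr (fun s _ => hconst s)] at hvar
  rw [← hD p t hp]
  simpa using hvar

end EulerLagrange

/-! ### Linearization along the orbit cylinder. -/

section OrbitCylinder

open Filter Topology

section MixedPartials

variable {F : Type*} [NormedAddCommGroup F] [NormedSpace ℝ F] {f : ℝ × ℝ → F} {e t : ℝ}

theorem DifferentiableAt.hasDerivAt_fst (hf : DifferentiableAt ℝ f (e, t)) :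
    HasDerivAt (fun e => f (e, t)) (fderiv ℝ f (e, t) (1, 0)) e :=
  hf.hasFDerivAt.comp_hasDerivAt (f := fun e => (e, t)) e
    ((hasDerivAt_id e).prodMk (hasDerivAt_const e t))

theorem DifferentiableAt.hasDerivAt_snd (hf : DifferentiableAt ℝ f (e, t)) :
    HasDerivAt (fun t => f (e, t)) (fderiv ℝ f (e, t) (0, 1)) t :=
  hf.hasFDerivAt.comp_hasDerivAt (f := fun t => (e, t)) t
    ((hasDerivAt_const t e).prodMk (hasDerivAt_id t))

theorem Filter.Eventually.prodMk_left {P : ℝ × ℝ → Prop} (hP : ∀ᶠ z in 𝓝 (e, t), P z) :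
    ∀ᶠ e' in 𝓝 e, P (e', t) :=
  (by fun_prop : ContinuousAt (fun e' : ℝ => (e', t)) e).eventually hP

theorem Filter.Eventually.prodMk_right {P : ℝ × ℝ → Prop} (hP : ∀ᶠ z in 𝓝 (e, t), P z) :
    ∀ᶠ t' in 𝓝 t, P (e, t') :=
  (by fun_prop : ContinuousAt (fun t' : ℝ => (e, t')) t).eventually hP

/-- Equality of the mixed partial derivatives. -/
theorem ContDiffAt.hasDerivAt_deriv_swap (hf : ContDiffAt ℝ 2 f (e, t)) {g : ℝ → F} {g' : F}
    (hg : ∀ᶠ e' in 𝓝 e, HasDerivAt (fun t => f (e', t)) (g e') t) (hg' : HasDerivAt g g' e) :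
    HasDerivAt (fun t => deriv (fun e => f (e, t)) e) g' t := by
  have hd : ∀ᶠ z in 𝓝 (e, t), DifferentiableAt ℝ f z := by
    filter_upwards [eventually_contDiffAt (n := 2) hf] with z hz
    exact hz.differentiableAt (by norm_num)
  have h1 : HasDerivAt (fun e' => fderiv ℝ f (e', t) (0, 1))
      (fderiv ℝ (fderiv ℝ f) (e, t) (1, 0) (0, 1)) e :=
    (hf.differentiableAt_fderiv.hasDerivAt_fst).clm_apply_const _
  have h2 : HasDerivAt (fun t' => fderiv ℝ f (e, t') (1, 0))
      (fderiv ℝ (fderiv ℝ f) (e, t) (0, 1) (1, 0)) t :=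
    (hf.differentiableAt_fderiv.hasDerivAt_snd).clm_apply_const _
  have h3 : g' = fderiv ℝ (fderiv ℝ f) (e, t) (1, 0) (0, 1) := by
    refine hg'.unique (h1.congr_of_eventuallyEq ?_)
    filter_upwards [hg, hd.prodMk_left] with e' he' he''
    exact he'.unique he''.hasDerivAt_snd
  rw [h3, hf.fderiv_fderiv_comm]
  refine h2.congr_of_eventuallyEq ?_
  filter_upwards [hd.prodMk_right] with t' ht'
  exact ht'.hasDerivAt_fst.deriv

end MixedPartials

variable {n : ℕ} {M : Type*} [TopologicalSpace M] [ChartedSpace (EuclideanSpace ℝ (Fin n)) M]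
  [IsManifold (𝓡 n) ∞ M]

local notation "𝔼" => EuclideanSpace ℝ (Fin n)

/-- The derivative of a family of loops with respect to the parameter. -/
def familyField (X : ℝ → ℝ → M) (h : ℝ) : ∀ t, TangentSpace (𝓡 n) (X h t) :=
  fun t => (deriv (fun e => extChartAt (𝓡 n) (X h t) (X e t)) h : EuclideanSpace ℝ (Fin n))

theorem actionCoord_energy (L : TangentBundle (𝓡 n) M → ℝ) (h e : ℝ) (p : M) :
    actionCoord L e p = fun y => actionCoord L h p y + (e - h) * y.2.2 := by
  ext y
  simp only [actionCoord]
  ring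

/-- The energy enters the density only as (e - h)τ, so it affects derivatives in the period
direction only. -/
theorem fderiv_actionCoord_energy {L : TangentBundle (𝓡 n) M → ℝ} {h : ℝ} (e : ℝ) {p : M}
    {y : 𝔼 × 𝔼 × ℝ} (hG : DifferentiableAt ℝ (actionCoord L h p) y) (z : 𝔼 × 𝔼 × ℝ) :
    fderiv ℝ (actionCoord L e p) y z = fderiv ℝ (actionCoord L h p) y z + (e - h) * z.2.2 := by
  have h1 : HasFDerivAt (fun y : 𝔼 × 𝔼 × ℝ => y.2.2)
      ((ContinuousLinearMap.snd ℝ 𝔼 ℝ).comp (ContinuousLinearMap.snd ℝ 𝔼 (𝔼 × ℝ))) y :=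
    ((ContinuousLinearMap.snd ℝ 𝔼 ℝ).comp (ContinuousLinearMap.snd ℝ 𝔼 (𝔼 × ℝ))).hasFDerivAt
  rw [actionCoord_energy L h e p, (hG.hasFDerivAt.fun_add (h1.const_mul (e - h))).fderiv]
  rfl

namespace IsOrbitCylinder

variable {g : SmoothMetric n M} {L : TangentBundle (𝓡 n) M → ℝ} {h : ℝ} {x : ℝ → M} {T ε : ℝ}
  {X : ℝ → ℝ → M} {P : ℝ → ℝ}

section

variable (hcyl : IsOrbitCylinder g L h x T ε X P)
include hcyl

theorem center_mem : h ∈ Ioo (h - ε) (h + ε) := ⟨by linarith [hcyl.pos], by linarith [hcyl.pos]⟩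

theorem eventually_mem : ∀ᶠ e in 𝓝 h, e ∈ Ioo (h - ε) (h + ε) :=
  Ioo_mem_nhds hcyl.center_mem.1 hcyl.center_mem.2

theorem contMDiffAt {e : ℝ} (he : e ∈ Ioo (h - ε) (h + ε)) (t : ℝ) :
    ContMDiffAt 𝓘(ℝ, ℝ × ℝ) (𝓡 n) ∞ (fun z : ℝ × ℝ => X z.1 z.2) (e, t) :=
  hcyl.smooth_loops.contMDiffAt ((isOpen_Ioo.prod isOpen_univ).mem_nhds ⟨he, mem_univ _⟩)

theorem contMDiff {e : ℝ} (he : e ∈ Ioo (h - ε) (h + ε)) : ContMDiff 𝓘(ℝ, ℝ) (𝓡 n) ∞ (X e) := by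
  intro t
  exact ContMDiffAt.comp (g := fun z : ℝ × ℝ => X z.1 z.2) (f := fun t => (e, t)) t
    (hcyl.contMDiffAt he t) (contDiffAt_const.prodMk contDiffAt_id).contMDiffAt

theorem periodic {e : ℝ} (he : e ∈ Ioo (h - ε) (h + ε)) : Function.Periodic (X e) 1 :=
  (hcyl.critical e he).1.1

theorem period_pos {e : ℝ} (he : e ∈ Ioo (h - ε) (h + ε)) : 0 < P e := (hcyl.critical e he).2.1

theorem contDiffAt_period : ContDiffAt ℝ ∞ P h :=
  hcyl.smooth_period.contDiffAt hcyl.eventually_mem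

theorem contDiffAt_coord {p : M} {t : ℝ} (hp : X h t ∈ (extChartAt (𝓡 n) p).source) :
    ContDiffAt ℝ ∞ (fun z : ℝ × ℝ => extChartAt (𝓡 n) p (X z.1 z.2)) (h, t) := by
  rw [extChartAt_source] at hp
  exact ((contMDiffAt_extChartAt' hp).comp (h, t) (hcyl.contMDiffAt hcyl.center_mem t)).contDiffAt

theorem eventually_mem_source {p : M} {t : ℝ} (hp : X h t ∈ (extChartAt (𝓡 n) p).source) :
    ∀ᶠ z : ℝ × ℝ in 𝓝 (h, t), X z.1 z.2 ∈ (extChartAt (𝓡 n) p).source :=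
  (hcyl.contMDiffAt hcyl.center_mem t).continuousAt.eventually
    ((isOpen_extChartAt_source p).mem_nhds hp)

/-- `familyField` is differentiated in a chart depending on `t`; this is its description in an
arbitrary fixed chart. -/
theorem hasDerivAt_coord {p : M} {t : ℝ} (hp : X h t ∈ (extChartAt (𝓡 n) p).source) :
    HasDerivAt (fun e => extChartAt (𝓡 n) p (X e t))
      (fieldCoord (X h) (familyField X h) p t) h := by
  have hs := mem_extChartAt_source (I := 𝓡 n) (X h t)
  have h1 : HasDerivAt (fun e => extChartAt (𝓡 n) (X h t) (X e t))
      (deriv (fun e => extChartAt (𝓡 n) (X h t) (X e t)) h) h :=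
    ((hcyl.contDiffAt_coord hs).differentiableAt (by simp)).hasDerivAt_fst.differentiableAt.hasDerivAt
  have h2 := ((contDiffAt_chartTransition hs hp).differentiableAt
    (by simp)).hasFDerivAt.comp_hasDerivAt h h1
  have h3 : fderiv ℝ (chartTransition (X h t) p) (extChartAt (𝓡 n) (X h t) (X h t))
      (deriv (fun e => extChartAt (𝓡 n) (X h t) (X e t)) h) =
      fieldCoord (X h) (familyField X h) p t := by
    rw [fderiv_chartTransition]
    rfl
  rw [h3] at h2
  refine h2.congr_of_eventuallyEq ?_
  filter_upwards [(hcyl.eventually_mem_source hs).prodMk_left] with e he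
  exact (chartTransition_extChartAt p he).symm

theorem fieldCoord_eventuallyEq {p : M} {t : ℝ} (hp : X h t ∈ (extChartAt (𝓡 n) p).source) :
    fieldCoord (n := n) (X h) (familyField X h) p =ᶠ[𝓝 t]
      fun s => deriv (fun e => extChartAt (𝓡 n) p (X e s)) h := by
  filter_upwards [(hcyl.eventually_mem_source hp).prodMk_right] with s hs
  exact (hcyl.hasDerivAt_coord hs).deriv.symm

theorem contDiffAt_fieldCoord {p : M} {t : ℝ} (hp : X h t ∈ (extChartAt (𝓡 n) p).source) :
    ContDiffAt ℝ ∞ (fieldCoord (n := n) (X h) (familyField X h) p) t := by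
  have hf := hcyl.contDiffAt_coord hp
  have h1 : ContDiffAt ℝ ∞ (fun s => fderiv ℝ
      (fun z : ℝ × ℝ => extChartAt (𝓡 n) p (X z.1 z.2)) (h, s) (1, 0)) t :=
    (ContDiffAt.comp (f := fun s : ℝ => (h, s)) t (hf.fderiv_right (m := ∞) (by simp))
      (contDiffAt_const.prodMk contDiffAt_id)).clm_apply contDiffAt_const
  refine h1.congr_of_eventuallyEq ?_
  filter_upwards [(hcyl.eventually_mem_source hp).prodMk_right] with s hs
  exact (hcyl.hasDerivAt_coord hs).unique
    ((hcyl.contDiffAt_coord hs).differentiableAt (by simp)).hasDerivAt_fst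

theorem contDiffAt_familyLoopPoint {p : M} {t : ℝ} (hp : X h t ∈ (extChartAt (𝓡 n) p).source) :
    ContDiffAt ℝ ∞ (fun z : ℝ × ℝ => loopPoint (n := n) (X z.1) (P z.1) p z.2) (h, t) := by
  have hf := hcyl.contDiffAt_coord hp
  have h1 : ContDiffAt ℝ ∞ (fun z : ℝ × ℝ => deriv (fun s => extChartAt (𝓡 n) p (X z.1 s)) z.2)
      (h, t) := by
    refine ((hf.fderiv_right (m := ∞) (by simp)).clm_apply
      (contDiffAt_const (c := (0, 1)))).congr_of_eventuallyEq ?_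
    have hd : ContDiffAt ℝ (1 : ℕ) (fun z : ℝ × ℝ => extChartAt (𝓡 n) p (X z.1 z.2)) (h, t) :=
      hf.of_le (by simp)
    filter_upwards [eventually_contDiffAt hd] with z hz
    exact (hz.differentiableAt (by simp)).hasDerivAt_snd.deriv
  exact hf.prodMk (h1.prodMk (ContDiffAt.comp (f := Prod.fst) (h, t) hcyl.contDiffAt_period
    contDiffAt_fst))

/-- Position and period components are immediate; for the velocity component the derivatives in e
and t must be interchanged. -/
theorem hasDerivAt_familyLoopPoint {p : M} {t : ℝ} (hp : X h t ∈ (extChartAt (𝓡 n) p).source) :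
    HasDerivAt (fun e => loopPoint (n := n) (X e) (P e) p t)
      (fieldJet (X h) (familyField X h) (deriv P h) p t) h := by
  have hc := ((hcyl.contDiffAt_familyLoopPoint hp).differentiableAt (by simp)).hasDerivAt_fst
  have hf := hcyl.contDiffAt_coord hp
  set c' := fderiv ℝ (fun z : ℝ × ℝ => loopPoint (n := n) (X z.1) (P z.1) p z.2) (h, t) (1, 0)
  have c1 : HasDerivAt (fun e => extChartAt (𝓡 n) p (X e t)) c'.1 h := hc.fst
  have c2 : HasDerivAt (fun e => deriv (fun s => extChartAt (𝓡 n) p (X e s)) t) c'.2.1 h :=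
    hc.snd.fst
  have c3 : HasDerivAt P c'.2.2 h := hc.snd.snd
  have h1 : c'.1 = fieldCoord (X h) (familyField X h) p t := c1.unique (hcyl.hasDerivAt_coord hp)
  have h2 : HasDerivAt (fun s => deriv (fun e => extChartAt (𝓡 n) p (X e s)) h) c'.2.1 t := by
    refine (hf.of_le ENat.LEInfty.out).hasDerivAt_deriv_swap ?_ c2
    have hd : ContDiffAt ℝ (1 : ℕ) (fun z : ℝ × ℝ => extChartAt (𝓡 n) p (X z.1 z.2)) (h, t) :=
      hf.of_le (by simp)
    filter_upwards [(eventually_contDiffAt hd).prodMk_left] with e he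
    exact (he.differentiableAt (by simp)).hasDerivAt_snd.differentiableAt.hasDerivAt
  have h3 : c'.2.2 = deriv P h := c3.deriv.symm
  have h4 : c' = fieldJet (X h) (familyField X h) (deriv P h) p t := by
    refine Prod.ext h1 (Prod.ext ?_ h3)
    exact ((h2.congr_of_eventuallyEq (hcyl.fieldCoord_eventuallyEq hp)).deriv).symm
  rw [← h4]
  exact hc

theorem familyField_periodic : Function.Periodic (fun t => (familyField (n := n) X h t : 𝔼)) 1 := by
  intro t
  have h1 : X h (t + 1) = X h t := hcyl.periodic hcyl.center_mem t
  change deriv (fun e => extChartAt (𝓡 n) (X h (t + 1)) (X e (t + 1))) h =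
    deriv (fun e => extChartAt (𝓡 n) (X h t) (X e t)) h
  apply Filter.EventuallyEq.deriv_eq
  filter_upwards [hcyl.eventually_mem] with e he
  rw [h1, hcyl.periodic he t]

theorem familyField_mem : familyField (n := n) X h ∈ H1Fields (X h) :=
  mem_H1Fields_of_contDiffAt (hcyl.contMDiff hcyl.center_mem) (hcyl.periodic hcyl.center_mem)
    hcyl.familyField_periodic fun t =>
      (hcyl.contDiffAt_fieldCoord (mem_extChartAt_source (X h t))).of_le (by simp)

theorem contDiffAt_fderiv_familyLoopPoint (hL : ContMDiff (𝓡 n).tangent 𝓘(ℝ, ℝ) ∞ L) {p : M}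
    {t : ℝ} (hp : X h t ∈ (extChartAt (𝓡 n) p).source) :
    ContDiffAt ℝ ∞ (fun z : ℝ × ℝ => fderiv ℝ (actionCoord L h p)
      (loopPoint (X z.1) (P z.1) p z.2)) (h, t) :=
  ContDiffAt.comp (f := fun z : ℝ × ℝ => loopPoint (X z.1) (P z.1) p z.2) (h, t)
    ((contDiffAt_actionCoord hL h (loopPoint_mem_target (P h) hp)
      (hcyl.period_pos hcyl.center_mem).ne').fderiv_right (m := ∞) (by simp))
    (hcyl.contDiffAt_familyLoopPoint hp)

theorem hasDerivAt_fderiv_familyLoopPoint (hL : ContMDiff (𝓡 n).tangent 𝓘(ℝ, ℝ) ∞ L) {p : M}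
    {t : ℝ} (hp : X h t ∈ (extChartAt (𝓡 n) p).source) (w : 𝔼 × 𝔼 × ℝ) :
    HasDerivAt (fun e => fderiv ℝ (actionCoord L h p) (loopPoint (X e) (P e) p t) w)
      (fderiv ℝ (fderiv ℝ (actionCoord L h p)) (loopPoint (X h) (P h) p t)
        (fieldJet (X h) (familyField X h) (deriv P h) p t) w) h := by
  have hG : ContDiffAt ℝ 2 (actionCoord L h p) (loopPoint (X h) (P h) p t) :=
    (contDiffAt_actionCoord hL h (loopPoint_mem_target (P h) hp)
      (hcyl.period_pos hcyl.center_mem).ne').of_le ENat.LEInfty.out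
  exact (hG.differentiableAt_fderiv.hasFDerivAt.comp_hasDerivAt
    (f := fun e => loopPoint (X e) (P e) p t) h
    (hcyl.hasDerivAt_familyLoopPoint hp)).clm_apply_const w

theorem eventually_critical {p : M} {t : ℝ} (hp : X h t ∈ (extChartAt (𝓡 n) p).source) :
    ∀ᶠ e in 𝓝 h, e ∈ Ioo (h - ε) (h + ε) ∧ X e t ∈ (extChartAt (𝓡 n) p).source :=
  hcyl.eventually_mem.and (hcyl.eventually_mem_source hp).prodMk_left

/-- The linearized Euler-Lagrange equation for the derivative of the family of loops. -/
theorem hasDerivAt_jacobi (hL : ContMDiff (𝓡 n).tangent 𝓘(ℝ, ℝ) ∞ L) {p : M} {t : ℝ}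
    (hp : X h t ∈ (extChartAt (𝓡 n) p).source) (v : 𝔼) :
    HasDerivAt (fun s => fderiv ℝ (fderiv ℝ (actionCoord L h p)) (loopPoint (X h) (P h) p s)
        (fieldJet (X h) (familyField X h) (deriv P h) p s) (0, v, 0))
      (fderiv ℝ (fderiv ℝ (actionCoord L h p)) (loopPoint (X h) (P h) p t)
        (fieldJet (X h) (familyField X h) (deriv P h) p t) (v, 0, 0)) t := by
  have hf : ContDiffAt ℝ 2 (fun z : ℝ × ℝ => fderiv ℝ (actionCoord L h p)
      (loopPoint (X z.1) (P z.1) p z.2) (0, v, 0)) (h, t) :=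
    ((hcyl.contDiffAt_fderiv_familyLoopPoint hL hp).clm_apply contDiffAt_const).of_le
      ENat.LEInfty.out
  have hdiff : ∀ e ∈ Ioo (h - ε) (h + ε), ∀ s, X e s ∈ (extChartAt (𝓡 n) p).source →
      DifferentiableAt ℝ (actionCoord L h p) (loopPoint (X e) (P e) p s) := fun e he s hs =>
    (contDiffAt_actionCoord hL h (loopPoint_mem_target (P e) hs)
      (hcyl.period_pos he).ne').differentiableAt (by simp)
  have h1 := hf.hasDerivAt_deriv_swap (g := fun e =>
    fderiv ℝ (actionCoord L h p) (loopPoint (X e) (P e) p t) (v, 0, 0)) ?_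
    (hcyl.hasDerivAt_fderiv_familyLoopPoint hL hp _)
  · refine h1.congr_of_eventuallyEq ?_
    filter_upwards [(hcyl.eventually_mem_source hp).prodMk_right] with s hs
    exact (hcyl.hasDerivAt_fderiv_familyLoopPoint hL hs (0, v, 0)).deriv.symm
  · filter_upwards [hcyl.eventually_critical hp] with e he
    -- Each neighbouring loop is critical at its own energy e. The change of energy is invisible to
    -- vectors without period component, so the equation can be rewritten for the fixed density at
    -- energy h.
    have h2 := hasDerivAt_fderiv_velocity g hL (hcyl.contMDiff he.1) (hcyl.periodic he.1)
      (hcyl.period_pos he.1).ne' (hcyl.critical e he.1).2.2 he.2 v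
    rw [fderiv_actionCoord_energy e (hdiff e he.1 t he.2)] at h2
    simp only [mul_zero, add_zero] at h2
    refine h2.congr_of_eventuallyEq ?_
    filter_upwards [_root_.eventually_mem_source (hcyl.contMDiff he.1).continuous he.2] with s hs
    rw [fderiv_actionCoord_energy e (hdiff e he.1 s hs)]
    simp

/-- The linearized energy identity for the derivative of the family of loops. -/
theorem fderiv_fderiv_period (hL : ContMDiff (𝓡 n).tangent 𝓘(ℝ, ℝ) ∞ L) {p : M} {t : ℝ}
    (hp : X h t ∈ (extChartAt (𝓡 n) p).source) :
    fderiv ℝ (fderiv ℝ (actionCoord L h p)) (loopPoint (X h) (P h) p t)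
      (fieldJet (X h) (familyField X h) (deriv P h) p t) (0, 0, 1) = -1 := by
  refine (hcyl.hasDerivAt_fderiv_familyLoopPoint hL hp (0, 0, 1)).unique ?_
  have h1 : HasDerivAt (fun e : ℝ => -(e - h)) (-1) h := ((hasDerivAt_id h).sub_const h).neg
  refine h1.congr_of_eventuallyEq ?_
  -- The energy identity at level e, expressed through the density at level h, reads ∂_τG = -(e -
  -- h); its derivative in e gives the right-hand side -1.
  filter_upwards [hcyl.eventually_critical hp] with e he
  have h2 := fderiv_period_eq_zero g hL (hcyl.contMDiff he.1) (hcyl.periodic he.1)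
    (hcyl.period_pos he.1).ne' (hcyl.critical e he.1).2.2 he.2
  rw [fderiv_actionCoord_energy e ((contDiffAt_actionCoord hL h (loopPoint_mem_target (P e) he.2)
    (hcyl.period_pos he.1).ne').differentiableAt (by simp))] at h2
  linarith

end

end IsOrbitCylinder

end OrbitCylinder

/-! ### The cylinder direction is dual to the period variable. -/

section CylinderIdentity

open Filter Topology

variable {n : ℕ} {M : Type*} [TopologicalSpace M] [ChartedSpace (EuclideanSpace ℝ (Fin n)) M]
  [IsManifold (𝓡 n) ∞ M]

local notation "𝔼" => EuclideanSpace ℝ (Fin n)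

/-- The boundary term in the second variation, for the fields `ξ` and `η`, in the coordinates
around `p`. -/
def jacobiMomentum (g : SmoothMetric n M) (L : TangentBundle (𝓡 n) M → ℝ) (h : ℝ) (x : ℝ → M)
    (T : ℝ) (ξ : ∀ t, TangentSpace (𝓡 n) (x t)) (b : ℝ) (η : ∀ t, TangentSpace (𝓡 n) (x t))
    (p : M) (t : ℝ) : ℝ :=
  hessForm (actionCoord L h p) (christoffelBilin g p) (loopPoint x T p t) (fieldJet x ξ b p t)
    (0, fieldCoord x η p t, 0)

theorem hessForm_velocity_right {V : Type*} [NormedAddCommGroup V] [NormedSpace ℝ V]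
    (G : V × V × ℝ → ℝ) (Γ : V → V →L[ℝ] V →L[ℝ] V) (y z : V × V × ℝ) (v : V) :
    hessForm G Γ y z (0, v, 0) =
      fderiv ℝ (fderiv ℝ G) y z (0, v, 0) - fderiv ℝ G y (0, Γ y.1 z.1 v, 0) := by
  simp [hessForm]

/-- The vector (0,η,0) is vertical, so it transforms by Dφ alone and no derivative of η is required;
chart invariance of `hessForm` does the rest. -/
theorem jacobiMomentum_trans (g : SmoothMetric n M) {L : TangentBundle (𝓡 n) M → ℝ}
    (hL : ContMDiff (𝓡 n).tangent 𝓘(ℝ, ℝ) ∞ L) (h : ℝ) {x : ℝ → M}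
    (hx : ContMDiff 𝓘(ℝ, ℝ) (𝓡 n) ∞ x) {T : ℝ} (hT : T ≠ 0)
    {ξ : ∀ t, TangentSpace (𝓡 n) (x t)} (b : ℝ) (η : ∀ t, TangentSpace (𝓡 n) (x t)) {p p' : M}
    {t : ℝ} (hp : x t ∈ (extChartAt (𝓡 n) p).source) (hp' : x t ∈ (extChartAt (𝓡 n) p').source)
    (hξ : DifferentiableAt ℝ (fieldCoord x ξ p) t) :
    jacobiMomentum g L h x T ξ b η p t = jacobiMomentum g L h x T ξ b η p' t := by
  have hφ : ContDiffAt ℝ 2 (chartTransition p p') (loopPoint x T p t).1 :=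
    (contDiffAt_chartTransition hp hp').of_le ENat.LEInfty.out
  unfold jacobiMomentum
  rw [hessForm_chart g hL h hp hp' rfl hT, velocityMap_loopPoint hx T hp hp',
    fderiv_velocityMap_fieldJet hx T b hp hp' hξ, fderiv_velocityMap hφ]
  congr 1
  refine Prod.ext ?_ (Prod.ext ?_ rfl)
  · simp
  · simp only [map_zero, _root_.zero_apply, zero_add]
    exact fieldCoord_trans η hp hp'

theorem jacobiMomentum_periodic (g : SmoothMetric n M) (L : TangentBundle (𝓡 n) M → ℝ) (h : ℝ)
    {x : ℝ → M} (hper : Function.Periodic x 1) (T : ℝ) {ξ η : ∀ t, TangentSpace (𝓡 n) (x t)}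
    (hξ : Function.Periodic (fun t => (ξ t : 𝔼)) 1) (hη : Function.Periodic (fun t => (η t : 𝔼)) 1)
    (b : ℝ) : Function.Periodic (fun t => jacobiMomentum g L h x T ξ b η (x t) t) 1 := by
  intro t
  simp only [jacobiMomentum]
  rw [hper t, loopPoint_periodic hper T _ t, fieldJet_periodic hper hξ b _ t,
    fieldCoord_periodic hper hη _ t]

namespace IsOrbitCylinder

variable {g : SmoothMetric n M} {L : TangentBundle (𝓡 n) M → ℝ} {h : ℝ} {x : ℝ → M} {T ε : ℝ}
  {X : ℝ → ℝ → M} {P : ℝ → ℝ} (hcyl : IsOrbitCylinder g L h x T ε X P)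
include hcyl

theorem contDiffAt_fieldJet {p : M} {t : ℝ} (hp : X h t ∈ (extChartAt (𝓡 n) p).source) (b : ℝ) :
    ContDiffAt ℝ ∞ (fieldJet (n := n) (X h) (familyField X h) b p) t := by
  have h1 := hcyl.contDiffAt_fieldCoord hp
  have h2 : ContDiffAt ℝ ∞ (deriv (fieldCoord (n := n) (X h) (familyField X h) p)) t := by
    have h3 : deriv (fieldCoord (n := n) (X h) (familyField X h) p) =
        fun t => fderiv ℝ (fieldCoord (n := n) (X h) (familyField X h) p) t 1 :=
      funext fun t => fderiv_apply_one_eq_deriv.symm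
    rw [h3]
    exact (h1.fderiv_right (m := ∞) (by simp)).clm_apply contDiffAt_const
  exact h1.prodMk (h2.prodMk contDiffAt_const)

theorem contDiffAt_fderiv_fderiv_fieldJet (hL : ContMDiff (𝓡 n).tangent 𝓘(ℝ, ℝ) ∞ L) {p : M}
    {t : ℝ} (hp : X h t ∈ (extChartAt (𝓡 n) p).source) (b : ℝ) :
    ContDiffAt ℝ ∞ (fun s => fderiv ℝ (fderiv ℝ (actionCoord L h p)) (loopPoint (X h) (P h) p s)
      (fieldJet (X h) (familyField X h) b p s)) t := by
  have hx := hcyl.contMDiff hcyl.center_mem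
  have hT := (hcyl.period_pos hcyl.center_mem).ne'
  have h1 := ((contDiffAt_actionCoord hL h (loopPoint_mem_target (P h) hp) hT).fderiv_right
    (m := ∞) (by simp)).fderiv_right (m := ∞) (by simp)
  exact (ContDiffAt.comp (f := loopPoint (X h) (P h) p) t h1
    (contDiffAt_loopPoint hx (P h) hp)).clm_apply (hcyl.contDiffAt_fieldJet hp b)

-- Separates the smooth covector from the merely H¹ field η, so that the product rule for H¹
-- functions applies to the boundary term.
set_option synthInstance.maxHeartbeats 200000 in
theorem exists_jacobiMomentum_eq (hL : ContMDiff (𝓡 n).tangent 𝓘(ℝ, ℝ) ∞ L) (p : M) (b : ℝ) :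
    ∃ R : ℝ → 𝔼 →L[ℝ] ℝ, (∀ t, X h t ∈ (extChartAt (𝓡 n) p).source → ContDiffAt ℝ 1 R t) ∧
      ∀ (η : ∀ t, TangentSpace (𝓡 n) (X h t)) (t : ℝ),
        jacobiMomentum g L h (X h) (P h) (familyField X h) b η p t =
          R t (fieldCoord (X h) η p t) := by
  have hx := hcyl.contMDiff hcyl.center_mem
  have hT := (hcyl.period_pos hcyl.center_mem).ne'
  let J : 𝔼 →L[ℝ] 𝔼 × 𝔼 × ℝ :=
    (ContinuousLinearMap.inr ℝ 𝔼 (𝔼 × ℝ)).comp (ContinuousLinearMap.inl ℝ 𝔼 ℝ)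
  refine ⟨fun t => (fderiv ℝ (fderiv ℝ (actionCoord L h p)) (loopPoint (X h) (P h) p t)
      (fieldJet (X h) (familyField X h) b p t)).comp J -
      (fderiv ℝ (actionCoord L h p) (loopPoint (X h) (P h) p t)).comp
        (J.comp (christoffelBilin g p (extChartAt (𝓡 n) p (X h t))
          (fieldCoord (X h) (familyField X h) p t))), fun t ht => ?_, fun η t => ?_⟩
  · have hΓ : ContDiffAt ℝ ∞ (fun s => christoffelBilin g p (extChartAt (𝓡 n) p (X h s))) t :=
      ContDiffAt.comp (f := fun s => extChartAt (𝓡 n) p (X h s)) t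
        (contDiffAt_christoffelBilin g ht) (contDiffAt_loopCoord hx ht)
    have h1 := (hcyl.contDiffAt_fderiv_fderiv_fieldJet hL ht b).clm_comp
      (contDiffAt_const (c := J))
    have h2 := (contDiffAt_fderiv_loopPoint (h := h) hL hx hT ht).clm_comp
      ((contDiffAt_const (c := J)).clm_comp (hΓ.clm_apply (hcyl.contDiffAt_fieldCoord ht)))
    exact (h1.sub h2).of_le (by simp)
  · rw [jacobiMomentum, hessForm_velocity_right]
    rfl

/-- The second variation in the direction of the orbit cylinder is a boundary term. -/
theorem hasDerivAt_jacobiMomentum (hL : ContMDiff (𝓡 n).tangent 𝓘(ℝ, ℝ) ∞ L) {p : M} {t : ℝ}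
    (hp : X h t ∈ (extChartAt (𝓡 n) p).source) {η : ∀ t, TangentSpace (𝓡 n) (X h t)} (c : ℝ)
    (hη : DifferentiableAt ℝ (fieldCoord (X h) η p) t) :
    HasDerivAt (jacobiMomentum g L h (X h) (P h) (familyField X h) (deriv P h) η p)
      (secondDensity g L h (X h) (P h) p (familyField X h) (deriv P h) η c t + c) t := by
  have hx := hcyl.contMDiff hcyl.center_mem
  have hT := (hcyl.period_pos hcyl.center_mem).ne'
  have hA := ((hcyl.contDiffAt_fderiv_fderiv_fieldJet hL hp (deriv P h)).differentiableAt
    (by simp)).hasDerivAt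
  -- The linearized Euler-Lagrange equation gives the derivative of the Hessian covector on vertical
  -- vectors; adding the motion of η yields the Hessian paired with (η,η',0).
  have hA1 := (hA.clm_apply_const (0, fieldCoord (X h) η p t, 0)).unique
    (hcyl.hasDerivAt_jacobi hL hp (fieldCoord (X h) η p t))
  have h2 : HasDerivAt (fun s => ((0, fieldCoord (X h) η p s, 0) : 𝔼 × 𝔼 × ℝ))
      (0, deriv (fieldCoord (X h) η p) t, 0) t :=
    (hasDerivAt_const t 0).prodMk (hη.hasDerivAt.prodMk (hasDerivAt_const t 0))
  have h3 := hA.clm_apply h2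
  rw [hA1, ← map_add] at h3
  have h4 := HasDerivAt.bilin_comp_apply
    ((contDiffAt_christoffelBilin g hp).differentiableAt (by simp))
    ((contDiffAt_loopCoord hx hp).differentiableAt (by simp)).hasDerivAt
    ((hcyl.contDiffAt_fieldCoord hp).differentiableAt (by simp)).hasDerivAt hη.hasDerivAt
  -- By the Euler-Lagrange equation the Christoffel correction is itself a total derivative, namely
  -- that of the momentum paired with Γ(ζ,η).
  have h5 := hasDerivAt_fderiv_velocity_apply g hL hx (hcyl.periodic hcyl.center_mem) hT
    (hcyl.critical h hcyl.center_mem).2.2 hp h4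
  have h6 : jacobiMomentum g L h (X h) (P h) (familyField X h) (deriv P h) η p = fun s =>
      fderiv ℝ (fderiv ℝ (actionCoord L h p)) (loopPoint (X h) (P h) p s)
        (fieldJet (X h) (familyField X h) (deriv P h) p s) (0, fieldCoord (X h) η p s, 0) -
      fderiv ℝ (actionCoord L h p) (loopPoint (X h) (P h) p s)
        (0, christoffelBilin g p (extChartAt (𝓡 n) p (X h s))
          (fieldCoord (X h) (familyField X h) p s) (fieldCoord (X h) η p s), 0) := by
    ext s
    exact hessForm_velocity_right _ _ _ _ _
  rw [h6]
  refine (h3.fun_sub h5).congr_deriv ?_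
  -- The period component c of the test vector contributes -c to the density, which is the source of
  -- the extra summand c.
  have h7 := hcyl.fderiv_fderiv_period hL hp
  have h8 : fieldJet (X h) η c p t =
      ((fieldCoord (X h) η p t, 0, 0) + (0, deriv (fieldCoord (X h) η p) t, 0)) +
        c • ((0, 0, 1) : 𝔼 × 𝔼 × ℝ) := by
    simp [fieldJet]
  rw [secondDensity, hessForm]
  conv_rhs => rw [h8, map_add, map_smul, h7]
  simp only [smul_eq_mul, mul_neg, mul_one, Prod.fst_add, Prod.snd_add, Prod.smul_fst,
    Prod.smul_snd, smul_zero, add_zero, zero_add]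
  simp only [loopPoint, fieldJet]
  ring

/-- The density plus c is the derivative of a periodic absolutely continuous function, so its
integral over a period vanishes. -/
theorem indexForm_familyField (hL : ContMDiff (𝓡 n).tangent 𝓘(ℝ, ℝ) ∞ L)
    (hx : ContMDiff 𝓘(ℝ, ℝ) (𝓡 n) ∞ (X h)) (hper : Function.Periodic (X h) 1) (hT : P h ≠ 0)
    (w : h1Submodule hx hper × ℝ) :
    indexForm g h hL hx hper hT (⟨familyField X h, hcyl.familyField_mem⟩, deriv P h) w = -w.2 := by
  obtain ⟨⟨η, hη⟩, c⟩ := w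
  rw [indexForm_apply]
  set F : ℝ → ℝ := fun t =>
    jacobiMomentum g L h (X h) (P h) (familyField X h) (deriv P h) η (X h t) t with hF
  have hFp : ∀ p t, X h t ∈ (extChartAt (𝓡 n) p).source →
      F t = jacobiMomentum g L h (X h) (P h) (familyField X h) (deriv P h) η p t := fun p t hp =>
    jacobiMomentum_trans g hL h hx hT _ η (mem_extChartAt_source _) hp
      ((hcyl.contDiffAt_fieldCoord (mem_extChartAt_source _)).differentiableAt (by simp))
  -- Centre 1/2 and radius 1/2 describe [0,1]. Since η is only H¹, the fundamental theorem needs F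
  -- to be a genuine primitive of its derivative, which is checked locally in fixed charts.
  have hprim : IsH1Primitive F (deriv F) (1 / 2) (1 / 2) := by
    refine isH1Primitive_of_local (by norm_num) fun t₀ _ => ?_
    obtain ⟨δ, hδ, hsrc⟩ := exists_forall_Icc_mem_source (n := n) hx.continuous t₀
    obtain ⟨R, hR, hRF⟩ := hcyl.exists_jacobiMomentum_eq (g := g) hL (X h t₀) (deriv P h)
    refine ⟨δ, _, ((isH1Primitive_fieldCoord hx hper hη hδ hsrc).covector_apply
      fun t ht => hR t (hsrc t ht)).congr fun t ht => ?_⟩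
    rw [hFp _ t (hsrc t ht), hRF]
  have hae : ∀ᵐ t, deriv F t = secondDensity g L h (X h) (P h) (X h t) (familyField X h)
      (deriv P h) η c t + c := by
    filter_upwards [ae_differentiableAt_fieldCoord hx hper hη] with t ht
    have hs := mem_extChartAt_source (I := 𝓡 n) (X h t)
    refine ((hcyl.hasDerivAt_jacobiMomentum hL hs c ht).congr_of_eventuallyEq ?_).deriv
    filter_upwards [_root_.eventually_mem_source hx.continuous hs] with s hs'
    exact hFp _ s hs'
  have h1 := hprim.sub_eq_integral (a := 0) (b := 1) (by norm_num) (by norm_num)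
  have h2 : F 1 = F 0 := by
    have := jacobiMomentum_periodic g L h hper (P h) hcyl.familyField_periodic
      ((mem_H1Fields_iff hx hper).1 hη).1 (deriv P h) 0
    rwa [zero_add] at this
  rw [h2, sub_self, intervalIntegral.integral_congr_ae (g := fun t =>
    secondDensity g L h (X h) (P h) (X h t) (familyField X h) (deriv P h) η c t + c)
    (by filter_upwards [hae] with t ht _ using ht),
    intervalIntegral.integral_add (intervalIntegrable_secondDensity g h hL hx hper hT
      hcyl.familyField_mem hη _ _ _ _) intervalIntegrable_const] at h1
  simp only [intervalIntegral.integral_const, sub_zero, one_smul] at h1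
  change (∫ t in (0 : ℝ)..1, secondDensity g L h (X h) (P h) (X h t) (familyField X h)
    (deriv P h) η c t) = -c
  linarith

end IsOrbitCylinder

end CylinderIdentity

end

theorem mainTheorem4 {n : ℕ} {M : Type*} [TopologicalSpace M] [T2Space M]
    [ChartedSpace (EuclideanSpace ℝ (Fin n)) M] [IsManifold (𝓡 n) ∞ M]
    (g : SmoothMetric n M)
    (L : TangentBundle (𝓡 n) M → ℝ) (hL : ContMDiff (𝓡 n).tangent 𝓘(ℝ, ℝ) ∞ L)
    (hquad : IsExactlyQuadratic L) (hconv : IsFiberStrictlyConvex L)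
    (h : ℝ) (x : ℝ → M) (T : ℝ) (hcrit : IsFreePeriodCritical g L h x T)
    (ε : ℝ) (X : ℝ → ℝ → M) (P : ℝ → ℝ) (hcyl : IsOrbitCylinder g L h x T ε X P) :
    freeMorseIndex g L h x T ≠ ⊤ ∧ fixedMorseIndex g L h x T ≠ ⊤ ∧
      ((freeMorseIndex g L h x T).toNat : ℤ) - ((fixedMorseIndex g L h x T).toNat : ℤ) =
        if 0 ≤ deriv P h then 1 else 0 := by
  obtain rfl := hcyl.loop_eq
  obtain rfl := hcyl.period_eq
  have hx := hcyl.contMDiff hcyl.center_mem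
  have hper := hcyl.periodic hcyl.center_mem
  have hT := hcyl.period_pos hcyl.center_mem
  have hfin := fixedMorseIndex_ne_top g h hL hconv hx hper hT
  rw [freeMorseIndex_eq g h hL hx hper hT.ne', fixedMorseIndex_eq g h hL hx hper hT.ne']
  -- The abstract index formula is applied with z the velocity of the cylinder, whose second
  -- component is the derivative of the period.
  obtain ⟨hfree, hdiff⟩ := morseIndex_prod_sub (indexForm g h hL hx hper hT.ne')
    (indexForm_symm g h hL hx hper hT.ne')
    (⟨familyField X h, hcyl.familyField_mem⟩, deriv P h)
    (hcyl.indexForm_familyField hL hx hper hT.ne') hfin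
  exact ⟨hfree, hfin, hdiff⟩
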